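/- Let $K$ be a field, $\varphi$ a ring endomorphism of $K$, and $R=K[t;\varphi]$ the ring of formal finite sums $\sum_i t^i a_i$ ($a_i\in K$) with $at=t\varphi(a)$. All modules are right $R$-modules. An element $r \in R$ is called separable if $t$ does not divide it, i.e. $r\notin tR$. A module $M$ is divisible if $M.r=M$ for all $r\neq 0$. A $\tau$-chain is a linear order $\Delta$ with maximum $\infty$ and a strictly increasing map $\tau:\Delta\to\Delta$ with $\tau(\infty)=\infty$ such that $\tau(\gamma)\le\gamma$, $\gamma\ne\infty$ and $\delta<\gamma$ imply $\tau(\delta)<\delta$. We write $\gamma>\theta$ if $\tau(\gamma)>\gamma$ or $\gamma=\infty$. A valued module is a module $M$ with a surjection $v:M\to\Delta$ onto a $\tau$-chain such that $v(x)=\infty$ iff $x=0$; $v(x\pm y)\ge\min\{v(x),v(y)\}$; $x\mapsto x.t$ is injective; $v(x.\lambda)=v(x)$ for $\lambda\in K^\times$; and $v(x.t)=\tau(v(x))$. It is henselian if for all separable $r\in R$ and all $x\in M$ with $v(x)>\theta$ there is $y\in M$ with $x=y.r$ and $v(y)>\theta$. Let $L$ be the two-sorted language consisting of $L_{Mod}(R)=\{0,+,-,(.r)_{r\in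 R}\}$ on the module sort, $L_V=\{\le,\tau,\infty,(R_n)_{n\in\mathbb N}\}$ on the value sort, and a function symbol $v$ from the module sort to the value sort. In a valued module, for $\gamma\neq\infty$, $R_n(\gamma)$ is interpreted as $|M_{\ge\gamma}/M_{>\gamma}|\ge n$, where $M_{\ge\gamma}=\{x: v(x)\ge\gamma\}$ and $M_{>\gamma}=\{x: v(x)>\gamma\}$; the truth values of the $R_n(\infty)$ may be fixed arbitrarily. Let $(F,v(F))$ be a non-zero henselian divisible valued $R$-module. Let $T_h$ be the $L$-theory of henselian valued modules (including the above condition on the $R_n$), $T_v$ the complete $L_V$-theory of $v(F)$, and $\mathrm{Tor}_F$ the $L_{Mod}(R)$-theory of non-zero divisible $R$-modules together with, for every $r\in R$, sentences saying that the number of $x$ with $x.r=0$ is the same element of $\mathbb N\cup\{\infty\}$ as in $F$. Put $\mathbf T=T_h\cup T_v\cup\mathrm{Tor}_F$. Let $\Theta_v$ be the set of $L$-formulas $$\xi(\bar x)\wedge Q\bar y_1\;\psi(\bar y_1,\bar y_2,v(t_1(\bar x)),\dots,v(t_k(\bar x)))$$ with $\xi$ a quantifier-free $L_{Mod}(R)$-formula,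 $\psi$ a quantifier-free $L_V$-formula, $Q$ a sequence of quantifiers over $\bar y_1$, $\bar x$ a tuple of module variables, $\bar y_1,\bar y_2$ tuples of value variables, and $t_1,\dots,t_k$ $L_{Mod}(R)$-terms. **Theorem.** The theory $\mathbf T$ is complete (it has a model and decides every $L$-sentence), and it eliminates quantifiers on the module sort: every $L$-formula with free variables $\bar x$ (module sort) and $\bar y_2$ (value sort) is equivalent modulo $\mathbf T$ to a formula of $\Theta_v$ in these variables. -/

import Mathlib

universe u

noncomputable section

/-! ## The twisted polynomial ring `K[t; φ]` -/

/-- The ring `K[t; φ]`: formal finite sums `∑ tⁱ aᵢ` with coefficients on the right, where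
`a t = t φ(a)`. -/
def TwistedPoly {K : Type u} [Field K] (_φ : K →+* K) : Type u := ℕ →₀ K

namespace TwistedPoly

variable {K : Type u} [Field K] (φ : K →+* K)

instance : AddCommGroup (TwistedPoly φ) := inferInstanceAs (AddCommGroup (ℕ →₀ K))

variable {φ}

/-- The `i`-th coefficient. -/
def coeff (p : TwistedPoly φ) (i : ℕ) : K := DFunLike.coe (F := ℕ →₀ K) p i

@[ext] theorem ext {p q : TwistedPoly φ} (h : ∀ i, p.coeff i = q.coeff i) : p = q :=
  Finsupp.ext h

@[simp] theorem coeff_add (p q : TwistedPoly φ) (i : ℕ) :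
    (p + q).coeff i = p.coeff i + q.coeff i := rfl

@[simp] theorem coeff_zero (i : ℕ) : (0 : TwistedPoly φ).coeff i = 0 := rfl

variable (φ)

/-- The monomial `tⁱ a`, as an additive map in `a`. -/
def monomial (i : ℕ) : K →+ TwistedPoly φ := (Finsupp.singleAddHom i : K →+ (ℕ →₀ K))

theorem coeff_monomial (i j : ℕ) (a : K) :
    (monomial φ i a).coeff j = if i = j then a else 0 := Finsupp.single_apply

variable {φ}

@[elab_as_elim]
theorem induction_add {P : TwistedPoly φ → Prop} (p : TwistedPoly φ) (h0 : P 0)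
    (hm : ∀ i a, P (monomial φ i a)) (ha : ∀ p q, P p → P q → P (p + q)) : P p :=
  Finsupp.induction_linear (motive := P) p h0 ha hm

/-- The product of `∑ tᵏ aₖ` and `∑ tˡ bₗ` is `∑ tᵏ⁺ˡ φˡ(aₖ) bₗ`. -/
instance : Mul (TwistedPoly φ) :=
  ⟨fun p q => Finsupp.sum (α := ℕ) (M := K) p fun k a =>
    Finsupp.sum (α := ℕ) (M := K) q fun l b => monomial φ (k + l) ((φ ^ l) a * b)⟩

theorem mul_def (p q : TwistedPoly φ) : p * q = Finsupp.sum (α := ℕ) (M := K) p fun k a =>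
    Finsupp.sum (α := ℕ) (M := K) q fun l b => monomial φ (k + l) ((φ ^ l) a * b) := rfl

theorem monomial_mul_monomial (k l : ℕ) (a b : K) :
    monomial φ k a * monomial φ l b = monomial φ (k + l) ((φ ^ l) a * b) := by
  rw [mul_def]
  change Finsupp.sum (Finsupp.single k a) (fun k a =>
    Finsupp.sum (Finsupp.single l b) fun l b => monomial φ (k + l) ((φ ^ l) a * b)) = _
  rw [Finsupp.sum_single_index (by simp), Finsupp.sum_single_index (by simp)]

protected theorem zero_mul (p : TwistedPoly φ) : 0 * p = 0 := Finsupp.sum_zero_index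

protected theorem mul_zero (p : TwistedPoly φ) : p * 0 = 0 := by
  rw [mul_def]
  exact Finset.sum_eq_zero fun _ _ => Finsupp.sum_zero_index

protected theorem right_distrib (p q r : TwistedPoly φ) : (p + q) * r = p * r + q * r := by
  refine Finsupp.sum_add_index' (fun k => ?_) (fun k a b => ?_)
  · exact Finset.sum_eq_zero fun l _ => by simp
  · refine Eq.trans (Finset.sum_congr rfl fun l _ => ?_) Finset.sum_add_distrib
    beta_reduce
    rw [map_add, add_mul, map_add]

protected theorem left_distrib (p q r : TwistedPoly φ) : p * (q + r) = p * q + p * r := by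
  refine Eq.trans (Finset.sum_congr rfl fun k _ => ?_) Finset.sum_add_distrib
  exact Finsupp.sum_add_index' (fun l => by simp) (fun l a b => by rw [mul_add, map_add])

/-- Multiplication is associative on monomials, hence everywhere. -/
protected theorem mul_assoc (p q r : TwistedPoly φ) : p * q * r = p * (q * r) := by
  induction p using induction_add with
  | h0 => simp only [TwistedPoly.zero_mul]
  | ha p p' hp hp' => simp only [TwistedPoly.right_distrib, hp, hp']
  | hm i a =>
    induction q using induction_add with
    | h0 => simp only [TwistedPoly.zero_mul, TwistedPoly.mul_zero]
    | ha q q' hq hq' => simp only [TwistedPoly.right_distrib, TwistedPoly.left_distrib, hq, hq']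
    | hm j b =>
      induction r using induction_add with
      | h0 => simp only [TwistedPoly.mul_zero]
      | ha r r' hr hr' => simp only [TwistedPoly.left_distrib, hr, hr']
      | hm k c =>
        simp only [monomial_mul_monomial, map_mul, add_assoc, mul_assoc, add_comm j k, pow_add,
          RingHom.mul_def, RingHom.comp_apply]

/-- The multiplication formula for coefficients. -/
theorem coeff_mul (p q : TwistedPoly φ) (i : ℕ) :
    (p * q).coeff i =
      ∑ kl ∈ Finset.HasAntidiagonal.antidiagonal i, (φ ^ kl.2) (p.coeff kl.1) * q.coeff kl.2 := by
  induction p using induction_add with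
  | h0 => simp [TwistedPoly.zero_mul]
  | ha p p' hp hp' => simp [TwistedPoly.right_distrib, hp, hp', add_mul, Finset.sum_add_distrib]
  | hm k a =>
    induction q using induction_add with
    | h0 => simp [TwistedPoly.mul_zero]
    | ha q q' hq hq' => simp [TwistedPoly.left_distrib, hq, hq', mul_add, Finset.sum_add_distrib]
    | hm l b =>
      rw [monomial_mul_monomial, coeff_monomial]
      simp only [coeff_monomial]
      split_ifs with h
      · rw [Finset.sum_eq_single (k, l)]
        · simp
        · rintro ⟨k', l'⟩ _ hne
          by_cases hk : k = k'
          · have : l ≠ l' := fun hl => hne (by rw [hk, hl])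
            simp [this]
          · simp [hk]
        · simp [h]
      · refine (Finset.sum_eq_zero ?_).symm
        rintro ⟨k', l'⟩ hkl
        rw [Finset.HasAntidiagonal.mem_antidiagonal] at hkl
        by_cases hk : k = k'
        · have : l ≠ l' := fun hl => h (by rw [hk, hl]; exact hkl)
          simp [this]
        · simp [hk]

instance : Ring (TwistedPoly φ) where
  __ := (inferInstance : AddCommGroup (TwistedPoly φ))
  zero_mul := TwistedPoly.zero_mul
  mul_zero := TwistedPoly.mul_zero
  left_distrib := TwistedPoly.left_distrib
  right_distrib := TwistedPoly.right_distrib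
  mul_assoc := TwistedPoly.mul_assoc
  one := monomial φ 0 1
  one_mul p := by
    change monomial φ 0 1 * p = p
    induction p using induction_add with
    | h0 => simp only [TwistedPoly.mul_zero]
    | ha p q hp hq => simp only [TwistedPoly.left_distrib, hp, hq]
    | hm i a => rw [monomial_mul_monomial, map_one, one_mul, zero_add]
  mul_one p := by
    change p * monomial φ 0 1 = p
    induction p using induction_add with
    | h0 => simp only [TwistedPoly.zero_mul]
    | ha p q hp hq => simp only [TwistedPoly.right_distrib, hp, hq]
    | hm i a => rw [monomial_mul_monomial]; simp

variable (φ)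

/-- The indeterminate `t`. -/
def t : TwistedPoly φ := monomial φ 1 1

/-- The constant polynomial `a`. -/
def C (a : K) : TwistedPoly φ := monomial φ 0 a

theorem C_mul_t (a : K) : C φ a * t φ = t φ * C φ (φ a) := by
  simp [C, t, monomial_mul_monomial]

variable {φ}

/-- `r` is separable if `t` does not divide it, i.e. `r` is not of the form `t s`. -/
def IsSeparable (r : TwistedPoly φ) : Prop := ¬ ∃ s, r = t φ * s

end TwistedPoly

/-! ## Valued modules

Right modules over `R` are modules over `Rᵐᵒᵖ`, and `MulOpposite.op r • x` is `x.r`. -/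

/-- A `τ`-chain: a linear order with maximum `∞ = ⊤` and a strictly increasing `τ`. -/
structure IsTauChain {Δ : Type u} [LinearOrder Δ] [OrderTop Δ] (τ : Δ → Δ) : Prop where
  strictMono : StrictMono τ
  map_top : τ ⊤ = ⊤
  map_lt : ∀ γ δ, γ ≠ ⊤ → τ γ ≤ γ → δ < γ → τ δ < δ

/-- `γ > θ`, i.e. `γ ∈ Δ₊ = {γ | τ γ > γ} ∪ {∞}`; the value `θ` itself need not exist. -/
def AboveTheta {Δ : Type u} [LinearOrder Δ] [OrderTop Δ] (τ : Δ → Δ) (γ : Δ) : Prop :=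
  γ < τ γ ∨ γ = ⊤

/-- A valued abelian group (with surjective valuation). -/
structure IsValuedGroup {M Δ : Type u} [AddCommGroup M] [LinearOrder Δ] [OrderTop Δ]
    (v : M → Δ) : Prop where
  surjective : Function.Surjective v
  eq_top_iff : ∀ x, v x = ⊤ ↔ x = 0
  min_le_add : ∀ x y, min (v x) (v y) ≤ v (x + y)
  min_le_sub : ∀ x y, min (v x) (v y) ≤ v (x - y)

/-- A (`K`-trivially) valued `K[t; φ]`-module. -/
structure IsValuedModule {K : Type u} [Field K] (φ : K →+* K) {M Δ : Type u} [AddCommGroup M]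
    [Module (TwistedPoly φ)ᵐᵒᵖ M] [LinearOrder Δ] [OrderTop Δ] (τ : Δ → Δ) (v : M → Δ) : Prop
    extends IsValuedGroup v where
  t_injective : Function.Injective fun x : M => MulOpposite.op (TwistedPoly.t φ) • x
  tauChain : IsTauChain τ
  map_const : ∀ a : K, a ≠ 0 → ∀ x : M, v (MulOpposite.op (TwistedPoly.C φ a) • x) = v x
  map_t : ∀ x : M, v (MulOpposite.op (TwistedPoly.t φ) • x) = τ (v x)

/-- A henselian valued `K[t; φ]`-module. -/
structure IsHenselianValuedModule {K : Type u} [Field K] (φ : K →+* K) {M Δ : Type u}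
    [AddCommGroup M] [Module (TwistedPoly φ)ᵐᵒᵖ M] [LinearOrder Δ] [OrderTop Δ] (τ : Δ → Δ)
    (v : M → Δ) : Prop extends IsValuedModule φ τ v where
  henselian : ∀ r : TwistedPoly φ, r.IsSeparable → ∀ x : M, AboveTheta τ (v x) →
    ∃ y : M, x = MulOpposite.op r • y ∧ AboveTheta τ (v y)

/-- A right `R`-module `M` is divisible if `M.r = M` for all `r ≠ 0`. -/
def IsDivisibleModule (R : Type u) [Ring R] (M : Type u) [AddCommGroup M] [Module Rᵐᵒᵖ M] : Prop :=
  ∀ r : R, r ≠ 0 → ∀ x : M, ∃ y : M, MulOpposite.op r • y = x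

namespace IsValuedGroup

variable {M Δ : Type u} [AddCommGroup M] [LinearOrder Δ] [OrderTop Δ] {v : M → Δ}

theorem map_zero (hv : IsValuedGroup v) : v 0 = ⊤ := (hv.eq_top_iff 0).2 rfl

theorem le_neg (hv : IsValuedGroup v) (x : M) : v x ≤ v (-x) := by
  have := hv.min_le_sub 0 x
  rwa [hv.map_zero, zero_sub, min_eq_right le_top] at this

/-- The closed ball `M_{≥ γ}`. -/
def geBall (hv : IsValuedGroup v) (γ : Δ) : AddSubgroup M where
  carrier := {x | γ ≤ v x}
  zero_mem' := by simp [hv.map_zero]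
  add_mem' hx hy := (le_min hx hy).trans (hv.min_le_add _ _)
  neg_mem' hx := le_trans hx (hv.le_neg _)

/-- The open ball `M_{> γ}`, for `γ ≠ ∞`. -/
def gtBall (hv : IsValuedGroup v) (γ : Δ) (hγ : γ ≠ ⊤) : AddSubgroup M where
  carrier := {x | γ < v x}
  zero_mem' := by simpa [hv.map_zero] using hγ.lt_top
  add_mem' hx hy := (lt_min hx hy).trans_le (hv.min_le_add _ _)
  neg_mem' hx := lt_of_lt_of_le hx (hv.le_neg _)

end IsValuedGroup

/-! ## The two-sorted language `L` -/

namespace ValMod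

open FirstOrder FirstOrder.Language

/-- Function symbols `0, +, -, (.r)` of the language of right `R`-modules. -/
inductive ModFunc (R : Type u) : ℕ → Type u
  | zero : ModFunc R 0
  | add : ModFunc R 2
  | neg : ModFunc R 1
  | act (r : R) : ModFunc R 1

/-- The language `L_Mod(R)`. -/
def modLang (R : Type u) : FirstOrder.Language.{u, 0} := ⟨ModFunc R, fun _ => Empty⟩

/-- Function symbols `∞, τ` of the value set sort. -/
inductive ValFunc : ℕ → Type
  | infty : ValFunc 0
  | tau : ValFunc 1

/-- Relation symbols `≤, R_n` of the value set sort. -/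
inductive ValRel : ℕ → Type
  | le : ValRel 2
  | res (n : ℕ) : ValRel 1

/-- The language `L_V`. -/
def valLang : FirstOrder.Language.{0, 0} := ⟨ValFunc, ValRel⟩

instance : IsOrdered valLang := ⟨ValRel.le⟩

/-- An `L`-structure. -/
structure LStr (R : Type u) where
  M : Type u
  V : Type u
  [modStr : (modLang R).Structure M]
  [valStr : valLang.Structure V]
  v : M → V

attribute [instance] LStr.modStr LStr.valStr

/-- Value-sort `L`-terms in `m` module variables and `n` value variables: `L_V`-terms in the value
variables and the expressions `v(s)`, `s` a module term. -/
abbrev ValTerm (R : Type u) (m n : ℕ) : Type u :=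
  valLang.Term ((modLang R).Term (Fin m) ⊕ Fin n)

/-- `L`-formulas with free variables among `m` module variables and `n` value variables.
A quantifier binds the last variable of its sort. (`L_Mod(R)` has no relation symbols.) -/
inductive LFormula (R : Type u) : ℕ → ℕ → Type u
  | falsum {m n : ℕ} : LFormula R m n
  | modEq {m n : ℕ} (s s' : (modLang R).Term (Fin m)) : LFormula R m n
  | valEq {m n : ℕ} (s s' : ValTerm R m n) : LFormula R m n
  | valRel {m n l : ℕ} (ρ : valLang.Relations l) (s : Fin l → ValTerm R m n) : LFormula R m n
  | imp {m n : ℕ} (χ χ' : LFormula R m n) : LFormula R m n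
  | allM {m n : ℕ} (χ : LFormula R (m + 1) n) : LFormula R m n
  | allV {m n : ℕ} (χ : LFormula R m (n + 1)) : LFormula R m n

/-- `L`-sentences. -/
abbrev LSentence (R : Type u) : Type u := LFormula R 0 0

/-- Evaluation of value-sort terms. -/
def LStr.evalV {R : Type u} (S : LStr R) {m n : ℕ} (x : Fin m → S.M) (y : Fin n → S.V)
    (s : ValTerm R m n) : S.V :=
  s.realize (Sum.elim (fun a => S.v (a.realize x)) y)

/-- Truth of `L`-formulas. -/
def LFormula.Realize {R : Type u} (S : LStr R) : {m n : ℕ} → LFormula R m n →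
    (Fin m → S.M) → (Fin n → S.V) → Prop
  | _, _, falsum, _, _ => False
  | _, _, modEq s s', x, _ => s.realize x = s'.realize x
  | _, _, valEq s s', x, y => S.evalV x y s = S.evalV x y s'
  | _, _, valRel ρ s, x, y => Structure.RelMap ρ fun i => S.evalV x y (s i)
  | _, _, imp χ χ', x, y => χ.Realize S x y → χ'.Realize S x y
  | _, _, allM χ, x, y => ∀ a : S.M, χ.Realize S (Fin.snoc x a) y
  | _, _, allV χ, x, y => ∀ b : S.V, χ.Realize S x (Fin.snoc y b)

/-- `S` is a model of the set `T` of `L`-sentences. -/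
def LStr.Models {R : Type u} (S : LStr R) (T : Set (LSentence R)) : Prop :=
  ∀ σ ∈ T, σ.Realize S Fin.elim0 Fin.elim0

namespace LFormula

variable {R : Type u} {m n : ℕ}

/-- Negation. -/
def neg (χ : LFormula R m n) : LFormula R m n := χ.imp falsum

/-- Conjunction. -/
def conj (χ χ' : LFormula R m n) : LFormula R m n := (χ.imp χ'.neg).neg

/-- Disjunction. -/
def disj (χ χ' : LFormula R m n) : LFormula R m n := χ.neg.imp χ'

/-- Equivalence. -/
def equiv (χ χ' : LFormula R m n) : LFormula R m n := (χ.imp χ').conj (χ'.imp χ)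

/-- Existential quantification over the module sort. -/
def exM (χ : LFormula R (m + 1) n) : LFormula R m n := χ.neg.allM.neg

/-- Existential quantification over the value sort. -/
def exV (χ : LFormula R m (n + 1)) : LFormula R m n := χ.neg.allV.neg

/-- Existential quantification over all module variables. -/
def exsM : {m : ℕ} → LFormula R m n → LFormula R 0 n
  | 0, χ => χ
  | _ + 1, χ => exsM χ.exM

/-- The conjunction of a list of formulas. -/
def conjs : List (LFormula R m n) → LFormula R m n
  | [] => falsum.neg
  | χ :: l => χ.conj (conjs l)

/-- An `L_Mod(R)`-formula as an `L`-formula; free variables are renamed along `e`. -/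
def ofMod {γ : Type} (e : γ → Fin m) : {l : ℕ} → (modLang R).BoundedFormula γ l →
    LFormula R (m + l) n
  | _, .falsum => falsum
  | l, .equal s s' => modEq (s.relabel (Sum.elim (Fin.castAdd l ∘ e) (Fin.natAdd m)))
      (s'.relabel (Sum.elim (Fin.castAdd l ∘ e) (Fin.natAdd m)))
  | _, .rel ρ _ => (ρ : Empty).elim
  | _, .imp χ χ' => (ofMod e χ).imp (ofMod e χ')
  | _, .all χ => allM (ofMod e χ)

/-- The substitution used in `ofVal`: free variables are replaced along `e`, and the bound
variables of the `L_V`-formula become the last value variables. -/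
def valSubst {γ : Type} (e : γ → ValTerm R m n) (l : ℕ) : γ ⊕ Fin l → ValTerm R m (n + l) :=
  Sum.elim (fun c => (e c).relabel (Sum.map id (Fin.castAdd l)))
    (fun i => Term.var (Sum.inr (Fin.natAdd n i)))

/-- The `L`-formula obtained from an `L_V`-formula by substituting value-sort terms for its free
variables along `e`. -/
def ofVal {γ : Type} (e : γ → ValTerm R m n) : {l : ℕ} → valLang.BoundedFormula γ l →
    LFormula R m (n + l)
  | _, .falsum => falsum
  | l, .equal s s' => valEq (s.subst (valSubst e l)) (s'.subst (valSubst e l))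
  | l, .rel ρ s => valRel ρ fun i => (s i).subst (valSubst e l)
  | _, .imp χ χ' => (ofVal e χ).imp (ofVal e χ')
  | _, .all χ => allV (ofVal e χ)

end LFormula

/-- `L_Mod(R)`-sentences as `L`-sentences. -/
def modSentence {R : Type u} (σ : (modLang R).Sentence) : LSentence R :=
  LFormula.ofMod (m := 0) (n := 0) Empty.elim σ

/-- `L_V`-sentences as `L`-sentences. -/
def valSentence {R : Type u} (σ : valLang.Sentence) : LSentence R :=
  LFormula.ofVal (m := 0) (n := 0) Empty.elim σ

/-! ### Symbols applied to terms -/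

section Terms

variable {R : Type u} {α : Type}

/-- The term `0`. -/
def zeroT : (modLang R).Term α := Constants.term (L := modLang R) ModFunc.zero

/-- The term `s + s'`. -/
def addT (s s' : (modLang R).Term α) : (modLang R).Term α :=
  Functions.apply₂ (L := modLang R) ModFunc.add s s'

/-- The term `-s`. -/
def negT (s : (modLang R).Term α) : (modLang R).Term α :=
  Functions.apply₁ (L := modLang R) ModFunc.neg s

/-- The term `s.r`. -/
def actT (s : (modLang R).Term α) (r : R) : (modLang R).Term α :=
  Functions.apply₁ (L := modLang R) (ModFunc.act r) s

/-- The term `∞`. -/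
def inftyT {β : Type*} : valLang.Term β := Constants.term (L := valLang) ValFunc.infty

/-- The term `τ(s)`. -/
def tauT {β : Type*} (s : valLang.Term β) : valLang.Term β :=
  Functions.apply₁ (L := valLang) ValFunc.tau s

variable {m n : ℕ}

/-- The `i`-th module variable. -/
def mvar (i : Fin m) : (modLang R).Term (Fin m) := Term.var i

/-- The `i`-th value variable. -/
def vvar (i : Fin n) : ValTerm R m n := Term.var (Sum.inr i)

/-- The term `v(s)`. -/
def vT (s : (modLang R).Term (Fin m)) : ValTerm R m n := Term.var (Sum.inl s)

/-- The formula `s ≤ s'`. -/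
def leF (s s' : ValTerm R m n) : LFormula R m n :=
  LFormula.valRel (l := 2) ValRel.le ![s, s']

/-- The formula `s < s'`. -/
def ltF (s s' : ValTerm R m n) : LFormula R m n := (leF s s').conj (leF s' s).neg

/-- The formula `R_k(s)`. -/
def resF (k : ℕ) (s : ValTerm R m n) : LFormula R m n :=
  LFormula.valRel (l := 1) (ValRel.res k) ![s]

/-- The formula `s > θ`. -/
def aboveThetaF (s : ValTerm R m n) : LFormula R m n :=
  (ltF s (tauT s)).disj (LFormula.valEq s inftyT)

end Terms

/-! ## The theories -/

section ModuleTheories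

variable (R : Type u) [Ring R]

/-- The axioms of right `R`-modules. -/
def moduleTheory : (modLang R).Theory :=
  {∀' ∀' ∀' (addT (addT &0 &1) &2 =' addT &0 (addT &1 &2)),
    ∀' ∀' (addT &0 &1 =' addT &1 &0),
    ∀' (addT &0 zeroT =' &0),
    ∀' (addT &0 (negT &0) =' zeroT),
    ∀' (actT &0 1 =' &0)} ∪
  {σ | ∃ r, σ = ∀' ∀' (actT (addT &0 &1) r =' addT (actT &0 r) (actT &1 r))} ∪
  {σ | ∃ r s, σ = ∀' (actT &0 (r + s) =' addT (actT &0 r) (actT &0 s))} ∪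
  {σ | ∃ r s, σ = ∀' (actT &0 (r * s) =' actT (actT &0 r) s)}

/-- The axioms of non zero divisible right `R`-modules. -/
def divisibleTheory : (modLang R).Theory :=
  moduleTheory R ∪ {∃' ∼(&0 =' zeroT)} ∪ {σ | ∃ r : R, r ≠ 0 ∧ σ = ∀' ∃' (actT &1 r =' &0)}

variable {R}

/-- The sentence "`r` has at least `n` zeros". -/
def annGe (r : R) (n : ℕ) : (modLang R).Sentence :=
  BoundedFormula.exs (n := n)
    (BoundedFormula.iInf (fun i : Fin n => actT (&i) r =' zeroT) ⊓
      BoundedFormula.iInf fun p : {p : Fin n × Fin n // p.1 ≠ p.2} => ∼(&p.1.1 =' &p.1.2))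

/-- The set of zeros of `r` in `F`. -/
def ann (F : Type u) [AddCommGroup F] [Module Rᵐᵒᵖ F] (r : R) : Set F :=
  {x | MulOpposite.op r • x = 0}

/-- `Tor_F`: the theory of non zero divisible `R`-modules in which every `r ∈ R` has as many zeros
(in `ℕ ∪ {∞}`) as in `F`. -/
def torTheory (F : Type u) [AddCommGroup F] [Module Rᵐᵒᵖ F] : (modLang R).Theory :=
  divisibleTheory R ∪
  {σ | ∃ r : R, (ann F r).Finite ∧
    σ = annGe r (ann F r).ncard ⊓ ∼(annGe r ((ann F r).ncard + 1))} ∪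
  {σ | ∃ (r : R) (n : ℕ), (ann F r).Infinite ∧ σ = annGe r n}

end ModuleTheories

/-- The axioms of `τ`-chains. -/
def tauChainTheory : valLang.Theory :=
  valLang.linearOrderTheory ∪
  {∀' (&0).le inftyT,
    ∀' ∀' ((&0).lt &1 ⟹ (tauT &0).lt (tauT &1)),
    tauT inftyT =' inftyT,
    ∀' ∀' (∼(&0 =' inftyT) ⟹ (tauT &0).le &0 ⟹ (&1).lt &0 ⟹ (tauT &1).lt &1)}

section HenselianTheory

open LFormula

/-- The axiom defining `R_n`: for `γ ≠ ∞`, `R_n(γ)` holds iff `M_{≥ γ}/M_{> γ}` has at least `n`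
elements, i.e. `M_{≥ γ}` has `n` elements no two of which are congruent modulo `M_{> γ}`. -/
def resAxiom (R : Type u) (n : ℕ) : LSentence R :=
  allV ((valEq (vvar 0) inftyT).neg.imp ((resF n (vvar 0)).equiv
    (exsM (m := n) ((conjs ((List.finRange n).map fun i => leF (vvar 0) (vT (mvar i)))).conj
      (conjs (((List.finRange n ×ˢ List.finRange n).filter fun p => p.1 ≠ p.2).map fun p =>
        (ltF (vvar 0) (vT (addT (mvar p.1) (negT (mvar p.2))))).neg))))))

variable {K : Type u} [Field K] (φ : K →+* K)

/-- The theory of valued `K[t; φ]`-modules in the language `L`. -/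
def valuedModuleTheory : Set (LSentence (TwistedPoly φ)) :=
  modSentence '' moduleTheory (TwistedPoly φ) ∪ valSentence '' tauChainTheory ∪
  {allV (exM (valEq (vT (mvar 0)) (vvar 0))),
    allM ((valEq (vT (mvar 0)) inftyT).equiv (modEq (mvar 0) zeroT)),
    allM (allM ((leF (vT (mvar 0)) (vT (addT (mvar 0) (mvar 1)))).disj
      (leF (vT (mvar 1)) (vT (addT (mvar 0) (mvar 1)))))),
    allM (allM ((leF (vT (mvar 0)) (vT (addT (mvar 0) (negT (mvar 1))))).disj
      (leF (vT (mvar 1)) (vT (addT (mvar 0) (negT (mvar 1))))))),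
    allM (allM ((modEq (actT (mvar 0) (TwistedPoly.t φ)) (actT (mvar 1) (TwistedPoly.t φ))).imp
      (modEq (mvar 0) (mvar 1)))),
    allM (valEq (vT (actT (mvar 0) (TwistedPoly.t φ))) (tauT (vT (mvar 0))))} ∪
  {σ | ∃ a : K, a ≠ 0 ∧
    σ = allM (valEq (vT (actT (mvar 0) (TwistedPoly.C φ a))) (vT (mvar 0)))} ∪
  {σ | ∃ n, σ = resAxiom _ n}

/-- `T_h`: the theory of henselian valued `K[t; φ]`-modules. -/
def henselTheory : Set (LSentence (TwistedPoly φ)) :=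
  valuedModuleTheory φ ∪
  {σ | ∃ r : TwistedPoly φ, r.IsSeparable ∧ σ = allM ((aboveThetaF (vT (mvar 0))).imp
    (exM ((modEq (mvar 0) (actT (mvar 1) r)).conj (aboveThetaF (vT (mvar 1))))))}

end HenselianTheory

/-! ## The structure attached to a valued module, and the theory `T` -/

/-- A right `R`-module as an `L_Mod(R)`-structure. -/
@[reducible]
def modStructure (R : Type u) [Ring R] (M : Type u) [AddCommGroup M] [Module Rᵐᵒᵖ M] :
    (modLang R).Structure M where
  funMap
    | .zero => fun _ => 0
    | .add => fun x => x 0 + x 1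
    | .neg => fun x => -x 0
    | .act r => fun x => MulOpposite.op r • x 0
  RelMap ρ := (ρ : Empty).elim

/-- The value set of a valued group as an `L_V`-structure: for `γ ≠ ∞`, `R_n(γ)` holds iff
`|M_{≥ γ}/M_{> γ}| ≥ n`. The truth values `ρ n` of `R_n(∞)` are an arbitrary convention. -/
@[reducible]
def valStructure {M Δ : Type u} [AddCommGroup M] [LinearOrder Δ] [OrderTop Δ] (τ : Δ → Δ)
    {v : M → Δ} (hv : IsValuedGroup v) (ρ : ℕ → Prop) : valLang.Structure Δ where
  funMap
    | .infty => fun _ => ⊤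
    | .tau => fun y => τ (y 0)
  RelMap
    | .le => fun y => y 0 ≤ y 1
    | .res n => fun y =>
      (y 0 = ⊤ ∧ ρ n) ∨
      ∃ h : y 0 ≠ ⊤,
        (n : ℕ∞) ≤ ENat.card (hv.geBall (y 0) ⧸ (hv.gtBall (y 0) h).addSubgroupOf (hv.geBall (y 0)))

/-- A valued module as an `L`-structure. -/
@[reducible]
def ofValuedModule {K : Type u} [Field K] (φ : K →+* K) {M Δ : Type u} [AddCommGroup M]
    [Module (TwistedPoly φ)ᵐᵒᵖ M] [LinearOrder Δ] [OrderTop Δ] (τ : Δ → Δ) {v : M → Δ}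
    (hv : IsValuedGroup v) (ρ : ℕ → Prop) : LStr (TwistedPoly φ) :=
  { M := M
    V := Δ
    modStr := modStructure (TwistedPoly φ) M
    valStr := valStructure τ hv ρ
    v := v }

/-- `T_v`: the complete `L_V`-theory of the value set `v(F)`. -/
def valueTheory {F Δ : Type u} [AddCommGroup F] [LinearOrder Δ] [OrderTop Δ] (τ : Δ → Δ)
    {v : F → Δ} (hv : IsValuedGroup v) (ρ : ℕ → Prop) : valLang.Theory :=
  letI := valStructure τ hv ρ
  valLang.completeTheory Δ

/-- `T = T_h ∪ T_v ∪ Tor_F`. -/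
def fullTheory {K : Type u} [Field K] (φ : K →+* K) {F Δ : Type u} [AddCommGroup F]
    [Module (TwistedPoly φ)ᵐᵒᵖ F] [LinearOrder Δ] [OrderTop Δ] (τ : Δ → Δ) {v : F → Δ}
    (hv : IsValuedGroup v) (ρ : ℕ → Prop) : Set (LSentence (TwistedPoly φ)) :=
  henselTheory φ ∪ valSentence '' valueTheory τ hv ρ ∪
    modSentence '' torTheory (R := TwistedPoly φ) F

/-- `T` is complete: it has a model, and it decides every sentence. -/
def IsCompleteTheory {R : Type u} (T : Set (LSentence R)) : Prop :=
  (∃ S : LStr R, S.Models T) ∧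
  ∀ σ : LSentence R, (∀ S : LStr R, S.Models T → S.Models {σ}) ∨
    (∀ S : LStr R, S.Models T → S.Models {σ.neg})

/-- `χ` and `χ'` are equivalent modulo `T`. -/
def EquivMod {R : Type u} (T : Set (LSentence R)) {m n : ℕ} (χ χ' : LFormula R m n) : Prop :=
  ∀ S : LStr R, S.Models T → ∀ (x : Fin m → S.M) (y : Fin n → S.V),
    χ.Realize S x y ↔ χ'.Realize S x y

/-- `Θ_v`: the formulas `ξ(x̄) ∧ Q ȳ₁ ψ(ȳ₁, ȳ₂, v(t₁(x̄)), …, v(t_k(x̄)))` with `ξ` a quantifier-free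
`L_Mod(R)`-formula, `Q ȳ₁ ψ` a prenex `L_V`-formula and the `tᵢ` module terms. -/
def ThetaV (R : Type u) (m n : ℕ) : Set (LFormula R m n) :=
  {θ | ∃ (ξ : (modLang R).Formula (Fin m)) (k : ℕ) (t : Fin k → (modLang R).Term (Fin m))
      (ψ : valLang.Formula (Fin n ⊕ Fin k)), ξ.IsQF ∧ ψ.IsPrenex ∧
      θ = (LFormula.ofMod (l := 0) id ξ).conj
        (LFormula.ofVal (l := 0) (Sum.elim vvar fun i => vT (t i)) ψ)}

end ValMod

end

/-! A formula $\exists a\,\psi$ mentions $a$ only through finitely many values $v(a.r_i+u_i)$, since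
module equations can be written as $v(s-s')=\infty$. Naming these values by value variables
$\gamma_i$ reduces the elimination of a module quantifier to one question: when does the system
$v(x.r_i+u_i)=\gamma_i$ have a solution $x$? The answer must be an $L_V$-formula in the $\gamma_i$
and in values of terms in the $u_i$, the same for all divisible henselian modules with given torsion
numbers (`isDefinable_exists_smul_values`).

The cut $\theta$ separates three regimes. Below $\theta$ the leading term of $r$ dominates and
$v(x.r)=\tau^{\deg r}(v(x))$; above $\theta$ the lowest term dominates and
$v(x.r)=\tau^{\mathrm{ord}\,r}(v(x))$. In both regimes common right multiples $r_iq_i=m$ turn the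
system into $v(y+w_i)=\delta_i$ with $y=x.m$ arbitrary by divisibility. Such a system is a question
about an ultrametric group, decided by the values of the $w_i-w_j$ and by the size of one residue
group, which is what the predicates $R_n$ provide (`exists_values_iff_of_ne_top`). At $\theta$
itself $M_{\ge\theta}/M_{>\theta}$ is infinite when nonzero, and Neumann's lemma on coset covers
lets all forms avoid $M_{>\theta}$ at once.

When some $\gamma_i$ lie above $\theta$, henselianity and divisibility make $M_{>\theta}$ a
divisible torsion-free submodule. The system then splits into compatibility conditions, an
ultrametric system inside $M_{>\theta}$, and a system in $M/M_{>\theta}$ of one equation and several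
inequations (`exists_values_iff_of_gt_theta`). That quotient is divisible with the torsion of $M$.
By `inequations_transfer` (inclusion-exclusion when the torsion is finite, Neumann's lemma to reduce
to that case) solvability there depends only on which subsystems of equations are solvable, and
Bézout identities express this by values of terms.

Completeness follows: closed module terms are $0$, so every sentence reduces to an $L_V$-sentence,
which $T_v$ decides. -/

noncomputable section

/-! ### Arithmetic of twisted polynomials: division, Bézout identities, the Ore condition. -/

namespace TwistedPoly

variable {K : Type u} [Field K] {φ : K →+* K}

@[simp] theorem coeff_neg (p : TwistedPoly φ) (i : ℕ) : (-p).coeff i = -p.coeff i := rfl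

@[simp] theorem coeff_sub (p q : TwistedPoly φ) (i : ℕ) :
    (p - q).coeff i = p.coeff i - q.coeff i := by
  rw [sub_eq_add_neg, coeff_add, coeff_neg, sub_eq_add_neg]

theorem coeff_mul_monomial (p : TwistedPoly φ) (k : ℕ) (c : K) (i : ℕ) :
    (p * monomial φ k c).coeff i = if k ≤ i then (φ ^ k) (p.coeff (i - k)) * c else 0 := by
  induction p using induction_add with
  | h0 => simp
  | ha p q hp hq =>
    rw [add_mul, coeff_add, hp, hq]
    split_ifs <;> simp [add_mul]
  | hm j a =>
    rw [monomial_mul_monomial, coeff_monomial, coeff_monomial]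
    by_cases h : j + k = i
    · subst h; simp
    · rw [if_neg h]
      split_ifs with h1 h2
      · omega
      · simp
      · rfl

theorem t_mul_monomial (i : ℕ) (a : K) : t φ * monomial φ i a = monomial φ (i + 1) a := by
  rw [t, monomial_mul_monomial, map_one, one_mul, add_comm]

theorem coeff_t_mul_succ (s : TwistedPoly φ) (i : ℕ) : (t φ * s).coeff (i + 1) = s.coeff i := by
  induction s using induction_add with
  | h0 => simp
  | ha p q hp hq => rw [mul_add, coeff_add, coeff_add, hp, hq]
  | hm j a => rw [t_mul_monomial, coeff_monomial, coeff_monomial]; simp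

theorem coeff_t_mul_zero (s : TwistedPoly φ) : (t φ * s).coeff 0 = 0 := by
  induction s using induction_add with
  | h0 => simp
  | ha p q hp hq => rw [mul_add, coeff_add, hp, hq, add_zero]
  | hm j a => rw [t_mul_monomial, coeff_monomial]; simp

theorem exists_coeff_eq_zero (p : TwistedPoly φ) : ∃ n, ∀ i, n ≤ i → p.coeff i = 0 := by
  induction p using induction_add with
  | h0 => exact ⟨0, fun _ _ => rfl⟩
  | ha p q hp hq =>
    obtain ⟨n, hn⟩ := hp
    obtain ⟨m, hm⟩ := hq
    refine ⟨max n m, fun i hi => ?_⟩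
    rw [coeff_add, hn i (le_of_max_le_left hi), hm i (le_of_max_le_right hi), add_zero]
  | hm j a => exact ⟨j + 1, fun i hi => by rw [coeff_monomial, if_neg (by omega)]⟩

theorem exists_coeff_ne_zero {p : TwistedPoly φ} (hp : p ≠ 0) : ∃ n, p.coeff n ≠ 0 := by
  by_contra! h
  exact hp (ext h)

/-- The degree of a twisted polynomial. -/
def deg (p : TwistedPoly φ) : ℕ := sSup {n | p.coeff n ≠ 0}

/-- The order of vanishing of a twisted polynomial at `t = 0`. -/
def ord (p : TwistedPoly φ) : ℕ := sInf {n | p.coeff n ≠ 0}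

theorem bddAbove_support (p : TwistedPoly φ) : BddAbove {n | p.coeff n ≠ 0} := by
  obtain ⟨n, hn⟩ := exists_coeff_eq_zero p
  refine ⟨n, fun i hi => ?_⟩
  by_contra! h
  exact hi (hn i h.le)

theorem coeff_deg_ne_zero {p : TwistedPoly φ} (hp : p ≠ 0) : p.coeff p.deg ≠ 0 :=
  Nat.sSup_mem (exists_coeff_ne_zero hp) (bddAbove_support p)

theorem coeff_eq_zero_of_deg_lt {p : TwistedPoly φ} {i : ℕ} (hi : p.deg < i) : p.coeff i = 0 := by
  by_contra h
  exact absurd (le_csSup (bddAbove_support p) h) (not_le.2 hi)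

theorem coeff_ord_ne_zero {p : TwistedPoly φ} (hp : p ≠ 0) : p.coeff p.ord ≠ 0 :=
  Nat.sInf_mem (exists_coeff_ne_zero hp)

theorem ord_t_mul {s : TwistedPoly φ} (hs : s ≠ 0) : (t φ * s).ord = s.ord + 1 := by
  refine le_antisymm (Nat.sInf_le ?_) (le_csInf ⟨s.ord + 1, ?_⟩ fun i hi => ?_)
  · rw [Set.mem_ofPred_eq, coeff_t_mul_succ]; exact coeff_ord_ne_zero hs
  · rw [Set.mem_ofPred_eq, coeff_t_mul_succ]; exact coeff_ord_ne_zero hs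
  · cases i with
    | zero => exact absurd (coeff_t_mul_zero s) hi
    | succ i =>
      rw [Set.mem_ofPred_eq, coeff_t_mul_succ] at hi
      exact Nat.succ_le_succ (Nat.sInf_le hi)

/-- A separable twisted polynomial has a non-zero constant coefficient. -/
theorem IsSeparable.coeff_zero_ne_zero {r : TwistedPoly φ} (hr : r.IsSeparable) :
    r.coeff 0 ≠ 0 := by
  intro h
  refine hr ?_
  -- Splitting off the constant term leaves a left multiple of `t`, so a vanishing constant term
  -- contradicts separability.
  suffices H : ∀ p : TwistedPoly φ, ∃ s, p = t φ * s + monomial φ 0 (p.coeff 0) by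
    obtain ⟨s, hs⟩ := H r
    exact ⟨s, by rw [hs, h]; simp⟩
  intro p
  induction p using induction_add with
  | h0 => exact ⟨0, by simp⟩
  | ha p q hp hq =>
    obtain ⟨s, hs⟩ := hp
    obtain ⟨s', hs'⟩ := hq
    refine ⟨s + s', ?_⟩
    rw [coeff_add, map_add, mul_add, add_add_add_comm, ← hs, ← hs']
  | hm j a =>
    cases j with
    | zero => exact ⟨0, by rw [coeff_monomial]; simp⟩
    | succ j => exact ⟨monomial φ j a, by rw [t_mul_monomial, coeff_monomial]; simp⟩

theorem IsSeparable.ord_eq_zero {r : TwistedPoly φ} (hr : r.IsSeparable) : r.ord = 0 :=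
  Nat.le_zero.1 (Nat.sInf_le hr.coeff_zero_ne_zero)

/-- Division with remainder: `r = s q + r'` with `deg r' < deg s`. -/
theorem exists_div {s : TwistedPoly φ} (hs : s ≠ 0) (r : TwistedPoly φ) :
    ∃ q r', r = s * q + r' ∧ ∀ i, s.deg ≤ i → r'.coeff i = 0 := by
  suffices H : ∀ (m : ℕ) (r : TwistedPoly φ), (∀ i, m ≤ i → r.coeff i = 0) →
      ∃ q r', r = s * q + r' ∧ ∀ i, s.deg ≤ i → r'.coeff i = 0 by
    obtain ⟨m, hm⟩ := exists_coeff_eq_zero r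
    exact H m r hm
  intro m
  induction m with
  | zero => exact fun r hr => ⟨0, r, by simp, fun i _ => hr i (Nat.zero_le i)⟩
  | succ m ih =>
    intro r hr
    rcases lt_or_ge m s.deg with h | h
    · exact ⟨0, r, by simp, fun i hi => hr i (by omega)⟩
    obtain ⟨k, rfl⟩ := Nat.exists_eq_add_of_le h
    -- With `s` on the left, the leading coefficient of `s * monomial φ k c` is `(φ ^ k) (s.coeff
    -- s.deg) * c`. The `c` that cancels the top term of `r` therefore exists even if `φ` is not
    -- surjective.
    have hne : (φ ^ k) (s.coeff s.deg) ≠ 0 := by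
      rw [Ne, map_eq_zero]; exact coeff_deg_ne_zero hs
    obtain ⟨q, r', h1, h2⟩ := ih
      (r - s * monomial φ k (((φ ^ k) (s.coeff s.deg))⁻¹ * r.coeff (s.deg + k))) (by
        intro i hi
        rw [coeff_sub, coeff_mul_monomial, if_pos (by omega)]
        rcases hi.eq_or_lt with rfl | hi
        · rw [Nat.add_sub_cancel, mul_inv_cancel_left₀ hne, sub_self]
        · rw [hr i hi, coeff_eq_zero_of_deg_lt (by omega)]; simp)
    refine ⟨monomial φ k (((φ ^ k) (s.coeff s.deg))⁻¹ * r.coeff (s.deg + k)) + q, r', ?_, h2⟩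
    rw [mul_add, add_assoc, ← h1]; abel

/-- In degree `p.deg + q.deg` the product has the single contribution `(φ ^ q.deg) (p.coeff p.deg) *
q.coeff q.deg`, and a ring homomorphism of fields is injective. -/
instance : NoZeroDivisors (TwistedPoly φ) where
  eq_zero_or_eq_zero_of_mul_eq_zero {p q} h := by
    by_contra! hpq
    obtain ⟨hp, hq⟩ := hpq
    have h1 : (p * q).coeff (p.deg + q.deg) = 0 := by rw [h]; rfl
    rw [coeff_mul, Finset.sum_eq_single (p.deg, q.deg)] at h1
    · exact mul_ne_zero ((map_ne_zero _).2 (coeff_deg_ne_zero hp)) (coeff_deg_ne_zero hq) h1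
    · rintro ⟨a, b⟩ hab hne
      rw [Finset.HasAntidiagonal.mem_antidiagonal] at hab
      dsimp only at hab ⊢
      rcases lt_trichotomy p.deg a with h2 | h2 | h2
      · rw [coeff_eq_zero_of_deg_lt h2, map_zero, zero_mul]
      · exact absurd (Prod.ext h2.symm (by dsimp only; omega)) hne
      · rw [coeff_eq_zero_of_deg_lt (p := q) (by omega), mul_zero]
    · simp

/-- Right ideals are principal. -/
theorem exists_generator (I : Submodule (TwistedPoly φ)ᵐᵒᵖ (TwistedPoly φ)) :
    ∃ g ∈ I, ∀ a ∈ I, ∃ b, a = g * b := by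
  classical
  -- A nonzero element of least degree generates, because remainders stay in `I`.
  by_cases hI : ∃ n, ∃ g ∈ I, g ≠ 0 ∧ g.deg = n
  · obtain ⟨g, hg, hg0, hn⟩ := Nat.find_spec hI
    refine ⟨g, hg, fun a ha => ?_⟩
    obtain ⟨q, r, h1, h2⟩ := exists_div hg0 a
    have hr : r ∈ I := by
      have : r = a - MulOpposite.op q • g := by rw [h1, op_smul_eq_mul]; abel
      rw [this]
      exact I.sub_mem ha (I.smul_mem _ hg)
    by_cases hr0 : r = 0
    · exact ⟨q, by rw [h1, hr0, add_zero]⟩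
    · have h3 : g.deg ≤ r.deg := hn ▸ Nat.find_min' hI ⟨r, hr, hr0, rfl⟩
      exact absurd (h2 _ h3) (coeff_deg_ne_zero hr0)
  · push Not at hI
    refine ⟨0, I.zero_mem, fun a ha => ⟨0, ?_⟩⟩
    by_contra h
    exact hI _ a ha (by simpa using h) rfl

/-- A finite family has a greatest common left divisor, a right linear combination of it. -/
theorem exists_bezout {ι : Type*} [Fintype ι] (r : ι → TwistedPoly φ) :
    ∃ (g : TwistedPoly φ) (p s : ι → TwistedPoly φ),
      g = ∑ i, r i * p i ∧ ∀ i, r i = g * s i := by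
  obtain ⟨g, hg, h⟩ := exists_generator (Submodule.span (TwistedPoly φ)ᵐᵒᵖ (Set.range r))
  obtain ⟨p, hp⟩ := (Submodule.mem_span_range_iff_exists_fun _).1 hg
  choose s hs using fun i => h (r i) (Submodule.subset_span ⟨i, rfl⟩)
  exact ⟨g, fun i => (p i).unop, s, hp.symm, hs⟩

/-- The right Ore condition. -/
theorem exists_mul_eq_mul {a b : TwistedPoly φ} (ha : a ≠ 0) (hb : b ≠ 0) :
    ∃ p q, p ≠ 0 ∧ q ≠ 0 ∧ a * p = b * q := by
  obtain ⟨g, p, s, hg, hs⟩ := exists_bezout ![a, b]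
  simp only [Fin.sum_univ_two, Matrix.cons_val_zero, Matrix.cons_val_one] at hg
  have hs0 : a = g * s 0 := hs 0
  have hs1 : b = g * s 1 := hs 1
  -- Substituting `g = a * p 0 + b * p 1` into `a = g * s 0` and `b = g * s 1` gives two relations
  -- between `a` and `b`. If the first one degenerates, i.e. `1 = p 0 * s 0`, then `p 1 = 0` or the
  -- second one is already nontrivial, so one of them always yields a nonzero common multiple.
  have h0 : a * (1 - p 0 * s 0) = b * (p 1 * s 0) := by
    calc a * (1 - p 0 * s 0) = a - a * p 0 * s 0 := by rw [mul_sub, mul_one, mul_assoc]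
      _ = g * s 0 - a * p 0 * s 0 := by rw [← hs0]
      _ = b * (p 1 * s 0) := by rw [hg]; noncomm_ring
  have h1 : b * (1 - p 1 * s 1) = a * (p 0 * s 1) := by
    calc b * (1 - p 1 * s 1) = b - b * p 1 * s 1 := by rw [mul_sub, mul_one, mul_assoc]
      _ = g * s 1 - b * p 1 * s 1 := by rw [← hs1]
      _ = a * (p 0 * s 1) := by rw [hg]; noncomm_ring
  by_cases h2 : 1 - p 0 * s 0 = 0
  · have h3 : 1 - p 1 * s 1 ≠ 0 := by
      intro h3
      rw [h2, mul_zero] at h0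
      have hs00 : s 0 ≠ 0 := fun h => ha (by rw [hs0, h, mul_zero])
      have hp1 : p 1 = 0 := by
        rcases mul_eq_zero.1 h0.symm with h | h
        · exact absurd h hb
        · exact (mul_eq_zero.1 h).resolve_right hs00
      rw [hp1, zero_mul, sub_zero] at h3
      exact hb (by rw [← mul_one b, h3, mul_zero])
    refine ⟨p 0 * s 1, 1 - p 1 * s 1, ?_, h3, h1.symm⟩
    intro h
    rw [h, mul_zero] at h1
    exact (mul_ne_zero hb h3) h1
  · refine ⟨1 - p 0 * s 0, p 1 * s 0, h2, ?_, h0⟩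
    intro h
    rw [h, mul_zero] at h0
    exact (mul_ne_zero ha h2) h0

/-- A finite family of non-zero elements has a common right multiple. -/
theorem exists_common_multiple {ι : Type*} [Finite ι] (r : ι → TwistedPoly φ)
    (hr : ∀ i, r i ≠ 0) :
    ∃ (m : TwistedPoly φ) (q : ι → TwistedPoly φ), m ≠ 0 ∧ (∀ i, q i ≠ 0) ∧
      ∀ i, r i * q i = m := by
  classical
  cases nonempty_fintype ι
  suffices H : ∀ s : Finset ι, ∃ m : TwistedPoly φ, m ≠ 0 ∧ ∀ i ∈ s, ∃ q, r i * q = m by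
    obtain ⟨m, hm, h⟩ := H Finset.univ
    choose q hq using fun i => h i (Finset.mem_univ i)
    exact ⟨m, q, hm, fun i h => hm (by rw [← hq i, h, mul_zero]), hq⟩
  intro s
  induction s using Finset.induction_on with
  | empty =>
    refine ⟨1, fun h => ?_, by simp⟩
    have : (1 : TwistedPoly φ).coeff 0 = 1 := coeff_monomial φ 0 0 1
    rw [h] at this
    exact zero_ne_one this
  | insert a s _ ih =>
    obtain ⟨m, hm, h⟩ := ih
    obtain ⟨p, q, hp, hq, hpq⟩ := exists_mul_eq_mul hm (hr a)
    refine ⟨m * p, mul_ne_zero hm hp, fun i hi => ?_⟩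
    rcases Finset.mem_insert.1 hi with rfl | hi
    · exact ⟨q, hpq.symm⟩
    · obtain ⟨q', hq'⟩ := h i hi
      exact ⟨q' * p, by rw [← mul_assoc, hq']⟩

/-- Needed to see that `M_{≥ θ} / M_{> θ}` is infinite: on a finite module two distinct scalars
would act alike. -/
instance : Infinite (TwistedPoly φ) := by
  refine Infinite.of_injective (fun n : ℕ => monomial φ n 1) fun m n h => ?_
  have : (monomial φ m 1).coeff n = (monomial φ n 1).coeff n := by
    dsimp only at h; rw [h]
  rw [coeff_monomial, coeff_monomial, if_pos rfl] at this
  by_contra hne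
  rw [if_neg hne] at this
  exact zero_ne_one this

end TwistedPoly

end

/-! ### Values of multiples below and above `θ`. -/

noncomputable section

open scoped RightActions

namespace IsTauChain

variable {Δ : Type u} [LinearOrder Δ] [OrderTop Δ] {τ : Δ → Δ}

/-- Contrapositive of `map_lt`: once `τ` does not raise a value other than `∞`, it lowers everything
smaller. So `γ ≤ τ γ` and `AboveTheta τ γ` define final segments, which play the roles of `≥ θ` and
`> θ` whether or not `θ` exists. -/
theorem le_map_of_le (hτ : IsTauChain τ) {γ δ : Δ} (hγ : γ ≤ τ γ) (h : γ ≤ δ) : δ ≤ τ δ := by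
  by_contra! hδ
  rcases h.eq_or_lt with rfl | h
  · exact absurd hγ (not_le.2 hδ)
  · refine absurd hγ (not_le.2 (hτ.map_lt δ γ ?_ hδ.le h))
    rintro rfl
    rw [hτ.map_top] at hδ
    exact lt_irrefl _ hδ

theorem aboveTheta_of_le (hτ : IsTauChain τ) {γ δ : Δ} (hγ : AboveTheta τ γ) (h : γ ≤ δ) :
    AboveTheta τ δ := by
  by_contra! hδ
  unfold AboveTheta at hδ
  push Not at hδ
  rcases hγ with hγ | rfl
  · rcases h.eq_or_lt with rfl | h
    · exact absurd hγ (not_lt.2 hδ.1)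
    · exact lt_asymm hγ (hτ.map_lt δ γ hδ.2 hδ.1 h)
  · exact hδ.2 (top_le_iff.1 h)

theorem _root_.AboveTheta.le_map (hτ : IsTauChain τ) {γ : Δ} (h : AboveTheta τ γ) : γ ≤ τ γ := by
  rcases h with h | rfl
  · exact h.le
  · rw [hτ.map_top]

theorem map_eq_top_iff (hτ : IsTauChain τ) {γ : Δ} : τ γ = ⊤ ↔ γ = ⊤ :=
  ⟨fun h => hτ.strictMono.injective (h.trans hτ.map_top.symm), fun h => by rw [h, hτ.map_top]⟩

theorem aboveTheta_map_iff (hτ : IsTauChain τ) {γ : Δ} :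
    AboveTheta τ (τ γ) ↔ AboveTheta τ γ := by
  unfold AboveTheta
  rw [hτ.map_eq_top_iff, hτ.strictMono.lt_iff_lt]

theorem aboveTheta_iterate_iff (hτ : IsTauChain τ) {γ : Δ} (n : ℕ) :
    AboveTheta τ (τ^[n] γ) ↔ AboveTheta τ γ := by
  induction n with
  | zero => rfl
  | succ n ih => rw [Function.iterate_succ_apply', hτ.aboveTheta_map_iff, ih]

theorem le_map_iterate_iff (hτ : IsTauChain τ) {γ : Δ} (n : ℕ) :
    τ^[n] γ ≤ τ (τ^[n] γ) ↔ γ ≤ τ γ := by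
  induction n with
  | zero => rfl
  | succ n ih => rw [Function.iterate_succ_apply', hτ.strictMono.le_iff_le, ih]

theorem le_iterate (hτ : IsTauChain τ) {γ : Δ} (h : γ ≤ τ γ) (n : ℕ) : γ ≤ τ^[n] γ := by
  induction n with
  | zero => rfl
  | succ n ih =>
    rw [Function.iterate_succ_apply']
    exact h.trans (hτ.strictMono.monotone ih)

theorem iterate_injective (hτ : IsTauChain τ) (n : ℕ) : Function.Injective τ^[n] :=
  hτ.strictMono.injective.iterate n

/-- There is at most one value `θ`. -/
theorem eq_of_fixed (hτ : IsTauChain τ) {γ δ : Δ} (hγ : γ ≤ τ γ) (hγ' : ¬ AboveTheta τ γ)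
    (hδ : δ ≤ τ δ) (hδ' : ¬ AboveTheta τ δ) : γ = δ := by
  unfold AboveTheta at hγ' hδ'
  push Not at hγ' hδ'
  rcases lt_trichotomy γ δ with h | h | h
  · exact absurd (hτ.map_lt δ γ hδ'.2 hδ'.1 h) (not_lt.2 hγ)
  · exact h
  · exact absurd (hτ.map_lt γ δ hγ'.2 hγ'.1 h) (not_lt.2 hδ)

end IsTauChain

namespace IsValuedGroup

variable {M Δ : Type u} [AddCommGroup M] [LinearOrder Δ] [OrderTop Δ] {v : M → Δ}

theorem map_neg (hv : IsValuedGroup v) (x : M) : v (-x) = v x :=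
  le_antisymm (by simpa using hv.le_neg (-x)) (hv.le_neg x)

theorem map_sub_comm (hv : IsValuedGroup v) (x y : M) : v (x - y) = v (y - x) := by
  rw [← hv.map_neg, neg_sub]

theorem map_add_eq_of_lt (hv : IsValuedGroup v) {x y : M} (h : v x < v y) : v (x + y) = v x := by
  refine le_antisymm ?_ ?_
  · by_contra! h1
    have := hv.min_le_sub (x + y) y
    rw [add_sub_cancel_right] at this
    exact absurd (lt_min h1 h) (not_lt.2 this)
  · have := hv.min_le_add x y
    rwa [min_eq_left h.le] at this

theorem le_map_add (hv : IsValuedGroup v) {x y : M} {γ : Δ} (hx : γ ≤ v x) (hy : γ ≤ v y) :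
    γ ≤ v (x + y) := (le_min hx hy).trans (hv.min_le_add x y)

theorem le_map_sub (hv : IsValuedGroup v) {x y : M} {γ : Δ} (hx : γ ≤ v x) (hy : γ ≤ v y) :
    γ ≤ v (x - y) := (le_min hx hy).trans (hv.min_le_sub x y)

theorem lt_map_add (hv : IsValuedGroup v) {x y : M} {γ : Δ} (hx : γ < v x) (hy : γ < v y) :
    γ < v (x + y) := (lt_min hx hy).trans_le (hv.min_le_add x y)

theorem lt_map_sub (hv : IsValuedGroup v) {x y : M} {γ : Δ} (hx : γ < v x) (hy : γ < v y) :
    γ < v (x - y) := (lt_min hx hy).trans_le (hv.min_le_sub x y)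

end IsValuedGroup

namespace IsValuedModule

open TwistedPoly

variable {K : Type u} [Field K] {φ : K →+* K} {M Δ : Type u} [AddCommGroup M]
  [Module (TwistedPoly φ)ᵐᵒᵖ M] [LinearOrder Δ] [OrderTop Δ] {τ : Δ → Δ} {v : M → Δ}

theorem map_monomial (hv : IsValuedModule φ τ v) (i : ℕ) {a : K} (ha : a ≠ 0) (x : M) :
    v (x <• monomial φ i a) = τ^[i] (v x) := by
  induction i generalizing x with
  | zero => exact hv.map_const a ha x
  | succ i ih =>
    rw [← t_mul_monomial, MulOpposite.op_mul, mul_smul, ih, hv.map_t, Function.iterate_succ_apply]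

/-- From `θ` on, iterating `τ` never lowers a value, so no monomial does, and the ultrametric
inequality handles sums. This makes `M_{≥ θ}` and `M_{> θ}` submodules. -/
theorem le_map_smul (hv : IsValuedModule φ τ v) {x : M} (hx : v x ≤ τ (v x))
    (r : TwistedPoly φ) : v x ≤ v (x <• r) := by
  induction r using induction_add with
  | h0 => rw [MulOpposite.op_zero, zero_smul, hv.map_zero]; exact le_top
  | ha p q hp hq => rw [MulOpposite.op_add, add_smul]; exact hv.le_map_add hp hq
  | hm i a =>
    by_cases ha : a = 0
    · rw [ha, _root_.map_zero, MulOpposite.op_zero, zero_smul, hv.map_zero]; exact le_top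
    · rw [hv.map_monomial i ha]
      exact hv.tauChain.le_iterate hx i

/-- The submodule `M_{≥ θ}`. -/
def geTheta (hv : IsValuedModule φ τ v) : Submodule (TwistedPoly φ)ᵐᵒᵖ M where
  carrier := {x | v x ≤ τ (v x)}
  zero_mem' := by
    change v 0 ≤ τ (v 0)
    rw [hv.map_zero, hv.tauChain.map_top]
  add_mem' {x y} hx hy := by
    have h := hv.min_le_add x y
    rcases le_total (v x) (v y) with h1 | h1
    · rw [min_eq_left h1] at h; exact hv.tauChain.le_map_of_le hx h
    · rw [min_eq_right h1] at h; exact hv.tauChain.le_map_of_le hy h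
  smul_mem' r x hx := hv.tauChain.le_map_of_le hx (hv.le_map_smul hx r.unop)

theorem mem_geTheta (hv : IsValuedModule φ τ v) {x : M} : x ∈ hv.geTheta ↔ v x ≤ τ (v x) := Iff.rfl

/-- The submodule `M_{> θ}`. -/
def gtTheta (hv : IsValuedModule φ τ v) : Submodule (TwistedPoly φ)ᵐᵒᵖ M where
  carrier := {x | AboveTheta τ (v x)}
  zero_mem' := by
    change AboveTheta τ (v 0)
    rw [hv.map_zero]; exact Or.inr rfl
  add_mem' {x y} hx hy := by
    have h := hv.min_le_add x y
    rcases le_total (v x) (v y) with h1 | h1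
    · rw [min_eq_left h1] at h; exact hv.tauChain.aboveTheta_of_le hx h
    · rw [min_eq_right h1] at h; exact hv.tauChain.aboveTheta_of_le hy h
  smul_mem' r x hx :=
    hv.tauChain.aboveTheta_of_le hx (hv.le_map_smul (hx.le_map hv.tauChain) r.unop)

theorem mem_gtTheta (hv : IsValuedModule φ τ v) {x : M} :
    x ∈ hv.gtTheta ↔ AboveTheta τ (v x) := Iff.rfl

theorem gtTheta_le_geTheta (hv : IsValuedModule φ τ v) : hv.gtTheta ≤ hv.geTheta :=
  fun _ hx => hx.le_map hv.tauChain

/-- Below `θ` the values `τ^[i] (v x)` of the terms strictly decrease with `i`, so the leading term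
determines the value of the sum. -/
theorem map_smul_of_not_mem_geTheta (hv : IsValuedModule φ τ v) {r : TwistedPoly φ} (hr : r ≠ 0)
    {x : M} (hx : x ∉ hv.geTheta) : v (x <• r) = τ^[r.deg] (v x) := by
  rw [hv.mem_geTheta, not_le] at hx
  have hlt : ∀ n, τ^[n + 1] (v x) < τ^[n] (v x) := fun n => by
    rw [Function.iterate_succ_apply]
    exact hv.tauChain.strictMono.iterate n hx
  -- Strict lower bound for everything of degree less than `n`; with `n = r.deg` it applies to `r`
  -- minus its leading term.
  have H : ∀ (n : ℕ) (p : TwistedPoly φ), (∀ i, n ≤ i → p.coeff i = 0) →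
      τ^[n] (v x) < v (x <• p) := fun n => by
    induction n with
    | zero =>
      intro p hp
      have : p = 0 := ext fun i => hp i (Nat.zero_le i)
      rw [this, MulOpposite.op_zero, zero_smul, hv.map_zero]
      exact lt_top_of_lt (lt_of_le_of_ne le_top fun h => by
        simp only [Function.iterate_zero, id] at h
        rw [h, hv.tauChain.map_top] at hx
        exact lt_irrefl _ hx)
    | succ n ih =>
      intro p hp
      have h1 : p = (p - monomial φ n (p.coeff n)) + monomial φ n (p.coeff n) := by abel
      rw [h1, MulOpposite.op_add, add_smul]
      refine hv.lt_map_add ((hlt n).trans (ih _ fun i hi => ?_)) ?_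
      · rw [coeff_sub, coeff_monomial]
        split_ifs with h2
        · rw [h2, sub_self]
        · rw [hp i (by omega), sub_zero]
      · by_cases ha : p.coeff n = 0
        · rw [ha, _root_.map_zero, MulOpposite.op_zero, zero_smul, hv.map_zero]
          exact lt_of_lt_of_le (hlt n) le_top
        · rw [hv.map_monomial n ha]
          exact hlt n
  have h1 : r = monomial φ r.deg (r.coeff r.deg) + (r - monomial φ r.deg (r.coeff r.deg)) := by abel
  have h2 := hv.map_monomial r.deg (coeff_deg_ne_zero hr) x
  rw [h1, MulOpposite.op_add, add_smul, hv.map_add_eq_of_lt, h2, ← h1]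
  rw [h2]
  refine H _ _ fun i hi => ?_
  rw [coeff_sub, coeff_monomial]
  split_ifs with h3
  · rw [h3, sub_self]
  · rw [coeff_eq_zero_of_deg_lt (by omega), sub_zero]

/-- Above `θ` the values of the terms increase with the degree, so the lowest term decides. Left
factors `t` are stripped one at a time, which reduces to a nonzero constant coefficient. -/
theorem map_smul_of_mem_gtTheta (hv : IsValuedModule φ τ v) {r : TwistedPoly φ} (hr : r ≠ 0)
    {x : M} (hx : x ∈ hv.gtTheta) : v (x <• r) = τ^[r.ord] (v x) := by
  suffices H : ∀ (n : ℕ) (r : TwistedPoly φ), r ≠ 0 → r.ord = n → ∀ x ∈ hv.gtTheta,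
      v (x <• r) = τ^[n] (v x) from H _ r hr rfl x hx
  clear hx hr x r
  intro n
  induction n with
  | zero =>
    intro r hr h0 x hx
    have h1 := coeff_ord_ne_zero hr
    rw [h0] at h1
    rcases hx with hx | hx
    swap
    · rw [(hv.eq_top_iff x).1 hx, smul_zero]; rfl
    have h2 : r = monomial φ 0 (r.coeff 0) + (r - monomial φ 0 (r.coeff 0)) := by abel
    have h3 := hv.map_monomial 0 h1 x
    rw [h2, MulOpposite.op_add, add_smul, hv.map_add_eq_of_lt, h3]
    rw [h3]
    -- Without its constant term `r` is some `t φ * s`, and `(x.t).s` has value at least `τ (v x) >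
    -- v x`.
    by_cases hsep : (r - monomial φ 0 (r.coeff 0)).IsSeparable
    · refine absurd ?_ hsep.coeff_zero_ne_zero
      rw [coeff_sub, coeff_monomial, if_pos rfl, sub_self]
    · obtain ⟨s, hs⟩ := not_not.1 hsep
      rw [hs, MulOpposite.op_mul, mul_smul]
      have h4 : AboveTheta τ (v (x <• t φ)) := by
        rw [hv.map_t, hv.tauChain.aboveTheta_map_iff]; exact Or.inl hx
      refine lt_of_lt_of_le ?_ (hv.le_map_smul (hv.gtTheta_le_geTheta h4) s)
      rw [hv.map_t]; exact hx
  | succ n ih =>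
    intro r hr h0 x hx
    have hsep : ¬ r.IsSeparable := fun h => by rw [h.ord_eq_zero] at h0; omega
    obtain ⟨s, rfl⟩ := not_not.1 hsep
    have hs : s ≠ 0 := right_ne_zero_of_mul hr
    rw [ord_t_mul hs] at h0
    rw [MulOpposite.op_mul, mul_smul, ih s hs (by omega), hv.map_t, Function.iterate_succ_apply]
    rw [hv.mem_gtTheta, hv.map_t, hv.tauChain.aboveTheta_map_iff]; exact hx

/-- Multiplication by `r ≠ 0` reflects membership in `M_{≥ θ}`. -/
theorem smul_mem_geTheta_iff (hv : IsValuedModule φ τ v) {r : TwistedPoly φ} (hr : r ≠ 0) {x : M} :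
    x <• r ∈ hv.geTheta ↔ x ∈ hv.geTheta := by
  refine ⟨fun h => ?_, hv.geTheta.smul_mem _⟩
  by_contra hx
  rw [hv.mem_geTheta, hv.map_smul_of_not_mem_geTheta hr hx, hv.tauChain.le_map_iterate_iff] at h
  exact hx h

/-- `M_{> θ}` is torsion-free because `τ^[r.ord]` is injective and fixes `∞`. Hence the torsion of
`M` embeds into `M / M_{> θ}`. -/
theorem eq_zero_of_smul_eq_zero (hv : IsValuedModule φ τ v) {r : TwistedPoly φ} (hr : r ≠ 0)
    {x : M} (hx : x ∈ hv.gtTheta) (h : x <• r = 0) : x = 0 := by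
  have h1 := hv.map_smul_of_mem_gtTheta hr hx
  rw [h, hv.map_zero] at h1
  refine (hv.eq_top_iff x).1 (hv.tauChain.iterate_injective r.ord ?_)
  rw [← h1, Function.iterate_fixed hv.tauChain.map_top]

/-- If `x - y ∈ M_{≥ θ}`, then `x` and `y` have the same values below `θ`. -/
theorem map_eq_of_sub_mem (hv : IsValuedModule φ τ v) {x y : M} (hx : x ∉ hv.geTheta)
    (h : x - y ∈ hv.geTheta) : v y = v x := by
  have h1 : y = x + -(x - y) := by abel
  rw [h1]
  refine hv.map_add_eq_of_lt ?_
  rw [hv.map_neg]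
  by_contra! h2
  exact hx (hv.tauChain.le_map_of_le h h2)

theorem map_eq_of_le_of_not_mem (hv : IsValuedModule φ τ v) {x : M} {γ : Δ}
    (hx : x ∈ hv.geTheta) (hx' : x ∉ hv.gtTheta) (hγ : γ ≤ τ γ) (hγ' : ¬ AboveTheta τ γ) :
    v x = γ := hv.tauChain.eq_of_fixed hx hx' hγ hγ'

end IsValuedModule

namespace IsHenselianValuedModule

open TwistedPoly

variable {K : Type u} [Field K] {φ : K →+* K} {M Δ : Type u} [AddCommGroup M]
  [Module (TwistedPoly φ)ᵐᵒᵖ M] [LinearOrder Δ] [OrderTop Δ] {τ : Δ → Δ} {v : M → Δ}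

/-- In a divisible henselian module, `M_{> θ}` is divisible. -/
theorem exists_mem_gtTheta_smul_eq (hv : IsHenselianValuedModule φ τ v)
    (hd : IsDivisibleModule (TwistedPoly φ) M) {r : TwistedPoly φ} (hr : r ≠ 0) {x : M}
    (hx : x ∈ hv.gtTheta) : ∃ y ∈ hv.gtTheta, y <• r = x := by
  suffices H : ∀ (n : ℕ) (r : TwistedPoly φ), r ≠ 0 → r.ord = n → ∀ x ∈ hv.gtTheta,
      ∃ y ∈ hv.gtTheta, y <• r = x from H _ r hr rfl x hx
  clear hx hr x r
  intro n
  induction n with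
  | zero =>
    intro r hr h0 x hx
    obtain ⟨y, h1, h2⟩ := hv.henselian r (by
      rintro ⟨s, rfl⟩
      rw [ord_t_mul (right_ne_zero_of_mul hr)] at h0
      omega) x hx
    exact ⟨y, h2, h1.symm⟩
  | succ n ih =>
    intro r hr h0 x hx
    have hsep : ¬ r.IsSeparable := fun h => by rw [h.ord_eq_zero] at h0; omega
    obtain ⟨s, rfl⟩ := not_not.1 hsep
    have hs : s ≠ 0 := right_ne_zero_of_mul hr
    rw [ord_t_mul hs] at h0
    obtain ⟨y, hy, rfl⟩ := ih s hs (by omega) x hx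
    -- Henselianity only covers separable factors. For the factor `t` any preimage in `M` will do,
    -- since `τ` reflects being above `θ`.
    obtain ⟨z, rfl⟩ := hd (t φ) (left_ne_zero_of_mul hr) y
    refine ⟨z, ?_, by rw [MulOpposite.op_mul, mul_smul]⟩
    rw [hv.mem_gtTheta, hv.map_t, hv.tauChain.aboveTheta_map_iff] at hy
    exact hy

end IsHenselianValuedModule

end

noncomputable section

open scoped RightActions Pointwise

/-! ## Systems of equations and inequations in divisible modules -/

namespace TwistedPoly

variable {K : Type u} [Field K] {φ : K →+* K}
  {Q : Type*} [AddCommGroup Q] [Module (TwistedPoly φ)ᵐᵒᵖ Q]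
  {Q' : Type*} [AddCommGroup Q'] [Module (TwistedPoly φ)ᵐᵒᵖ Q']

/-- Divisibility of a right module, without restriction on universes. -/
def Divisible (φ : K →+* K) (Q : Type*) [AddCommGroup Q] [Module (TwistedPoly φ)ᵐᵒᵖ Q] : Prop :=
  ∀ r : TwistedPoly φ, r ≠ 0 → ∀ x : Q, ∃ y : Q, y <• r = x

/-- The set of zeros of `r` as a subgroup. -/
def annSubgroup (Q : Type*) [AddCommGroup Q] [Module (TwistedPoly φ)ᵐᵒᵖ Q] (r : TwistedPoly φ) :
    AddSubgroup Q :=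
  (DistribSMul.toAddMonoidHom Q (MulOpposite.op r)).ker

theorem mem_annSubgroup {r : TwistedPoly φ} {x : Q} : x ∈ annSubgroup Q r ↔ x <• r = 0 := Iff.rfl

/-- Solutions of the linear system `x.(f i) + w i = 0`. -/
def solutions {ι : Type*} (f : ι → TwistedPoly φ) (w : ι → Q) : Set Q :=
  {x | ∀ i, x <• f i + w i = 0}

theorem smul_sum_mul {ι : Type*} [Fintype ι] (f p : ι → TwistedPoly φ) (x : Q) :
    x <• (∑ i, f i * p i) = ∑ i, (x <• f i) <• p i := by
  rw [Finset.op_sum, Finset.sum_smul]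
  exact Finset.sum_congr rfl fun i _ => by rw [MulOpposite.op_mul, mul_smul]

section

variable {ι : Type*} [Fintype ι] {g : TwistedPoly φ} {f p s : ι → TwistedPoly φ}

theorem smul_add_sum_eq_zero (hg : g = ∑ i, f i * p i) {w : ι → Q} {x : Q}
    (hx : x ∈ solutions f w) : x <• g + ∑ i, w i <• p i = 0 := by
  rw [hg, smul_sum_mul, ← Finset.sum_add_distrib]
  exact Finset.sum_eq_zero fun i _ => by rw [← smul_add, hx i, smul_zero]

/-- As `g` is both a right combination and a left divisor of the `f i`, the common zeros of the `f
i` are the zeros of `g`. The solution set, if nonempty, is a coset of this group. -/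
theorem encard_solutions (hg : g = ∑ i, f i * p i) (hs : ∀ i, f i = g * s i) {w : ι → Q}
    (h : (solutions f w).Nonempty) :
    (solutions f w).encard = (annSubgroup Q g : Set Q).encard := by
  obtain ⟨x, hx⟩ := h
  have : solutions f w = (fun y => x + y) '' (annSubgroup Q g : Set Q) := by
    ext z
    constructor
    · intro hz
      refine ⟨z - x, ?_, by simp⟩
      have h1 := smul_add_sum_eq_zero hg hx
      have h2 := smul_add_sum_eq_zero hg hz
      rw [SetLike.mem_coe, mem_annSubgroup, smul_sub, sub_eq_zero]
      exact add_right_cancel (h2.trans h1.symm)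
    · rintro ⟨y, hy, rfl⟩ i
      rw [SetLike.mem_coe, mem_annSubgroup] at hy
      have := hx i
      rw [hs i, MulOpposite.op_mul, mul_smul] at this ⊢
      rw [smul_add, hy, add_zero, this]
  rw [this, (add_right_injective x).encard_image]

/-- The Bézout combination of the equations prescribes `x.g`, which divisibility realizes, and all
`x.(f i)` are then forced. What remains are finitely many equations between terms in the `w i`, so
solvability needs no quantifier. -/
theorem solutions_nonempty_iff (hd : Divisible φ Q) (hg0 : g ≠ 0) (hg : g = ∑ i, f i * p i)
    (hs : ∀ i, f i = g * s i) {w : ι → Q} :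
    (solutions f w).Nonempty ↔ ∀ i, w i - (∑ j, w j <• p j) <• s i = 0 := by
  constructor
  · rintro ⟨x, hx⟩ i
    have h1 := smul_add_sum_eq_zero hg hx
    have h2 := hx i
    rw [← h2, hs i, MulOpposite.op_mul, mul_smul, eq_neg_of_add_eq_zero_left h1, smul_neg]
    abel
  · intro h
    obtain ⟨x, hx⟩ := hd g hg0 (-∑ j, w j <• p j)
    refine ⟨x, fun i => ?_⟩
    rw [hs i, MulOpposite.op_mul, mul_smul, hx, smul_neg, neg_add_eq_zero]
    exact (sub_eq_zero.1 (h i)).symm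

end

section

variable {ι : Type*} {d : TwistedPoly φ} {r : ι → TwistedPoly φ}

/-- Solutions of the system `x.d + u = 0`, `x.(r i) + w i = 0` for `i ∈ S`. -/
def subSolutions (d : TwistedPoly φ) (r : ι → TwistedPoly φ) (u : Q) (w : ι → Q) (S : Finset ι) :
    Set Q :=
  {x | x <• d + u = 0 ∧ ∀ i ∈ S, x <• r i + w i = 0}

/-- The coefficients of a subsystem. -/
def subFamily (d : TwistedPoly φ) (r : ι → TwistedPoly φ) (S : Finset ι) (o : Option S) :
    TwistedPoly φ :=
  o.elim d fun i => r i

theorem subSolutions_eq (d : TwistedPoly φ) (r : ι → TwistedPoly φ) (u : Q) (w : ι → Q)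
    (S : Finset ι) : subSolutions d r u w S =
      solutions (subFamily d r S) fun o => o.elim u fun i => w i := by
  ext x
  simp [subSolutions, solutions, subFamily, Option.forall]

theorem generator_ne_zero (hd : d ≠ 0) {S : Finset ι} {g : TwistedPoly φ}
    {s : Option S → TwistedPoly φ} (hs : ∀ i, subFamily d r S i = g * s i) : g ≠ 0 := by
  rintro rfl
  exact hd (by simpa [subFamily] using hs none)

/-- Both solution sets are empty, or both are cosets of the annihilator of the same `g`, whose size
is the same in the two modules. -/
theorem encard_subSolutions_eq (hd : d ≠ 0)
    (hann : ∀ r : TwistedPoly φ, r ≠ 0 →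
      (annSubgroup Q r : Set Q).encard = (annSubgroup Q' r : Set Q').encard)
    {u : Q} {w : ι → Q} {u' : Q'} {w' : ι → Q'} {S : Finset ι}
    (h : (subSolutions d r u w S).Nonempty ↔ (subSolutions d r u' w' S).Nonempty) :
    (subSolutions d r u w S).encard = (subSolutions d r u' w' S).encard := by
  obtain ⟨g, p, s, hg, hs⟩ := exists_bezout (subFamily d r S)
  rcases (subSolutions d r u w S).eq_empty_or_nonempty with h1 | h1
  · have h2 : subSolutions d r u' w' S = ∅ := by
      rw [← Set.not_nonempty_iff_eq_empty, ← h, h1]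
      exact Set.not_nonempty_empty
    rw [h1, h2, Set.encard_empty, Set.encard_empty]
  · have h2 := h.1 h1
    rw [subSolutions_eq] at h1 h2 ⊢
    rw [subSolutions_eq, encard_solutions hg hs h1, encard_solutions hg hs h2,
      hann g (generator_ne_zero hd hs)]

theorem finite_solutions (hfin : (annSubgroup Q d : Set Q).Finite) (u : Q) :
    {x : Q | x <• d + u = 0}.Finite := by
  have : {x : Q | x <• d + u = 0} = solutions (fun _ : Unit => d) fun _ => u := by
    ext x; simp [solutions]
  rw [this]
  rcases (solutions (fun _ : Unit => d) fun _ => u).eq_empty_or_nonempty with h | h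
  · rw [h]; exact Set.finite_empty
  · rw [← Set.encard_ne_top_iff, encard_solutions (g := d) (p := 1) (s := 1) (by simp) (by simp) h,
      Set.encard_ne_top_iff]
    exact hfin

/-- Inclusion-exclusion for a system of one equation and several inequations. -/
theorem ncard_inequations [Fintype ι] (hfin : (annSubgroup Q d : Set Q).Finite) (u : Q)
    (w : ι → Q) :
    ({x : Q | x <• d + u = 0 ∧ ∀ i, x <• r i + w i ≠ 0}.ncard : ℤ) =
      ∑ S ∈ (Finset.univ : Finset ι).powerset, (-1) ^ S.card *
        ((subSolutions d r u w S).ncard : ℤ) := by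
  classical
  let Y := {x : Q // x <• d + u = 0}
  have : Fintype Y := (finite_solutions hfin u).fintype
  let E : ι → Finset Y := fun i => Finset.univ.filter fun x => x.1 <• r i + w i = 0
  have h1 : {x : Q | x <• d + u = 0 ∧ ∀ i, x <• r i + w i ≠ 0} =
      Subtype.val '' ((Finset.univ.inf fun i => (E i)ᶜ : Finset Y) : Set Y) := by
    ext x
    simp [Y, E, Finset.mem_inf, and_comm]
  have h2 : ∀ S : Finset ι, subSolutions d r u w S =
      Subtype.val '' ((S.inf E : Finset Y) : Set Y) := fun S => by
    ext x
    simp [Y, E, Finset.mem_inf, subSolutions, and_comm]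
  rw [h1, Set.ncard_image_of_injective _ Subtype.val_injective, Set.ncard_coe_finset,
    Finset.inclusion_exclusion_card_inf_compl]
  refine Finset.sum_congr rfl fun S _ => ?_
  rw [h2, Set.ncard_image_of_injective _ Subtype.val_injective, Set.ncard_coe_finset]

/-- By inclusion-exclusion the number of solutions is an alternating sum of the sizes of the
equational subsystems. These sizes agree in `Q` and `Q'`, so a nonzero count transfers. -/
theorem inequations_transfer_of_finite [Finite ι] (hd : d ≠ 0)
    (hann : ∀ r : TwistedPoly φ, r ≠ 0 →
      (annSubgroup Q r : Set Q).encard = (annSubgroup Q' r : Set Q').encard)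
    (hfin : (annSubgroup Q d : Set Q).Finite) {u : Q} {w : ι → Q} {u' : Q'} {w' : ι → Q'}
    (h : ∀ S : Finset ι,
      (subSolutions d r u w S).Nonempty ↔ (subSolutions d r u' w' S).Nonempty)
    (hsol : ∃ x : Q, x <• d + u = 0 ∧ ∀ i, x <• r i + w i ≠ 0) :
    ∃ x : Q', x <• d + u' = 0 ∧ ∀ i, x <• r i + w' i ≠ 0 := by
  cases nonempty_fintype ι
  have hfin' : (annSubgroup Q' d : Set Q').Finite := by
    rw [← Set.encard_ne_top_iff, ← hann d hd, Set.encard_ne_top_iff]; exact hfin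
  have h1 := ncard_inequations (r := r) hfin u w
  have h2 := ncard_inequations (r := r) hfin' u' w'
  have h3 : ({x : Q | x <• d + u = 0 ∧ ∀ i, x <• r i + w i ≠ 0}.ncard : ℤ) =
      {x : Q' | x <• d + u' = 0 ∧ ∀ i, x <• r i + w' i ≠ 0}.ncard := by
    rw [h1, h2]
    refine Finset.sum_congr rfl fun S _ => ?_
    rw [Set.ncard, Set.ncard, encard_subSolutions_eq hd hann (h S)]
  have h4 : {x : Q | x <• d + u = 0 ∧ ∀ i, x <• r i + w i ≠ 0}.ncard ≠ 0 :=
    Set.ncard_ne_zero_of_mem hsol.choose_spec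
      ((finite_solutions hfin u).subset fun x hx => hx.1)
  rw [Nat.cast_injective h3] at h4
  obtain ⟨x, hx⟩ := Set.nonempty_of_ncard_ne_zero h4
  exact ⟨x, hx⟩

/-- Passing from `x` to `x.g`, where `g` divides all coefficients of a system. -/
theorem subSolutions_nonempty_mul (hQ : Divisible φ Q) {g h : TwistedPoly φ} (hg : g ≠ 0)
    {s : ι → TwistedPoly φ} (hd : d = g * h) {S : Finset ι} (hr : ∀ i ∈ S, r i = g * s i)
    (u : Q) (w : ι → Q) :
    (subSolutions h s u w S).Nonempty ↔ (subSolutions d r u w S).Nonempty := by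
  constructor
  · rintro ⟨y, hy, hy'⟩
    obtain ⟨x, rfl⟩ := hQ g hg y
    refine ⟨x, ?_, fun i hi => ?_⟩
    · rw [hd, MulOpposite.op_mul, mul_smul]; exact hy
    · rw [hr i hi, MulOpposite.op_mul, mul_smul]; exact hy' i hi
  · rintro ⟨x, hx, hx'⟩
    refine ⟨x <• g, ?_, fun i hi => ?_⟩
    · rw [← mul_smul, ← MulOpposite.op_mul, ← hd]; exact hx
    · rw [← mul_smul, ← MulOpposite.op_mul, ← hr i hi]; exact hx' i hi

theorem subSolutions_map (E : Finset ι) (u : Q) (w : ι → Q) (S : Finset E) :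
    subSolutions d (fun i : E => r i) u (fun i : E => w i) S =
      subSolutions d r u w (S.map (Function.Embedding.subtype _)) := by
  ext x
  simp [subSolutions]

/-- If the solutions of finitely many equations cover the solutions of `x.d + u = 0`, then so do
those of the equations that define subgroups of finite index. -/
theorem exists_finiteIndex_cover [Finite ι] (u : Q) (w : ι → Q) {x₀ : Q} (hx₀ : x₀ <• d + u = 0)
    (hcov : ∀ x : Q, x <• d + u = 0 → ∃ i, x <• r i + w i = 0) :
    ∃ E : Finset ι,
      (∀ i ∈ E, ((annSubgroup Q (r i)).addSubgroupOf (annSubgroup Q d)).FiniteIndex) ∧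
      ∀ x : Q, x <• d + u = 0 → ∃ i ∈ E, x <• r i + w i = 0 := by
  classical
  cases nonempty_fintype ι
  let A := annSubgroup Q d
  let H : ι → AddSubgroup A := fun i => (annSubgroup Q (r i)).addSubgroupOf A
  -- After translation by `x₀`, each equation with a solution cuts out a coset in `A`. The other
  -- indices contribute nothing, and their representative `0` in `a` is never used.
  let s : Finset ι := Finset.univ.filter fun i => ∃ a : A, (x₀ + a.1) <• r i + w i = 0
  let a : ι → A := fun i =>
    if h : ∃ a : A, (x₀ + a.1) <• r i + w i = 0 then h.choose else 0
  have ha : ∀ i ∈ s, (x₀ + (a i).1) <• r i + w i = 0 := fun i hi => by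
    have h := (Finset.mem_filter.1 hi).2
    simp only [a, dif_pos h]
    exact h.choose_spec
  have hmem : ∀ i ∈ s, ∀ b : A, b ∈ a i +ᵥ (H i : Set A) ↔ (x₀ + b.1) <• r i + w i = 0 := by
    intro i hi b
    rw [mem_leftAddCoset_iff, SetLike.mem_coe, AddSubgroup.mem_addSubgroupOf, mem_annSubgroup]
    have h1 := ha i hi
    have h2 : ((-a i + b : A) : Q) <• r i =
        ((x₀ + b.1) <• r i + w i) - ((x₀ + (a i).1) <• r i + w i) := by
      rw [AddSubgroup.coe_add, AddSubgroup.coe_neg]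
      simp only [smul_add, smul_neg]; abel
    rw [h2, h1, sub_zero]
  have hc : ⋃ i ∈ s, a i +ᵥ (H i : Set A) = Set.univ := by
    refine Set.eq_univ_of_forall fun b => ?_
    obtain ⟨i, hi⟩ := hcov (x₀ + b.1) (by
      rw [smul_add, mem_annSubgroup.1 b.2, add_zero, hx₀])
    have his : i ∈ s := Finset.mem_filter.2 ⟨Finset.mem_univ i, b, hi⟩
    exact Set.mem_biUnion his ((hmem i his b).2 hi)
  -- Neumann's lemma: in a finite cover by cosets those of infinite index are superfluous.
  have h1 := AddSubgroup.leftCoset_cover_filter_FiniteIndex hc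
  refine ⟨s.filter fun i => (H i).FiniteIndex, fun i hi => (Finset.mem_filter.1 hi).2,
    fun x hx => ?_⟩
  have hb : x - x₀ ∈ A := by
    rw [mem_annSubgroup, smul_sub, sub_eq_zero]
    exact add_right_cancel (hx.trans hx₀.symm)
  have h2 : (⟨x - x₀, hb⟩ : A) ∈
      ⋃ k ∈ s.filter (fun i => (H i).FiniteIndex), a k +ᵥ (H k : Set A) := by
    rw [h1]; trivial
  simp only [Set.mem_iUnion] at h2
  obtain ⟨i, hi, h2⟩ := h2
  refine ⟨i, hi, ?_⟩
  rw [hmem i (Finset.mem_filter.1 hi).1] at h2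
  simpa using h2

/-- Multiplication by `g` maps the zeros of `d = g * h` onto those of `h`, by divisibility. Its
kernel contains the common zeros of `d` and the `r i`, a finite intersection of subgroups of finite
index, so the image is finite. -/
theorem finite_annSubgroup_of_finiteIndex (hQ : Divisible φ Q) {S : Finset ι}
    {g h : TwistedPoly φ} {p : Option S → TwistedPoly φ} (hg0 : g ≠ 0)
    (hg : g = ∑ i, subFamily d r S i * p i) (hd : d = g * h)
    (hfin : ∀ i ∈ S, ((annSubgroup Q (r i)).addSubgroupOf (annSubgroup Q d)).FiniteIndex) :
    (annSubgroup Q h : Set Q).Finite := by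
  let A := annSubgroup Q d
  let f : A →+ Q := (DistribSMul.toAddMonoidHom Q (MulOpposite.op g)).comp A.subtype
  have h1 : (⨅ i : S, (annSubgroup Q (r i)).addSubgroupOf A).FiniteIndex :=
    AddSubgroup.finiteIndex_iInf fun i => hfin i.1 i.2
  have h2 : ⨅ i : S, (annSubgroup Q (r i)).addSubgroupOf A ≤ f.ker := by
    intro x hx
    rw [AddSubgroup.mem_iInf] at hx
    change x.1 <• g = 0
    rw [hg, smul_sum_mul]
    refine Finset.sum_eq_zero fun o _ => ?_
    cases o with
    | none =>
      have : x.1 <• d = 0 := x.2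
      simp [subFamily, this]
    | some i =>
      have : x.1 <• r i = 0 := hx i
      simp [subFamily, this]
  have h3 : f.ker.FiniteIndex := AddSubgroup.finiteIndex_of_le h2
  have h4 : (annSubgroup Q h : Set Q) ⊆ f.range := by
    intro y hy
    obtain ⟨x, rfl⟩ := hQ g hg0 y
    refine ⟨⟨x, ?_⟩, rfl⟩
    rw [mem_annSubgroup, hd, MulOpposite.op_mul, mul_smul]
    exact hy
  have : Finite (A ⧸ f.ker) := AddSubgroup.finite_quotient_of_finiteIndex
  have : Finite f.range := Finite.of_equiv _ (QuotientAddGroup.quotientKerEquivRange f).toEquiv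
  exact (Set.toFinite (f.range : Set Q)).subset h4

/-- In divisible modules with annihilators of the same sizes, the solvability of a system of one
equation and several inequations only depends on which subsystems of equations are solvable. -/
theorem inequations_transfer [Finite ι] (hd : d ≠ 0) (hQ : Divisible φ Q) (hQ' : Divisible φ Q')
    (hann : ∀ r : TwistedPoly φ, r ≠ 0 →
      (annSubgroup Q r : Set Q).encard = (annSubgroup Q' r : Set Q').encard)
    {u : Q} {w : ι → Q} {u' : Q'} {w' : ι → Q'}
    (h : ∀ S : Finset ι,
      (subSolutions d r u w S).Nonempty ↔ (subSolutions d r u' w' S).Nonempty)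
    (hsol : ∃ x : Q, x <• d + u = 0 ∧ ∀ i, x <• r i + w i ≠ 0) :
    ∃ x : Q', x <• d + u' = 0 ∧ ∀ i, x <• r i + w' i ≠ 0 := by
  classical
  -- If there is no solution in `Q'`, the equations cover the solutions of `x.d + u' = 0`, and
  -- already those in a set `E` of finite-index equations do. Dividing `d` and these `r i` by their
  -- common divisor `g` makes the torsion of the quotient `s none` finite, so the counting argument
  -- applies to the reduced system.
  by_contra! hcov
  obtain ⟨x₀, hx₀⟩ := hQ' d hd (-u')
  obtain ⟨E, hE, hcovE⟩ := exists_finiteIndex_cover u' w' (x₀ := x₀) (by rw [hx₀, neg_add_cancel])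
    hcov
  obtain ⟨g, p, s, hg, hs⟩ := exists_bezout (subFamily d r E)
  have hg0 := generator_ne_zero hd hs
  have hdg : d = g * s none := hs none
  have hrg : ∀ i : E, r i = g * s (some i) := fun i => hs (some i)
  have hh0 : s none ≠ 0 := fun h0 => hd (by rw [hdg, h0, mul_zero])
  have hfin' := finite_annSubgroup_of_finiteIndex hQ' hg0 hg hdg hE
  have hfin : (annSubgroup Q (s none) : Set Q).Finite := by
    rw [← Set.encard_ne_top_iff, hann _ hh0, Set.encard_ne_top_iff]; exact hfin'
  obtain ⟨x, hx, hx'⟩ := hsol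
  obtain ⟨y, hy, hy'⟩ := inequations_transfer_of_finite (ι := E) (r := fun i => s (some i))
    (u := u) (w := fun i => w i) (u' := u') (w' := fun i => w' i) hh0 hann hfin (fun S => by
      rw [subSolutions_nonempty_mul hQ hg0 hdg (r := fun i : E => r i) (fun i _ => hrg i),
        subSolutions_nonempty_mul hQ' hg0 hdg (r := fun i : E => r i) (fun i _ => hrg i),
        subSolutions_map, subSolutions_map]
      exact h _)
    ⟨x <• g, by rw [← mul_smul, ← MulOpposite.op_mul, ← hdg]; exact hx, fun i => by
      rw [← mul_smul, ← MulOpposite.op_mul, ← hrg]; exact hx' i⟩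
  -- A preimage of the reduced solution under `g` solves the original equation and escapes the
  -- cover.
  obtain ⟨z, rfl⟩ := hQ' g hg0 y
  obtain ⟨i, hi, hz⟩ := hcovE z (by
    rw [hdg, MulOpposite.op_mul, mul_smul]; exact hy)
  refine hy' ⟨i, hi⟩ ?_
  dsimp only
  rw [← mul_smul, ← MulOpposite.op_mul, ← hrg]
  exact hz

end

end TwistedPoly

end

/-! ### Prescribing the values of several translates in a valued group. -/

noncomputable section

open scoped RightActions Pointwise

namespace IsValuedGroup

/-- `M_{≥ γ}` has `n` elements no two of which are congruent modulo `M_{> γ}`. -/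
def HasResidues {M Δ : Type u} [AddCommGroup M] [LinearOrder Δ] (v : M → Δ) (n : ℕ) (γ : Δ) : Prop :=
  ∃ a : Fin n → M, (∀ i, γ ≤ v (a i)) ∧ ∀ i j, i ≠ j → ¬ γ < v (a i - a j)

theorem hasResidues_of_card {M Δ : Type u} [AddCommGroup M] [LinearOrder Δ] {v : M → Δ} {κ : Type*} [Fintype κ] {γ : Δ} {n : ℕ} (hn : Fintype.card κ = n)
    (a : κ → M) (h : ∀ i, γ ≤ v (a i)) (h' : ∀ i j, i ≠ j → ¬ γ < v (a i - a j)) :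
    HasResidues v n γ := by
  let e := (Fintype.equivFinOfCardEq hn).symm
  exact ⟨a ∘ e, fun i => h _, fun i j hij => h' _ _ fun h => hij (e.injective h)⟩

variable {M Δ : Type u} [AddCommGroup M] [LinearOrder Δ] [OrderTop Δ] {v : M → Δ} {ι : Type*}

/-- The value `∞` at `i₀` forces `y = -w i₀`. -/
theorem exists_values_iff_of_top (hv : IsValuedGroup v) {w : ι → M} {γ : ι → Δ} {i₀ : ι}
    (h : γ i₀ = ⊤) : (∃ y, ∀ i, v (y + w i) = γ i) ↔ ∀ i, v (w i - w i₀) = γ i := by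
  constructor
  · rintro ⟨y, hy⟩ i
    have h1 := hy i₀
    rw [h, hv.eq_top_iff] at h1
    rw [← hy i, eq_neg_of_add_eq_zero_left h1, neg_add_eq_sub]
  · exact fun h1 => ⟨-w i₀, fun i => by rw [neg_add_eq_sub, h1]⟩

/-- Solvability of `v(y + w i) = γ i` in terms of the values of the differences of the `w i` and
the size of one residue group. -/
theorem exists_values_iff_of_ne_top [Finite ι] (hv : IsValuedGroup v) {w : ι → M} {γ : ι → Δ}
    {i₀ : ι} (htop : γ i₀ ≠ ⊤) (hmax : ∀ i, γ i ≤ γ i₀) :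
    (∃ y, ∀ i, v (y + w i) = γ i) ↔
      (∀ i, γ i < γ i₀ → v (w i - w i₀) = γ i) ∧ (∀ i, γ i = γ i₀ → γ i₀ ≤ v (w i - w i₀)) ∧
      ∃ S : Finset ι, (∀ i ∈ S, γ i = γ i₀) ∧
        (∀ i ∈ S, ∀ j ∈ S, i ≠ j → ¬ γ i₀ < v (w i - w j)) ∧
        (∀ i, γ i = γ i₀ → ∃ j ∈ S, γ i₀ < v (w i - w j)) ∧ HasResidues v (S.card + 1) (γ i₀) := by
  classical
  cases nonempty_fintype ι
  constructor
  · rintro ⟨y, hy⟩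
    have hge : ∀ i, γ i = γ i₀ → γ i₀ ≤ v (w i - w i₀) := fun i hi => by
      have h1 : w i - w i₀ = (y + w i) - (y + w i₀) := by abel
      rw [h1]
      exact hv.le_map_sub (by rw [hy, hi]) (by rw [hy])
    refine ⟨fun i hi => ?_, hge, ?_⟩
    · have h1 : w i - w i₀ = (y + w i) + -(y + w i₀) := by abel
      rw [h1, hv.map_add_eq_of_lt, hy]
      rwa [hv.map_neg, hy, hy]
    -- A largest `S` satisfying `P` represents all classes modulo `M_{> γ i₀}` of the `w i` whose
    -- prescribed value is the maximal one.
    · let P : Finset ι → Prop := fun S => (∀ i ∈ S, γ i = γ i₀) ∧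
        (∀ i ∈ S, ∀ j ∈ S, i ≠ j → ¬ γ i₀ < v (w i - w j))
      obtain ⟨S, hS, hmaxS⟩ := (Finset.univ.filter P).exists_max_image Finset.card
        ⟨∅, Finset.mem_filter.2 ⟨Finset.mem_univ _, by simp, by simp⟩⟩
      have hPS : P S := (Finset.mem_filter.1 hS).2
      refine ⟨S, hPS.1, hPS.2, fun i hi => ?_, ?_⟩
      · by_contra! hcon
        have hiS : i ∉ S := fun h => by
          have h1 := hcon i h
          rw [sub_self, hv.map_zero, top_le_iff] at h1
          exact htop h1
        have hP : P (insert i S) := by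
          refine ⟨fun j hj => ?_, fun j hj k hk hjk => ?_⟩
          · rcases Finset.mem_insert.1 hj with rfl | hj
            · exact hi
            · exact hPS.1 j hj
          · rcases Finset.mem_insert.1 hj with h1 | h1 <;>
              rcases Finset.mem_insert.1 hk with h2 | h2
            · exact absurd (h1.trans h2.symm) hjk
            · rw [h1]; exact not_lt.2 (hcon k h2)
            · rw [h2, hv.map_sub_comm]; exact not_lt.2 (hcon j h1)
            · exact hPS.2 j h1 k h2 hjk
        have h1 := hmaxS _ (Finset.mem_filter.2 ⟨Finset.mem_univ _, hP⟩)
        rw [Finset.card_insert_of_notMem hiS] at h1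
        omega
      -- The classes `w i₀ - w i` with `i ∈ S` are those that `y + w i₀` has to avoid. Together with
      -- `y + w i₀` itself they are `S.card + 1` distinct residues.
      · refine hasResidues_of_card (κ := Option S) (by simp)
          (fun o => o.elim (y + w i₀) fun i => w i₀ - w i) ?_ ?_
        · rintro (_ | ⟨i, hi⟩)
          · exact (hy i₀).ge
          · dsimp only [Option.elim]
            rw [hv.map_sub_comm]
            exact hge i (hPS.1 i hi)
        · have h1 : ∀ i ∈ S, ¬ γ i₀ < v (y + w i₀ - (w i₀ - w i)) := fun i hi => by
            have : y + w i₀ - (w i₀ - w i) = y + w i := by abel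
            rw [this, hy i, hPS.1 i hi]
            exact lt_irrefl _
          rintro (_ | ⟨i, hi⟩) (_ | ⟨j, hj⟩) hij
          · exact absurd rfl hij
          · exact h1 j hj
          · rw [hv.map_sub_comm]; exact h1 i hi
          · have : w i₀ - w i - (w i₀ - w j) = w j - w i := by abel
            dsimp only [Option.elim]
            rw [this]
            exact hPS.2 j hj i hi fun h => hij (by subst h; rfl)
  · rintro ⟨hlt, hge, S, hS, -, hS', a, ha, ha'⟩
    -- Pigeonhole: `S.card` forbidden classes cannot contain all `S.card + 1` residues.
    obtain ⟨l, hl⟩ : ∃ l, ∀ i ∈ S, ¬ γ i₀ < v (a l + (w i - w i₀)) := by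
      by_contra! hcon
      choose f hf hf' using hcon
      obtain ⟨l, l', hne, heq⟩ := Fintype.exists_ne_map_eq_of_card_lt
        (fun l => (⟨f l, hf l⟩ : S)) (by simp)
      refine ha' l l' hne ?_
      have h1 : a l - a l' = (a l + (w (f l) - w i₀)) - (a l' + (w (f l') - w i₀)) := by
        have : f l = f l' := congrArg Subtype.val heq
        rw [this]; abel
      rw [h1]
      exact hv.lt_map_sub (hf' l) (hf' l')
    refine ⟨a l - w i₀, fun i => ?_⟩
    rcases (hmax i).lt_or_eq with hi | hi
    · have h1 : a l - w i₀ + w i = (w i - w i₀) + a l := by abel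
      rw [h1, hv.map_add_eq_of_lt, hlt i hi]
      rw [hlt i hi]
      exact hi.trans_le (ha l)
    · have h1 : a l - w i₀ + w i = a l + (w i - w i₀) := by abel
      rw [h1, hi]
      refine le_antisymm (not_lt.1 fun h2 => ?_) (hv.le_map_add (ha l) (hge i hi))
      obtain ⟨j, hj, h3⟩ := hS' i hi
      refine hl j hj ?_
      have h4 : a l + (w j - w i₀) = a l + (w i - w i₀) - (w i - w j) := by abel
      rw [h4]
      exact hv.lt_map_sub h2 h3

end IsValuedGroup

end

/-! ### Linear value systems in divisible henselian modules. -/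

noncomputable section

open scoped RightActions Pointwise

namespace IsHenselianValuedModule

open TwistedPoly

variable {K : Type u} [Field K] {φ : K →+* K} {M Δ : Type u} [AddCommGroup M]
  [Module (TwistedPoly φ)ᵐᵒᵖ M] [LinearOrder Δ] [OrderTop Δ] {τ : Δ → Δ} {v : M → Δ}
  {ι : Type*}

/-- `M_{≥ θ} / M_{> θ}` is infinite if it is non-zero. -/
theorem infinite_quotient (hv : IsHenselianValuedModule φ τ v)
    (hd : IsDivisibleModule (TwistedPoly φ) M) {x₀ : M} (hx₀ : x₀ ∈ hv.geTheta)
    (hx₀' : x₀ ∉ hv.gtTheta) :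
    Infinite (hv.geTheta ⧸ hv.gtTheta.comap hv.geTheta.subtype) := by
  by_contra hfin
  rw [not_infinite_iff_finite] at hfin
  let k := hv.geTheta ⧸ hv.gtTheta.comap hv.geTheta.subtype
  -- A finite quotient has only finitely many self-maps, so some `r - s ≠ 0` kills it. But `x₀` is a
  -- multiple `y.(r - s)` with `y` in `M_{≥ θ}`.
  obtain ⟨r, s, hne, heq⟩ := Finite.exists_ne_map_eq_of_infinite
    fun (r : TwistedPoly φ) (x : k) => x <• r
  obtain ⟨y, hy⟩ := hd (r - s) (sub_ne_zero.2 hne) x₀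
  have hyge : y ∈ hv.geTheta := by
    rw [← hv.smul_mem_geTheta_iff (sub_ne_zero.2 hne), hy]; exact hx₀
  have h1 := congrFun heq (Submodule.Quotient.mk ⟨y, hyge⟩)
  rw [← sub_eq_zero, ← sub_smul, ← MulOpposite.op_sub, ← Submodule.Quotient.mk_smul,
    Submodule.Quotient.mk_eq_zero] at h1
  refine hx₀' ?_
  rw [← hy]
  exact h1

/-- If the value `θ` exists, then finitely many values can simultaneously be made equal to `θ`. -/
theorem exists_not_mem_gtTheta [Finite ι] (hv : IsHenselianValuedModule φ τ v)
    (hd : IsDivisibleModule (TwistedPoly φ) M) {x₀ : M} (hx₀ : x₀ ∈ hv.geTheta)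
    (hx₀' : x₀ ∉ hv.gtTheta) {r : ι → TwistedPoly φ} (hr : ∀ i, r i ≠ 0) {w : ι → M}
    (hw : ∀ i, w i ∈ hv.geTheta) :
    ∃ x ∈ hv.geTheta, ∀ i, x <• r i + w i ∉ hv.gtTheta := by
  cases nonempty_fintype ι
  by_contra! hcov
  let f : ι → hv.geTheta →+ (hv.geTheta ⧸ hv.gtTheta.comap hv.geTheta.subtype) := fun i =>
    (Submodule.mkQ (hv.gtTheta.comap hv.geTheta.subtype)).toAddMonoidHom.comp
      (DistribSMul.toAddMonoidHom hv.geTheta (MulOpposite.op (r i)))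
  have hf : ∀ i, ∀ x : hv.geTheta, x ∈ (f i).ker ↔ x.1 <• r i ∈ hv.gtTheta := fun i x => by
    rw [AddMonoidHom.mem_ker]
    exact Submodule.Quotient.mk_eq_zero _
  have hb : ∀ i, ∃ b : hv.geTheta, b.1 <• r i = -w i := fun i => by
    obtain ⟨b, hb⟩ := hd (r i) (hr i) (-w i)
    refine ⟨⟨b, ?_⟩, hb⟩
    rw [← hv.smul_mem_geTheta_iff (hr i), hb]
    exact hv.geTheta.neg_mem (hw i)
  choose b hb using hb
  have hc : ⋃ i ∈ (Finset.univ : Finset ι), b i +ᵥ ((f i).ker : Set hv.geTheta) = Set.univ := by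
    refine Set.eq_univ_of_forall fun x => ?_
    obtain ⟨i, hi⟩ := hcov x.1 x.2
    refine Set.mem_biUnion (Finset.mem_coe.2 (Finset.mem_univ i)) ?_
    rw [mem_leftAddCoset_iff, SetLike.mem_coe, hf]
    have : ((-b i + x : hv.geTheta) : M) <• r i = x.1 <• r i + w i := by
      rw [Submodule.coe_add, Submodule.coe_neg, smul_add, smul_neg, hb, neg_neg, add_comm]
    rw [this]; exact hi
  -- By Neumann's lemma some kernel has finite index. Since `f i` is surjective, `M_{≥ θ} / M_{> θ}`
  -- would be finite.
  obtain ⟨i, -, hi⟩ := AddSubgroup.exists_finiteIndex_of_leftCoset_cover hc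
  have hsurj : Function.Surjective (f i) := by
    intro y
    obtain ⟨y, rfl⟩ := Submodule.Quotient.mk_surjective _ y
    obtain ⟨z, hz⟩ := hd (r i) (hr i) y.1
    refine ⟨⟨z, ?_⟩, ?_⟩
    · rw [← hv.smul_mem_geTheta_iff (hr i), hz]; exact y.2
    · exact congrArg Submodule.Quotient.mk (Subtype.ext hz)
  have : Finite (hv.geTheta ⧸ (f i).ker) := AddSubgroup.finite_quotient_of_finiteIndex
  have h1 : Finite (hv.geTheta ⧸ hv.gtTheta.comap hv.geTheta.subtype) :=
    Finite.of_surjective _ (QuotientAddGroup.quotientKerEquivOfSurjective (f i) hsurj).surjective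
  have h2 := hv.infinite_quotient hd hx₀ hx₀'
  exact not_finite (hv.geTheta ⧸ hv.gtTheta.comap hv.geTheta.subtype)

section

variable {r q : ι → TwistedPoly φ} {u : ι → M} {γ : ι → Δ}

/-- Applying `q i` turns every `a.(r i)` into the same element `a.m`, which is arbitrary by
divisibility. No information is lost: `q i` preserves and reflects being below `θ`, and acts there
on values by an injective iterate of `τ`. -/
theorem exists_values_iff_of_lt_theta (hv : IsHenselianValuedModule φ τ v)
    (hd : IsDivisibleModule (TwistedPoly φ) M) {m : TwistedPoly φ} (hm : m ≠ 0)
    (hq : ∀ i, q i ≠ 0) (hrq : ∀ i, r i * q i = m) (hγ : ∀ i, ¬ γ i ≤ τ (γ i)) :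
    (∃ a, ∀ i, v (a <• r i + u i) = γ i) ↔
      ∃ y, ∀ i, v (y + u i <• q i) = τ^[(q i).deg] (γ i) := by
  have key : ∀ a i, v (a <• m + u i <• q i) = τ^[(q i).deg] (γ i) ↔ v (a <• r i + u i) = γ i := by
    intro a i
    have h1 : a <• m + u i <• q i = (a <• r i + u i) <• q i := by
      rw [smul_add, ← hrq i, MulOpposite.op_mul, mul_smul]
    rw [h1]
    constructor
    · intro h
      have h2 : a <• r i + u i ∉ hv.geTheta := by
        rw [← hv.smul_mem_geTheta_iff (hq i), hv.mem_geTheta, h, hv.tauChain.le_map_iterate_iff]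
        exact hγ i
      rw [hv.map_smul_of_not_mem_geTheta (hq i) h2] at h
      exact hv.tauChain.iterate_injective _ h
    · intro h
      rw [hv.map_smul_of_not_mem_geTheta (hq i), h]
      rw [hv.mem_geTheta, h]
      exact hγ i
  constructor
  · rintro ⟨a, ha⟩
    exact ⟨a <• m, fun i => (key a i).2 (ha i)⟩
  · rintro ⟨y, hy⟩
    obtain ⟨a, rfl⟩ := hd m hm y
    exact ⟨a, fun i => (key a i).1 (hy i)⟩

/-- The conditions on `x.(r i) + u i` modulo `M_{≥ θ}`, once `x.(r i₀) + u i₀ ∈ M_{≥ θ}`. -/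
def Compatible (τ : Δ → Δ) (v : M → Δ) (i₀ : ι) (p q : ι → TwistedPoly φ) (u : ι → M)
    (γ : ι → Δ) : Prop :=
  ∀ i, (γ i ≤ τ (γ i) → v (u i <• q i - u i₀ <• p i) ≤ τ (v (u i <• q i - u i₀ <• p i))) ∧
    (¬ γ i ≤ τ (γ i) → v (u i <• q i - u i₀ <• p i) = τ^[(q i).deg] (γ i))

variable {i₀ : ι} {p : ι → TwistedPoly φ}

/-- Since `r i * q i = r i₀ * p i`, the combination `u i.(q i) - u i₀.(p i)` does not involve `a`.
It agrees with `(a.(r i) + u i).(q i)` up to a multiple of `a.(r i₀) + u i₀`, hence modulo `M_{≥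
θ}`. So these conditions are the same for every `a` that is correct at `i₀`. -/
theorem compatible_iff (hv : IsHenselianValuedModule φ τ v) (hq : ∀ i, q i ≠ 0)
    (hrq : ∀ i, r i * q i = r i₀ * p i) {a : M} (ha : a <• r i₀ + u i₀ ∈ hv.geTheta) :
    Compatible τ v i₀ p q u γ ↔ ∀ i, (γ i ≤ τ (γ i) → a <• r i + u i ∈ hv.geTheta) ∧
      (¬ γ i ≤ τ (γ i) → v (a <• r i + u i) = γ i) := by
  refine forall_congr' fun i => ?_
  have h1 : (a <• r i + u i) <• q i - (u i <• q i - u i₀ <• p i) = (a <• r i₀ + u i₀) <• p i := by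
    rw [smul_add, smul_add, ← mul_smul, ← mul_smul, ← MulOpposite.op_mul, ← MulOpposite.op_mul,
      hrq i]
    abel
  have h2 : (a <• r i + u i) <• q i - (u i <• q i - u i₀ <• p i) ∈ hv.geTheta := by
    rw [h1]; exact hv.geTheta.smul_mem _ ha
  have h3 : (u i <• q i - u i₀ <• p i) - (a <• r i + u i) <• q i ∈ hv.geTheta := by
    rw [← neg_sub]; exact hv.geTheta.neg_mem h2
  have h4 : u i <• q i - u i₀ <• p i ∈ hv.geTheta ↔ a <• r i + u i ∈ hv.geTheta := by
    rw [← hv.smul_mem_geTheta_iff (hq i) (x := a <• r i + u i)]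
    exact ⟨fun h => by simpa using hv.geTheta.add_mem h2 h,
      fun h => by simpa using hv.geTheta.add_mem h3 h⟩
  refine and_congr (imp_congr_right fun _ => h4) (imp_congr_right fun hγ => ?_)
  constructor
  · intro h
    have h5 : u i <• q i - u i₀ <• p i ∉ hv.geTheta := by
      rw [hv.mem_geTheta, h, hv.tauChain.le_map_iterate_iff]; exact hγ
    have h6 := hv.map_eq_of_sub_mem h5 h3
    rw [hv.map_smul_of_not_mem_geTheta (hq i) (fun h7 => h5 (h4.2 h7)), h] at h6
    exact hv.tauChain.iterate_injective _ h6
  · intro h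
    have h5 : a <• r i + u i ∉ hv.geTheta := by rw [hv.mem_geTheta, h]; exact hγ
    have h6 : (a <• r i + u i) <• q i ∉ hv.geTheta := by
      rwa [hv.smul_mem_geTheta_iff (hq i)]
    rw [hv.map_eq_of_sub_mem h6 h2, hv.map_smul_of_not_mem_geTheta (hq i) h5, h]

/-- Take `c` with `c.(r i₀) + u i₀ = 0`. Moving `c` by `x ∈ M_{≥ θ}` keeps every condition modulo
`M_{≥ θ}`, and `exists_not_mem_gtTheta` supplies an `x` for which the forms that should have value
`θ` leave `M_{> θ}`. -/
theorem exists_values_iff_of_le_theta [Finite ι] (hv : IsHenselianValuedModule φ τ v)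
    (hd : IsDivisibleModule (TwistedPoly φ) M) (hr : ∀ i, r i ≠ 0) (hq : ∀ i, q i ≠ 0)
    (hrq : ∀ i, r i * q i = r i₀ * p i) (hγ₀ : γ i₀ ≤ τ (γ i₀))
    (hγ : ∀ i, ¬ AboveTheta τ (γ i)) :
    (∃ a, ∀ i, v (a <• r i + u i) = γ i) ↔ Compatible τ v i₀ p q u γ := by
  constructor
  · rintro ⟨a, ha⟩
    rw [hv.compatible_iff hq hrq (a := a) (by rw [hv.mem_geTheta, ha]; exact hγ₀)]
    exact fun i => ⟨fun h => by rw [hv.mem_geTheta, ha]; exact h, fun _ => ha i⟩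
  · intro hcomp
    obtain ⟨c, hc⟩ := hd (r i₀) (hr i₀) (-u i₀)
    have hc' : c <• r i₀ + u i₀ = 0 := by rw [hc, neg_add_cancel]
    have h1 := (hv.compatible_iff hq hrq (a := c) (by rw [hc']; exact zero_mem _)).1 hcomp
    obtain ⟨x₀, hx₀⟩ := hv.surjective (γ i₀)
    obtain ⟨x, hx, hx'⟩ := hv.exists_not_mem_gtTheta (ι := {i // γ i ≤ τ (γ i)}) hd (x₀ := x₀)
      (by rw [hv.mem_geTheta, hx₀]; exact hγ₀) (by rw [hv.mem_gtTheta, hx₀]; exact hγ i₀)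
      (r := fun i => r i) (fun i => hr i) (w := fun i => c <• r i + u i) (fun i => (h1 i).1 i.2)
    refine ⟨x + c, fun i => ?_⟩
    have h2 : (x + c) <• r i₀ + u i₀ ∈ hv.geTheta := by
      rw [smul_add, add_assoc, hc', add_zero]; exact hv.geTheta.smul_mem _ hx
    have h3 := (hv.compatible_iff hq hrq h2).1 hcomp i
    by_cases h4 : γ i ≤ τ (γ i)
    · refine hv.map_eq_of_le_of_not_mem (h3.1 h4) ?_ h4 (hγ i)
      rw [smul_add, add_assoc]
      exact hx' ⟨i, h4⟩
    · exact h3.2 h4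

end

section

variable {r : ι → TwistedPoly φ} {u : ι → M} {γ : ι → Δ} {J : Finset ι}

/-- The forms indexed by `J` lie in `M_{> θ}` as soon as `a.d + U` and the remainders `u j - U.(s
j)` do, where `U = ∑ u l.(p' l)`. This fixes `a` modulo `M_{> θ}` by one equation, with the
inequations from the forms of value `θ`. The exact values on `J` can then be adjusted by an element
of `M_{> θ}` without disturbing anything else. -/
theorem exists_values_iff_of_gt_theta (hv : IsHenselianValuedModule φ τ v)
    (hd : IsDivisibleModule (TwistedPoly φ) M) {i₀ : ι} (hi₀ : i₀ ∈ J)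
    {p q : ι → TwistedPoly φ} (hq : ∀ i, q i ≠ 0)
    (hrq : ∀ i, r i * q i = r i₀ * p i) (hγ : ∀ i, AboveTheta τ (γ i) ↔ i ∈ J)
    {d m : TwistedPoly φ} {p' s q' : J → TwistedPoly φ} (hd0 : d ≠ 0)
    (hp' : d = ∑ j : J, r j * p' j)
    (hs : ∀ j : J, r j = d * s j) (hm : m ≠ 0) (hq0 : ∀ j, q' j ≠ 0)
    (hrq' : ∀ j : J, r j * q' j = m) :
    (∃ a, ∀ i, v (a <• r i + u i) = γ i) ↔
      Compatible τ v i₀ p q u γ ∧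
      (∀ j : J, AboveTheta τ (v (u j - (∑ l : J, u l <• p' l) <• s j))) ∧
      (∃ y, ∀ j : J, v (y + (u j - (∑ l : J, u l <• p' l) <• s j) <• q' j) =
        τ^[(q' j).ord] (γ j)) ∧
      ∃ x, AboveTheta τ (v (x <• d + ∑ l : J, u l <• p' l)) ∧
        ∀ i, γ i ≤ τ (γ i) → ¬ AboveTheta τ (γ i) → ¬ AboveTheta τ (v (x <• r i + u i)) := by
  set U := ∑ l : J, u l <• p' l with hU
  have hγ₀ : γ i₀ ≤ τ (γ i₀) := ((hγ i₀).2 hi₀).le_map hv.tauChain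
  have hsplit : ∀ (a : M) (j : J), a <• r j + u j = (a <• d + U) <• s j + (u j - U <• s j) := by
    intro a j
    rw [hs j, MulOpposite.op_mul, mul_smul, smul_add]
    abel
  constructor
  · rintro ⟨a, ha⟩
    have hJ : ∀ j : J, a <• r j + u j ∈ hv.gtTheta := fun j => by
      rw [hv.mem_gtTheta, ha]; exact (hγ j).2 j.2
    have hdU : a <• d + U ∈ hv.gtTheta := by
      have : a <• d + U = ∑ j : J, (a <• r j + u j) <• p' j := by
        rw [hp', smul_sum_mul, hU, ← Finset.sum_add_distrib]
        exact Finset.sum_congr rfl fun j _ => (smul_add _ _ _).symm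
      rw [this]
      exact hv.gtTheta.sum_mem fun j _ => hv.gtTheta.smul_mem _ (hJ j)
    have he : ∀ j : J, u j - U <• s j ∈ hv.gtTheta := fun j => by
      have h1 : u j - U <• s j = (a <• r j + u j) - (a <• d + U) <• s j := by
        rw [hsplit]; abel
      rw [h1]
      exact hv.gtTheta.sub_mem (hJ j) (hv.gtTheta.smul_mem _ hdU)
    refine ⟨?_, he, ?_, a, hdU, fun i h1 h2 => by rwa [ha]⟩
    · rw [hv.compatible_iff hq hrq (a := a) (by rw [hv.mem_geTheta, ha]; exact hγ₀)]
      exact fun i => ⟨fun h => by rw [hv.mem_geTheta, ha]; exact h, fun _ => ha i⟩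
    -- Dividing `a.d + U` by `d` inside `M_{> θ}` gives an `n` with `a.(r j) + u j = n.(r j) + (u j
    -- - U.(s j))`; then `y = n.m` works.
    · obtain ⟨n, hn, hn'⟩ := hv.exists_mem_gtTheta_smul_eq hd hd0 hdU
      refine ⟨n <• m, fun j => ?_⟩
      have h1 : n <• m + (u j - U <• s j) <• q' j = (a <• r j + u j) <• q' j := by
        rw [hsplit, ← hn', ← hrq' j, hs j, smul_add]
        simp only [MulOpposite.op_mul, mul_smul]
      rw [h1, hv.map_smul_of_mem_gtTheta (hq0 j) (hJ j), ha]
  · rintro ⟨hcomp, he, ⟨y, hy⟩, x, hx, hx'⟩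
    -- Subtracting `n'` makes `x.d + U` vanish exactly; the `n` found below then realizes the values
    -- on `J`. Both corrections lie in `M_{> θ}`, so the inequations survive.
    obtain ⟨n', hn', hn''⟩ := hv.exists_mem_gtTheta_smul_eq hd hd0 hx
    have hyJ : ∀ j : J, y + (u j - U <• s j) <• q' j ∈ hv.gtTheta := fun j => by
      rw [hv.mem_gtTheta, hy, hv.tauChain.aboveTheta_iterate_iff]; exact (hγ j).2 j.2
    have hygt : y ∈ hv.gtTheta := by
      have h1 := hv.gtTheta.sub_mem (hyJ ⟨i₀, hi₀⟩)
        (hv.gtTheta.smul_mem (MulOpposite.op (q' ⟨i₀, hi₀⟩)) (he ⟨i₀, hi₀⟩))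
      rwa [add_sub_cancel_right] at h1
    obtain ⟨n, hn, rfl⟩ := hv.exists_mem_gtTheta_smul_eq hd hm hygt
    have ha : ∀ j : J, v ((x - n' + n) <• r j + u j) = γ j := fun j => by
      have h1 : (x - n' + n) <• r j + u j = n <• r j + (u j - U <• s j) := by
        have h2 : (x - n' + n) <• d + U = n <• d := by
          rw [smul_add, smul_sub, hn'']; abel
        rw [hsplit, h2, ← mul_smul, ← MulOpposite.op_mul, ← hs j]
      have h2 : n <• r j + (u j - U <• s j) ∈ hv.gtTheta :=
        hv.gtTheta.add_mem (hv.gtTheta.smul_mem _ hn) (he j)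
      have h3 := hy j
      rw [← hrq' j, MulOpposite.op_mul, mul_smul, ← smul_add,
        hv.map_smul_of_mem_gtTheta (hq0 j) h2] at h3
      rw [h1, hv.tauChain.iterate_injective _ h3]
    have h0 : (x - n' + n) <• r i₀ + u i₀ ∈ hv.geTheta := by
      rw [hv.mem_geTheta, ha ⟨i₀, hi₀⟩]; exact hγ₀
    have hcomp' := (hv.compatible_iff hq hrq h0).1 hcomp
    refine ⟨x - n' + n, fun i => ?_⟩
    by_cases h1 : γ i ≤ τ (γ i)
    · by_cases h2 : AboveTheta τ (γ i)
      · exact ha ⟨i, (hγ i).1 h2⟩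
      · refine hv.map_eq_of_le_of_not_mem ((hcomp' i).1 h1) (fun h3 => hx' i h1 h2 ?_) h1 h2
        have h4 : x <• r i + u i = ((x - n' + n) <• r i + u i) + (n' - n) <• r i := by
          rw [smul_add, smul_sub, smul_sub]; abel
        rw [h4]
        exact hv.gtTheta.add_mem h3 (hv.gtTheta.smul_mem _ (hv.gtTheta.sub_mem hn' hn))
    · exact (hcomp' i).2 h1

end

/-- The torsion of `M / M_{> θ}` is that of `M`. -/
theorem encard_annSubgroup_quotient (hv : IsHenselianValuedModule φ τ v)
    (hd : IsDivisibleModule (TwistedPoly φ) M) {r : TwistedPoly φ} (hr : r ≠ 0) :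
    (annSubgroup (M ⧸ hv.gtTheta) r : Set (M ⧸ hv.gtTheta)).encard = (ValMod.ann M r).encard := by
  have h1 : (annSubgroup (M ⧸ hv.gtTheta) r : Set (M ⧸ hv.gtTheta)) =
      hv.gtTheta.mkQ '' ValMod.ann M r := by
    ext y
    constructor
    · intro hy
      obtain ⟨x, rfl⟩ := hv.gtTheta.mkQ_surjective y
      have h2 : x <• r ∈ hv.gtTheta := by
        rw [← Submodule.Quotient.mk_eq_zero hv.gtTheta]; exact hy
      obtain ⟨n, hn, hn'⟩ := hv.exists_mem_gtTheta_smul_eq hd hr h2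
      refine ⟨x - n, ?_, ?_⟩
      · change (x - n) <• r = 0
        rw [smul_sub, hn', sub_self]
      · rw [map_sub, sub_eq_self]
        exact (Submodule.Quotient.mk_eq_zero _).2 hn
    · rintro ⟨x, hx, rfl⟩
      rw [SetLike.mem_coe, mem_annSubgroup, ← map_smul]
      rw [show x <• r = 0 from hx, map_zero]
  rw [h1, Set.InjOn.encard_image]
  intro x hx y hy hxy
  have h2 : x - y ∈ hv.gtTheta := by
    rw [← Submodule.Quotient.mk_eq_zero hv.gtTheta, Submodule.Quotient.mk_sub, sub_eq_zero]
    exact hxy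
  refine sub_eq_zero.1 (hv.eq_zero_of_smul_eq_zero hr h2 ?_)
  rw [smul_sub, show x <• r = 0 from hx, show y <• r = 0 from hy, sub_zero]

/-- Modulo `M_{> θ}` this is a system of one equation and several inequations in a divisible module
with the torsion of `M`, so `inequations_transfer` applies. Hypothesis `h` compares the consistency
criteria of `solutions_nonempty_iff` for the equational subsystems. -/
theorem gtTheta_transfer [Finite ι] {M' Δ' : Type u} [AddCommGroup M']
    [Module (TwistedPoly φ)ᵐᵒᵖ M'] [LinearOrder Δ'] [OrderTop Δ'] {τ' : Δ' → Δ'} {v' : M' → Δ'}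
    (hv : IsHenselianValuedModule φ τ v) (hd : IsDivisibleModule (TwistedPoly φ) M)
    (hv' : IsHenselianValuedModule φ τ' v') (hd' : IsDivisibleModule (TwistedPoly φ) M')
    (hann : ∀ r : TwistedPoly φ, r ≠ 0 → (ValMod.ann M r).encard = (ValMod.ann M' r).encard)
    {d : TwistedPoly φ} (hd0 : d ≠ 0) {r : ι → TwistedPoly φ}
    {g : Finset ι → TwistedPoly φ} {p s : ∀ S : Finset ι, Option S → TwistedPoly φ}
    (hg : ∀ S, g S = ∑ o, subFamily d r S o * p S o)
    (hs : ∀ S o, subFamily d r S o = g S * s S o)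
    {u : M} {w : ι → M} {u' : M'} {w' : ι → M'}
    (h : ∀ S : Finset ι,
      (∀ o : Option S, AboveTheta τ (v ((o.elim u fun i => w i) -
        (∑ l : Option S, (l.elim u fun i => w i) <• p S l) <• s S o))) ↔
      (∀ o : Option S, AboveTheta τ' (v' ((o.elim u' fun i => w' i) -
        (∑ l : Option S, (l.elim u' fun i => w' i) <• p S l) <• s S o))))
    (hsol : ∃ x, AboveTheta τ (v (x <• d + u)) ∧ ∀ i, ¬ AboveTheta τ (v (x <• r i + w i))) :
    ∃ x, AboveTheta τ' (v' (x <• d + u')) ∧ ∀ i, ¬ AboveTheta τ' (v' (x <• r i + w' i)) := by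
  have hdiv : ∀ {M Δ : Type u} [AddCommGroup M] [Module (TwistedPoly φ)ᵐᵒᵖ M] [LinearOrder Δ]
      [OrderTop Δ] {τ : Δ → Δ} {v : M → Δ} (hv : IsHenselianValuedModule φ τ v)
      (hd : IsDivisibleModule (TwistedPoly φ) M), Divisible φ (M ⧸ hv.gtTheta) := by
    intro M Δ _ _ _ _ τ v hv hd r hr x
    obtain ⟨x, rfl⟩ := hv.gtTheta.mkQ_surjective x
    obtain ⟨y, rfl⟩ := hd r hr x
    exact ⟨hv.gtTheta.mkQ y, rfl⟩
  have hsub : ∀ {M Δ : Type u} [AddCommGroup M] [Module (TwistedPoly φ)ᵐᵒᵖ M] [LinearOrder Δ]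
      [OrderTop Δ] {τ : Δ → Δ} {v : M → Δ} (hv : IsHenselianValuedModule φ τ v)
      (hd : IsDivisibleModule (TwistedPoly φ) M) (u : M) (w : ι → M) (S : Finset ι),
      (subSolutions d r (hv.gtTheta.mkQ u) (fun i => hv.gtTheta.mkQ (w i)) S).Nonempty ↔
        ∀ o : Option S, AboveTheta τ (v ((o.elim u fun i => w i) -
          (∑ l : Option S, (l.elim u fun i => w i) <• p S l) <• s S o)) := by
    intro M Δ _ _ _ _ τ v hv hd u w S
    rw [subSolutions_eq, solutions_nonempty_iff (hdiv hv hd) (generator_ne_zero hd0 (hs S)) (hg S)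
      (hs S)]
    refine forall_congr' fun o => ?_
    rw [← hv.mem_gtTheta, ← Submodule.Quotient.mk_eq_zero hv.gtTheta, ← Submodule.mkQ_apply,
      map_sub, map_smul, map_sum]
    have h1 : ∀ l : Option S, (l.elim (hv.gtTheta.mkQ u) fun i => hv.gtTheta.mkQ (w i)) =
        hv.gtTheta.mkQ (l.elim u fun i => w i) := by
      rintro (_ | l) <;> rfl
    simp only [h1, map_smul]
  obtain ⟨x, hx, hx'⟩ := hsol
  obtain ⟨y, hy, hy'⟩ := inequations_transfer (Q := M ⧸ hv.gtTheta) (Q' := M' ⧸ hv'.gtTheta)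
    (r := r) (u := hv.gtTheta.mkQ u) (w := fun i => hv.gtTheta.mkQ (w i))
    (u' := hv'.gtTheta.mkQ u') (w' := fun i => hv'.gtTheta.mkQ (w' i)) hd0 (hdiv hv hd)
    (hdiv hv' hd') (fun r hr => by
      rw [hv.encard_annSubgroup_quotient hd hr, hv'.encard_annSubgroup_quotient hd' hr,
        hann r hr])
    (fun S => by rw [hsub hv hd, hsub hv' hd', h S])
    ⟨hv.gtTheta.mkQ x, (Submodule.Quotient.mk_eq_zero hv.gtTheta (x := x <• d + u)).2 hx,
      fun i h1 => hx' i ((Submodule.Quotient.mk_eq_zero hv.gtTheta (x := x <• r i + w i)).1 h1)⟩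
  obtain ⟨y, rfl⟩ := hv'.gtTheta.mkQ_surjective y
  exact ⟨y, (Submodule.Quotient.mk_eq_zero hv'.gtTheta (x := y <• d + u')).1 hy,
    fun i h1 => hy' i ((Submodule.Quotient.mk_eq_zero hv'.gtTheta (x := y <• r i + w' i)).2 h1)⟩

end IsHenselianValuedModule

end

noncomputable section

open scoped RightActions

namespace ValMod

open FirstOrder FirstOrder.Language

/-! ## Predicates definable on the value sort -/

/-- A divisible henselian valued module in which the number of zeros of `r` is `c r`, with any
truth values of the predicates `R_n` at `∞`. -/
structure HenselianModel {K : Type u} [Field K] (φ : K →+* K) (c : TwistedPoly φ → ℕ∞) where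
  M : Type u
  V : Type u
  [addCommGroup : AddCommGroup M]
  [module : Module (TwistedPoly φ)ᵐᵒᵖ M]
  [linearOrder : LinearOrder V]
  [orderTop : OrderTop V]
  τ : V → V
  v : M → V
  henselian : IsHenselianValuedModule φ τ v
  divisible : IsDivisibleModule (TwistedPoly φ) M
  encard_ann : ∀ r : TwistedPoly φ, (ann M r).encard = c r
  res : ℕ → V → Prop
  res_iff : ∀ (n : ℕ) (γ : V), γ ≠ ⊤ → (res n γ ↔ IsValuedGroup.HasResidues v n γ)

attribute [instance] HenselianModel.addCommGroup HenselianModel.module HenselianModel.linearOrder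
  HenselianModel.orderTop

variable {K : Type u} [Field K] {φ : K →+* K} {c : TwistedPoly φ → ℕ∞}

namespace HenselianModel

instance instModStructure (H : HenselianModel φ c) : (modLang (TwistedPoly φ)).Structure H.M :=
  modStructure (TwistedPoly φ) H.M

instance instValStructure (H : HenselianModel φ c) : valLang.Structure H.V where
  funMap
    | .infty => fun _ => ⊤
    | .tau => fun y => H.τ (y 0)
  RelMap
    | .le => fun y => y 0 ≤ y 1
    | .res n => fun y => H.res n (y 0)

/-- The underlying two-sorted structure. -/
@[reducible]
def toLStr (H : HenselianModel φ c) : LStr (TwistedPoly φ) :=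
  { M := H.M, V := H.V, v := H.v }

instance (H : HenselianModel φ c) : Nonempty H.V := ⟨⊤⟩

variable {α β : Type} (H : HenselianModel φ c)

theorem realize_addT (s s' : (modLang (TwistedPoly φ)).Term α) (x : α → H.M) :
    (addT s s').realize x = s.realize x + s'.realize x := rfl

theorem realize_negT (s : (modLang (TwistedPoly φ)).Term α) (x : α → H.M) :
    (negT s).realize x = -s.realize x := rfl

theorem realize_actT (s : (modLang (TwistedPoly φ)).Term α) (r : TwistedPoly φ)
    (x : α → H.M) : (actT s r).realize x = s.realize x <• r := rfl

theorem realize_inftyT {γ : Type*} (y : γ → H.V) :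
    (inftyT : valLang.Term γ).realize y = ⊤ := rfl

theorem realize_tauT {γ : Type*} (s : valLang.Term γ) (y : γ → H.V) :
    (tauT s).realize y = H.τ (s.realize y) := rfl

/-- The values of value-sort terms. -/
def assign (x : α → H.M) (y : β → H.V) : (modLang (TwistedPoly φ)).Term α ⊕ β → H.V :=
  Sum.elim (fun s => H.v (s.realize x)) y

end HenselianModel

variable {α β α' β' : Type}

/-- A module-valued function given by a term. -/
def IsModTerm (f : ∀ H : HenselianModel φ c, (α → H.M) → H.M) : Prop :=
  ∃ s : (modLang (TwistedPoly φ)).Term α, ∀ H x, f H x = s.realize x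

/-- A value-valued function given by a term. -/
def IsValTerm (f : ∀ H : HenselianModel φ c, (α → H.M) → (β → H.V) → H.V) : Prop :=
  ∃ s : valLang.Term ((modLang (TwistedPoly φ)).Term α ⊕ β),
    ∀ H x y, f H x y = s.realize (H.assign x y)

/-- A predicate given by an `L_V`-formula in the value variables and the values of module terms. -/
def IsDefinable (P : ∀ H : HenselianModel φ c, (α → H.M) → (β → H.V) → Prop) : Prop :=
  ∃ ψ : valLang.Formula ((modLang (TwistedPoly φ)).Term α ⊕ β),
    ∀ H x y, P H x y ↔ ψ.Realize (H.assign x y)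

namespace IsModTerm

variable {f g : ∀ H : HenselianModel φ c, (α → H.M) → H.M}

theorem var (a : α) : IsModTerm fun (H : HenselianModel φ c) (x : α → H.M) => x a :=
  ⟨Term.var a, fun _ _ => rfl⟩

theorem realize (s : (modLang (TwistedPoly φ)).Term α) :
    IsModTerm fun (H : HenselianModel φ c) (x : α → H.M) => s.realize x := ⟨s, fun _ _ => rfl⟩

theorem zero : IsModTerm fun (H : HenselianModel φ c) (_ : α → H.M) => (0 : H.M) :=
  ⟨zeroT, fun _ _ => rfl⟩

theorem add (hf : IsModTerm f) (hg : IsModTerm g) : IsModTerm fun H x => f H x + g H x := by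
  obtain ⟨s, hs⟩ := hf
  obtain ⟨s', hs'⟩ := hg
  exact ⟨addT s s', fun H x => by dsimp only; rw [hs, hs', H.realize_addT]⟩

theorem neg (hf : IsModTerm f) : IsModTerm fun H x => -f H x := by
  obtain ⟨s, hs⟩ := hf
  exact ⟨negT s, fun H x => by dsimp only; rw [hs, H.realize_negT]⟩

theorem sub (hf : IsModTerm f) (hg : IsModTerm g) : IsModTerm fun H x => f H x - g H x := by
  simp only [sub_eq_add_neg]
  exact hf.add hg.neg

theorem act (hf : IsModTerm f) (r : TwistedPoly φ) : IsModTerm fun H x => f H x <• r := by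
  obtain ⟨s, hs⟩ := hf
  exact ⟨actT s r, fun H x => by dsimp only; rw [hs, H.realize_actT]⟩

theorem sum {ι : Type*} (S : Finset ι) {f : ι → ∀ H : HenselianModel φ c, (α → H.M) → H.M}
    (hf : ∀ i, IsModTerm (f i)) : IsModTerm fun H x => ∑ i ∈ S, f i H x := by
  classical
  induction S using Finset.induction_on with
  | empty => simpa only [Finset.sum_empty] using zero
  | insert a S ha ih =>
    simp only [Finset.sum_insert ha]
    exact (hf a).add ih

end IsModTerm

namespace IsValTerm

variable {f : ∀ H : HenselianModel φ c, (α → H.M) → (β → H.V) → H.V}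

theorem var (b : β) : IsValTerm fun (H : HenselianModel φ c) (_ : α → H.M) (y : β → H.V) => y b :=
  ⟨Term.var (Sum.inr b), fun _ _ _ => rfl⟩

theorem top : IsValTerm fun (H : HenselianModel φ c) (_ : α → H.M) (_ : β → H.V) => (⊤ : H.V) :=
  ⟨inftyT, fun _ _ _ => rfl⟩

theorem val {g : ∀ H : HenselianModel φ c, (α → H.M) → H.M} (hg : IsModTerm g) :
    IsValTerm fun (H : HenselianModel φ c) (x : α → H.M) (_ : β → H.V) => H.v (g H x) := by
  obtain ⟨s, hs⟩ := hg
  exact ⟨Term.var (Sum.inl s), fun H x y => by dsimp only; rw [hs]; rfl⟩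

theorem tau (hf : IsValTerm f) : IsValTerm fun H x y => H.τ (f H x y) := by
  obtain ⟨s, hs⟩ := hf
  exact ⟨tauT s, fun H x y => by dsimp only; rw [hs, H.realize_tauT]⟩

theorem iterate_tau (hf : IsValTerm f) (n : ℕ) : IsValTerm fun H x y => H.τ^[n] (f H x y) := by
  induction n with
  | zero => exact hf
  | succ n ih =>
    simp only [Function.iterate_succ_apply']
    exact ih.tau

end IsValTerm

namespace IsDefinable

variable {P Q : ∀ H : HenselianModel φ c, (α → H.M) → (β → H.V) → Prop}
  {f g : ∀ H : HenselianModel φ c, (α → H.M) → (β → H.V) → H.V}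

theorem congr (hQ : IsDefinable Q) (h : ∀ H x y, P H x y ↔ Q H x y) : IsDefinable P := by
  obtain ⟨ψ, hψ⟩ := hQ
  exact ⟨ψ, fun H x y => (h H x y).trans (hψ H x y)⟩

theorem le (hf : IsValTerm f) (hg : IsValTerm g) :
    IsDefinable fun H x y => f H x y ≤ g H x y := by
  obtain ⟨s, hs⟩ := hf
  obtain ⟨s', hs'⟩ := hg
  refine ⟨Relations.formula₂ (L := valLang) ValRel.le s s', fun H x y => ?_⟩
  refine Iff.trans ?_ Formula.realize_rel₂.symm
  dsimp only
  rw [hs, hs']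
  rfl

theorem res (n : ℕ) (hf : IsValTerm f) : IsDefinable fun H x y => H.res n (f H x y) := by
  obtain ⟨s, hs⟩ := hf
  refine ⟨Relations.formula₁ (L := valLang) (ValRel.res n) s, fun H x y => ?_⟩
  refine Iff.trans ?_ Formula.realize_rel₁.symm
  dsimp only
  rw [hs]
  rfl

theorem eq (hf : IsValTerm f) (hg : IsValTerm g) :
    IsDefinable fun H x y => f H x y = g H x y := by
  obtain ⟨s, hs⟩ := hf
  obtain ⟨s', hs'⟩ := hg
  refine ⟨s.equal s', fun H x y => ?_⟩
  dsimp only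
  rw [Formula.realize_equal, hs, hs']

/-- Such a `p` does not vary with the model, so `⊤` or `⊥` serves, without deciding which. -/
theorem const (p : Prop) :
    IsDefinable fun (H : HenselianModel φ c) (_ : α → H.M) (_ : β → H.V) => p := by
  by_cases hp : p
  · exact ⟨⊤, fun H x y => by simp [hp]⟩
  · exact ⟨⊥, fun H x y => by simp [hp, Formula.Realize]⟩

theorem not (hP : IsDefinable P) : IsDefinable fun H x y => ¬ P H x y := by
  obtain ⟨ψ, hψ⟩ := hP
  exact ⟨ψ.not, fun H x y => by dsimp only; rw [hψ, Formula.realize_not]⟩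

theorem and (hP : IsDefinable P) (hQ : IsDefinable Q) :
    IsDefinable fun H x y => P H x y ∧ Q H x y := by
  obtain ⟨ψ, hψ⟩ := hP
  obtain ⟨χ, hχ⟩ := hQ
  exact ⟨ψ ⊓ χ, fun H x y => by dsimp only; rw [hψ, hχ, Formula.realize_inf]⟩

theorem imp (hP : IsDefinable P) (hQ : IsDefinable Q) :
    IsDefinable fun H x y => P H x y → Q H x y := by
  obtain ⟨ψ, hψ⟩ := hP
  obtain ⟨χ, hχ⟩ := hQ
  exact ⟨ψ.imp χ, fun H x y => by dsimp only; rw [hψ, hχ, Formula.realize_imp]⟩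

theorem iff (hP : IsDefinable P) (hQ : IsDefinable Q) :
    IsDefinable fun H x y => (P H x y ↔ Q H x y) :=
  ((hP.imp hQ).and (hQ.imp hP)).congr fun _ _ _ => iff_iff_implies_and_implies

theorem lt (hf : IsValTerm f) (hg : IsValTerm g) :
    IsDefinable fun H x y => f H x y < g H x y :=
  (le hg hf).not.congr fun _ _ _ => not_le.symm

theorem forall_finite {ι : Type*} [Finite ι]
    {P : ι → ∀ H : HenselianModel φ c, (α → H.M) → (β → H.V) → Prop}
    (hP : ∀ i, IsDefinable (P i)) : IsDefinable fun H x y => ∀ i, P i H x y := by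
  choose ψ hψ using hP
  exact ⟨Formula.iInf ψ, fun H x y => by simp only [hψ, Formula.realize_iInf]⟩

theorem exists_finite {ι : Type*} [Finite ι]
    {P : ι → ∀ H : HenselianModel φ c, (α → H.M) → (β → H.V) → Prop}
    (hP : ∀ i, IsDefinable (P i)) : IsDefinable fun H x y => ∃ i, P i H x y := by
  choose ψ hψ using hP
  exact ⟨Formula.iSup ψ, fun H x y => by simp only [hψ, Formula.realize_iSup]⟩

theorem aboveTheta (hf : IsValTerm f) : IsDefinable fun H x y => AboveTheta H.τ (f H x y) :=
  ((lt hf hf.tau).not.imp (eq hf .top)).congr fun H x y => by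
    unfold AboveTheta
    tauto

/-- Substitution of terms for variables. -/
theorem comp {P : ∀ H : HenselianModel φ c, (α' → H.M) → (β' → H.V) → Prop} (hP : IsDefinable P)
    {f : α' → ∀ H : HenselianModel φ c, (α → H.M) → H.M}
    {g : β' → ∀ H : HenselianModel φ c, (α → H.M) → (β → H.V) → H.V}
    (hf : ∀ a, IsModTerm (f a)) (hg : ∀ b, IsValTerm (g b)) :
    IsDefinable fun H x y => P H (fun a => f a H x) (fun b => g b H x y) := by
  obtain ⟨ψ, hψ⟩ := hP
  choose s hs using hf
  choose s' hs' using hg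
  refine ⟨BoundedFormula.subst ψ (Sum.elim (fun t => Term.var (Sum.inl (t.subst s))) s'),
    fun H x y => ?_⟩
  dsimp only
  rw [hψ, Formula.Realize, Formula.Realize, BoundedFormula.realize_subst]
  refine iff_of_eq (congrArg (fun z => BoundedFormula.Realize ψ z default) (funext fun o => ?_))
  rcases o with t | b
  · simp only [HenselianModel.assign, Sum.elim_inl, Term.realize_var, Term.realize_subst, hs]
  · simp only [HenselianModel.assign, Sum.elim_inr, hs']

theorem exists_val {κ : Type} [Finite κ]
    {P : ∀ H : HenselianModel φ c, (α → H.M) → (β ⊕ κ → H.V) → Prop} (hP : IsDefinable P) :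
    IsDefinable fun H x y => ∃ z : κ → H.V, P H x (Sum.elim y z) := by
  obtain ⟨ψ, hψ⟩ := hP
  refine ⟨Formula.iExs κ (ψ.relabel (Equiv.sumAssoc _ _ _).symm), fun H x y => ?_⟩
  rw [Formula.realize_iExs]
  refine exists_congr fun z => ?_
  rw [hψ, Formula.realize_relabel]
  refine iff_of_eq (congrArg ψ.Realize (funext fun o => ?_))
  rcases o with t | b | k <;> rfl

/-- A predicate whose truth value only depends on those of finitely many definable predicates is
definable. -/
theorem of_determined {κ : Type*} [Finite κ]
    {G : κ → ∀ H : HenselianModel φ c, (α → H.M) → (β → H.V) → Prop}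
    (hG : ∀ k, IsDefinable (G k))
    (h : ∀ H x y H' x' y', (∀ k, G k H x y ↔ G k H' x' y') → P H x y → P H' x' y') :
    IsDefinable P := by
  -- The defining formula is the disjunction over the finitely many truth patterns `σ` of the `G k`
  -- that occur together with `P` in some model.
  have h1 : IsDefinable fun H x y => ∃ σ : κ → Prop,
      (∃ H' x' y', P H' x' y' ∧ ∀ k, G k H' x' y' ↔ σ k) ∧ ∀ k, (G k H x y ↔ σ k) :=
    exists_finite fun σ => (const _).and (forall_finite fun k => (hG k).iff (const (σ k)))
  refine h1.congr fun H x y => ⟨fun hP => ⟨fun k => G k H x y, ⟨H, x, y, hP, fun k => Iff.rfl⟩,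
    fun k => Iff.rfl⟩, ?_⟩
  rintro ⟨σ, ⟨H', x', y', hP, h2⟩, h3⟩
  exact h H' x' y' H x y (fun k => (h2 k).trans (h3 k).symm) hP

end IsDefinable

/-! ## Elimination of one module quantifier -/

section Elimination

variable {ι : Type} [Finite ι]

/-- Definability of the solvability of `v(y + w i) = γ i`. -/
theorem isDefinable_exists_values : IsDefinable fun (H : HenselianModel φ c) (w : ι → H.M)
    (γ : ι → H.V) => ∃ y, ∀ i, H.v (y + w i) = γ i := by
  classical
  cases nonempty_fintype ι
  rcases isEmpty_or_nonempty ι with hι | hι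
  · exact (IsDefinable.const True).congr fun H w γ => by
      simp only [iff_true]
      exact ⟨0, fun i => isEmptyElim i⟩
  have hsub : ∀ i j : ι, IsValTerm fun (H : HenselianModel φ c) (w : ι → H.M) (_ : ι → H.V) =>
      H.v (w i - w j) := fun i j => IsValTerm.val ((IsModTerm.var i).sub (.var j))
  have hvar : ∀ i : ι, IsValTerm fun (H : HenselianModel φ c) (_ : ι → H.M) (γ : ι → H.V) =>
      γ i := fun i => .var i
  -- Here `i₀` is an index of maximal value, and the two criteria are used according to whether that
  -- value is `∞`. `R_n` is consulted only at values other than `∞`, where its meaning is fixed.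
  have h1 : IsDefinable fun (H : HenselianModel φ c) (w : ι → H.M) (γ : ι → H.V) =>
      ∃ i₀, (∀ i, γ i ≤ γ i₀) ∧ (γ i₀ = ⊤ → ∀ i, H.v (w i - w i₀) = γ i) ∧
      (¬ γ i₀ = ⊤ → (∀ i, γ i < γ i₀ → H.v (w i - w i₀) = γ i) ∧
        (∀ i, γ i = γ i₀ → γ i₀ ≤ H.v (w i - w i₀)) ∧
        ∃ S : Finset ι, (∀ i, i ∈ S → γ i = γ i₀) ∧
          (∀ i, i ∈ S → ∀ j, j ∈ S → i ≠ j → ¬ γ i₀ < H.v (w i - w j)) ∧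
          (∀ i, γ i = γ i₀ → ∃ j, j ∈ S ∧ γ i₀ < H.v (w i - w j)) ∧
          H.res (S.card + 1) (γ i₀)) :=
    IsDefinable.exists_finite fun i₀ => (IsDefinable.forall_finite fun i =>
      .le (hvar i) (hvar i₀)).and <| ((IsDefinable.eq (hvar i₀) .top).imp
        (.forall_finite fun i => .eq (hsub i i₀) (hvar i))).and <|
      (IsDefinable.eq (hvar i₀) .top).not.imp <|
      (IsDefinable.forall_finite fun i => (IsDefinable.lt (hvar i) (hvar i₀)).imp
        (.eq (hsub i i₀) (hvar i))).and <|
      (IsDefinable.forall_finite fun i => (IsDefinable.eq (hvar i) (hvar i₀)).imp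
        (.le (hvar i₀) (hsub i i₀))).and <|
      IsDefinable.exists_finite fun S =>
      (IsDefinable.forall_finite fun i => (IsDefinable.const (i ∈ S)).imp
        (.eq (hvar i) (hvar i₀))).and <|
      (IsDefinable.forall_finite fun i => (IsDefinable.const (i ∈ S)).imp <|
        IsDefinable.forall_finite fun j => (IsDefinable.const (j ∈ S)).imp <|
          (IsDefinable.const (i ≠ j)).imp (IsDefinable.lt (hvar i₀) (hsub i j)).not).and <|
      (IsDefinable.forall_finite fun i => (IsDefinable.eq (hvar i) (hvar i₀)).imp <|
        IsDefinable.exists_finite fun j => (IsDefinable.const (j ∈ S)).and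
          (.lt (hvar i₀) (hsub i j))).and
      (.res _ (hvar i₀))
  refine h1.congr fun H w γ => ?_
  have hv := H.henselian.toIsValuedGroup
  constructor
  · intro h
    obtain ⟨i₀, hi₀⟩ := Finite.exists_max γ
    refine ⟨i₀, hi₀, fun htop => (hv.exists_values_iff_of_top htop).1 h, fun htop => ?_⟩
    rw [hv.exists_values_iff_of_ne_top htop hi₀] at h
    obtain ⟨h1, h2, S, h3, h4, h5, h6⟩ := h
    exact ⟨h1, h2, S, h3, h4, h5, (H.res_iff _ _ htop).2 h6⟩
  · rintro ⟨i₀, hi₀, h, h'⟩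
    by_cases htop : γ i₀ = ⊤
    · exact (hv.exists_values_iff_of_top htop).2 (h htop)
    · rw [hv.exists_values_iff_of_ne_top htop hi₀]
      obtain ⟨h1, h2, S, h3, h4, h5, h6⟩ := h' htop
      exact ⟨h1, h2, S, h3, h4, h5, (H.res_iff _ _ htop).1 h6⟩

/-- Definability of the solvability of a system of conditions modulo `M_{> θ}`. -/
theorem isDefinable_exists_aboveTheta {d : TwistedPoly φ} (hd : d ≠ 0) (r : ι → TwistedPoly φ) :
    IsDefinable fun (H : HenselianModel φ c) (w : Option ι → H.M) (_ : β → H.V) =>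
      ∃ x, AboveTheta H.τ (H.v (x <• d + w none)) ∧
        ∀ i, ¬ AboveTheta H.τ (H.v (x <• r i + w (some i))) := by
  classical
  cases nonempty_fintype ι
  choose g p s hg hs using fun S : Finset ι =>
    TwistedPoly.exists_bezout (TwistedPoly.subFamily d r S)
  -- One predicate for each subset of inequations turned into equations, stating that this subsystem
  -- is solvable modulo `M_{> θ}`.
  refine IsDefinable.of_determined (κ := Finset ι) (G := fun S H w _ =>
    ∀ o : Option S, AboveTheta H.τ (H.v ((o.elim (w none) fun i => w (some i)) -
      (∑ l : Option S, (l.elim (w none) fun i => w (some i)) <• p S l) <• s S o)))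
    (fun S => .forall_finite fun o => .aboveTheta (.val ?_)) ?_
  · have h1 : ∀ o : Option S, IsModTerm fun (H : HenselianModel φ c) (w : Option ι → H.M) =>
        o.elim (w none) fun i => w (some i) := by
      rintro (_ | i)
      · exact .var none
      · exact .var (some i.1)
    exact (h1 o).sub ((IsModTerm.sum Finset.univ fun l => (h1 l).act _).act _)
  · intro H w _ H' w' _ h hsol
    exact H.henselian.gtTheta_transfer H.divisible H'.henselian H'.divisible
      (fun r _ => by rw [H.encard_ann, H'.encard_ann]) hd hg hs h hsol

theorem isDefinable_compatible (i₀ : ι) (p q : ι → TwistedPoly φ) :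
    IsDefinable fun (H : HenselianModel φ c) (u : ι → H.M) (γ : ι → H.V) =>
      IsHenselianValuedModule.Compatible H.τ H.v i₀ p q u γ := by
  have hw : ∀ i : ι, IsValTerm fun (H : HenselianModel φ c) (u : ι → H.M) (_ : ι → H.V) =>
      H.v (u i <• q i - u i₀ <• p i) :=
    fun i => .val (((IsModTerm.var i).act _).sub ((IsModTerm.var i₀).act _))
  have hγ : ∀ i : ι, IsDefinable fun (H : HenselianModel φ c) (_ : ι → H.M) (γ : ι → H.V) =>
      γ i ≤ H.τ (γ i) := fun i => .le (.var i) (IsValTerm.var i).tau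
  exact .forall_finite fun i => ((hγ i).imp (.le (hw i) (hw i).tau)).and
    ((hγ i).not.imp (.eq (hw i) ((IsValTerm.var i).iterate_tau _)))

/-- Definability of the solvability of `v(x.(r i) + u i) = γ i` for given positions of the `γ i`
relative to `θ`. -/
theorem isDefinable_exists_values_of_type {r : ι → TwistedPoly φ} (hr : ∀ i, r i ≠ 0)
    (E J : Set ι) :
    IsDefinable fun (H : HenselianModel φ c) (u : ι → H.M) (γ : ι → H.V) =>
      (∀ i, γ i ≤ H.τ (γ i) ↔ i ∈ E) ∧ (∀ i, AboveTheta H.τ (γ i) ↔ i ∈ J) ∧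
      ∃ x, ∀ i, H.v (x <• r i + u i) = γ i := by
  classical
  cases nonempty_fintype ι
  have hE : IsDefinable fun (H : HenselianModel φ c) (_ : ι → H.M) (γ : ι → H.V) =>
      ∀ i, γ i ≤ H.τ (γ i) ↔ i ∈ E := .forall_finite fun i =>
    IsDefinable.iff (.le (.var i) (IsValTerm.var i).tau) (.const _)
  have hJ : IsDefinable fun (H : HenselianModel φ c) (_ : ι → H.M) (γ : ι → H.V) =>
      ∀ i, AboveTheta H.τ (γ i) ↔ i ∈ J := .forall_finite fun i =>
    IsDefinable.iff (.aboveTheta (.var i)) (.const _)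
  suffices H : ∃ Q : ∀ H : HenselianModel φ c, (ι → H.M) → (ι → H.V) → Prop, IsDefinable Q ∧
      ∀ (H : HenselianModel φ c) (u : ι → H.M) (γ : ι → H.V), (∀ i, γ i ≤ H.τ (γ i) ↔ i ∈ E) →
        (∀ i, AboveTheta H.τ (γ i) ↔ i ∈ J) →
        ((∃ x, ∀ i, H.v (x <• r i + u i) = γ i) ↔ Q H u γ) by
    obtain ⟨Q, hQ, h⟩ := H
    exact (hE.and (hJ.and hQ)).congr fun H u γ =>
      and_congr_right fun h1 => and_congr_right fun h2 => h H u γ h1 h2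
  -- `E` collects the indices with values at or above `θ`, `J` those strictly above. The cases are:
  -- all below `θ`, none above but some equal to `θ`, and some above.
  rcases E.eq_empty_or_nonempty with hE0 | ⟨e, he⟩
  · obtain ⟨m, q, hm, hq, hrq⟩ := TwistedPoly.exists_common_multiple r hr
    exact ⟨_, isDefinable_exists_values.comp (fun i => (IsModTerm.var i).act (q i))
      (fun i => (IsValTerm.var i).iterate_tau (q i).deg), fun H u γ h1 _ =>
      H.henselian.exists_values_iff_of_lt_theta H.divisible hm hq hrq fun i => by
        rw [h1, hE0]; exact Set.notMem_empty i⟩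
  have hpq : ∀ i₀ : ι, ∃ p q : ι → TwistedPoly φ, (∀ i, q i ≠ 0) ∧
      ∀ i, r i * q i = r i₀ * p i := fun i₀ => by
    choose q p hq _ h using fun i => TwistedPoly.exists_mul_eq_mul (hr i) (hr i₀)
    exact ⟨p, q, hq, h⟩
  rcases J.eq_empty_or_nonempty with hJ0 | ⟨j, hj⟩
  · obtain ⟨p, q, hq, hrq⟩ := hpq e
    exact ⟨_, isDefinable_compatible e p q, fun H u γ h1 h2 =>
      H.henselian.exists_values_iff_of_le_theta H.divisible hr hq hrq ((h1 e).2 he) fun i => by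
        rw [h2, hJ0]; exact Set.notMem_empty i⟩
  obtain ⟨p, q, hq, hrq⟩ := hpq j
  obtain ⟨d, p', s, hp', hs⟩ := TwistedPoly.exists_bezout fun l : J.toFinset => r l
  obtain ⟨m, q', hm, hq', hrq'⟩ :=
    TwistedPoly.exists_common_multiple (fun l : J.toFinset => r l) fun l => hr l
  have hjJ : j ∈ J.toFinset := Set.mem_toFinset.2 hj
  have hd0 : d ≠ 0 := by
    rintro rfl
    exact hr j (by simpa using hs ⟨j, hjJ⟩)
  have hU : IsModTerm fun (H : HenselianModel φ c) (u : ι → H.M) =>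
      ∑ l : J.toFinset, u l <• p' l := .sum _ fun l => (IsModTerm.var l.1).act _
  have he : ∀ l : J.toFinset, IsModTerm fun (H : HenselianModel φ c) (u : ι → H.M) =>
      u l - (∑ l : J.toFinset, u l <• p' l) <• s l := fun l => (IsModTerm.var l.1).sub (hU.act _)
  refine ⟨_, (isDefinable_compatible j p q).and <|
    (IsDefinable.forall_finite fun l => .aboveTheta (.val (he l))).and <|
    (isDefinable_exists_values.comp (fun l => (he l).act (q' l))
      fun l => (IsValTerm.var l.1).iterate_tau (q' l).ord).and <|
    (isDefinable_exists_aboveTheta hd0 fun i : {i // i ∈ E ∧ i ∉ J} => r i).comp (β' := ι)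
      (α := ι) (β := ι) (f := fun o (H : HenselianModel φ c) (u : ι → H.M) =>
        o.elim (∑ l : J.toFinset, u l <• p' l) fun i => u i.1)
      (by rintro (_ | i); exacts [hU, .var i.1]) (fun i => .var i), fun H u γ h1 h2 => ?_⟩
  rw [H.henselian.exists_values_iff_of_gt_theta H.divisible hjJ hq hrq
    (fun i => (h2 i).trans Set.mem_toFinset.symm) hd0 hp' hs hm hq' hrq']
  refine and_congr_right fun _ => and_congr_right fun _ => and_congr_right fun _ =>
    exists_congr fun x => and_congr_right fun _ => ?_
  simp only [h1, h2]
  exact ⟨fun h i => h i.1 i.2.1 i.2.2, fun h i hi hi' => h ⟨i, hi, hi'⟩⟩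

/-- Definability of the solvability of `v(x.(r i) + u i) = γ i`. -/
theorem isDefinable_exists_smul_values (r : ι → TwistedPoly φ) :
    IsDefinable fun (H : HenselianModel φ c) (u : ι → H.M) (γ : ι → H.V) =>
      ∃ x, ∀ i, H.v (x <• r i + u i) = γ i := by
  have h1 : IsDefinable fun (H : HenselianModel φ c) (u : {i // r i ≠ 0} → H.M)
      (γ : {i // r i ≠ 0} → H.V) => ∃ x, ∀ i, H.v (x <• r i.1 + u i) = γ i := by
    refine (IsDefinable.exists_finite fun E => IsDefinable.exists_finite fun J =>
      isDefinable_exists_values_of_type (r := fun i : {i // r i ≠ 0} => r i.1) (fun i => i.2)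
        E J).congr fun H u γ => ⟨fun h => ?_, ?_⟩
    · exact ⟨{i | γ i ≤ H.τ (γ i)}, {i | AboveTheta H.τ (γ i)}, fun i => Iff.rfl, fun i => Iff.rfl,
        h⟩
    · rintro ⟨E, J, -, -, h⟩
      exact h
  -- Conditions with `r i = 0` do not involve `x` and are split off.
  have h2 := (IsDefinable.forall_finite fun i : {i // r i = 0} =>
      IsDefinable.eq (c := c) (α := ι) (β := ι) (.val (.var i.1)) (.var i.1)).and
    (h1.comp (α := ι) (β := ι) (fun i => .var i.1) (fun i => .var i.1))
  refine h2.congr fun H u γ => ?_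
  constructor
  · rintro ⟨x, hx⟩
    refine ⟨fun i => ?_, x, fun i => hx i⟩
    rw [← hx i, i.2, MulOpposite.op_zero, zero_smul, zero_add]
  · rintro ⟨h, x, hx⟩
    refine ⟨x, fun i => ?_⟩
    by_cases hi : r i = 0
    · rw [hi, MulOpposite.op_zero, zero_smul, zero_add]
      exact h ⟨i, hi⟩
    · exact hx ⟨i, hi⟩

end Elimination

end ValMod

end

noncomputable section

open scoped RightActions

namespace ValMod

open FirstOrder FirstOrder.Language

/-! ## Elimination of all module quantifiers -/

section

variable {K : Type u} [Field K] {φ : K →+* K} {c : TwistedPoly φ → ℕ∞} {m n : ℕ} {β : Type}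

/-- A module term is an affine function of its last variable. -/
theorem exists_affine (s : (modLang (TwistedPoly φ)).Term (Fin (m + 1))) :
    ∃ (r : TwistedPoly φ) (u : ∀ H : HenselianModel φ c, (Fin m → H.M) → H.M), IsModTerm u ∧
      ∀ (H : HenselianModel φ c) (x : Fin m → H.M) (a : H.M),
        s.realize (Fin.snoc (α := fun _ => H.M) x a) = a <• r + u H x := by
  induction s with
  | var i =>
    refine Fin.lastCases ?_ (fun i => ?_) i
    · exact ⟨1, _, .zero, fun H x a => by simp⟩
    · exact ⟨0, _, .var i, fun H x a => by simp⟩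
  | func f ts ih =>
    choose r u hu h using ih
    cases f with
    | zero => exact ⟨0, _, .zero, fun H x a => by
        rw [MulOpposite.op_zero, zero_smul, zero_add]; rfl⟩
    | add =>
      refine ⟨r 0 + r 1, _, (hu 0).add (hu 1), fun H x a => ?_⟩
      rw [MulOpposite.op_add, add_smul, add_add_add_comm, ← h, ← h]; rfl
    | neg =>
      refine ⟨-r 0, _, (hu 0).neg, fun H x a => ?_⟩
      rw [MulOpposite.op_neg, neg_smul, ← neg_add, ← h]; rfl
    | act q =>
      refine ⟨r 0 * q, _, (hu 0).act q, fun H x a => ?_⟩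
      rw [MulOpposite.op_mul, mul_smul, ← smul_add, ← h]; rfl

/-- Only finitely many terms occur in the formula, each affine in the last variable `a`. Naming
their values by new value variables `z` separates the formula into an `L_V`-condition on `z` and the
solvability in `a` of a linear value system. -/
theorem IsDefinable.exists_mod
    {P : ∀ H : HenselianModel φ c, (Fin (m + 1) → H.M) → (β → H.V) → Prop} (hP : IsDefinable P) :
    IsDefinable fun H (x : Fin m → H.M) y => ∃ a : H.M, P H (Fin.snoc x a) y := by
  classical
  obtain ⟨ψ, hψ⟩ := hP
  let S : Finset ((modLang (TwistedPoly φ)).Term (Fin (m + 1))) :=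
    ψ.freeVarFinset.preimage Sum.inl Sum.inl_injective.injOn
  let e : S ≃ Fin S.card := S.equivFin
  choose r u hu hs using fun i : Fin S.card => exists_affine (c := c) (e.symm i).1
  let f : ψ.freeVarFinset → Fin S.card ⊕ β := fun o => match o with
    | ⟨Sum.inl s, h⟩ => Sum.inl (e ⟨s, Finset.mem_preimage.2 h⟩)
    | ⟨Sum.inr b, _⟩ => Sum.inr b
  let ψ' : valLang.Formula (Fin S.card ⊕ β) := BoundedFormula.restrictFreeVar ψ f
  have h1 : ∀ (H : HenselianModel φ c) (x : Fin m → H.M) (y : β → H.V) (a : H.M),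
      P H (Fin.snoc x a) y ↔ ψ'.Realize (Sum.elim (fun i => H.v (a <• r i + u i H x)) y) := by
    intro H x y a
    rw [hψ]
    refine (BoundedFormula.realize_restrictFreeVar _ ?_).symm
    rintro ⟨t | b, h⟩
    · simp only [f, Sum.elim_inl, ← hs, Equiv.symm_apply_apply, HenselianModel.assign]
    · rfl
  have h2 : IsDefinable fun (H : HenselianModel φ c) (_ : Fin m → H.M)
      (y : β ⊕ Fin S.card → H.V) => ψ'.Realize (fun o => y (Sum.swap o)) :=
    ⟨ψ'.relabel (fun o => Sum.inr (Sum.swap o)), fun H x y => by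
      rw [Formula.realize_relabel]; rfl⟩
  have h3 := (isDefinable_exists_smul_values (c := c) r).comp (α := Fin m) (β := β ⊕ Fin S.card)
    hu (fun i => .var (Sum.inr i))
  refine (h3.and h2).exists_val.congr fun H x y => ?_
  simp only [h1]
  constructor
  · rintro ⟨a, ha⟩
    refine ⟨fun i => H.v (a <• r i + u i H x), ⟨a, fun i => rfl⟩, ?_⟩
    convert ha using 2 with o
    rcases o with i | b <;> rfl
  · rintro ⟨z, ⟨a, ha⟩, h⟩
    refine ⟨a, ?_⟩
    convert h using 2 with o
    rcases o with i | b
    · exact ha i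
    · rfl

/-- Every formula defines a predicate of the value sort. -/
theorem isDefinable_realize (χ : LFormula (TwistedPoly φ) m n) :
    IsDefinable fun (H : HenselianModel φ c) (x : Fin m → H.M) (y : Fin n → H.V) =>
      χ.Realize H.toLStr x y := by
  induction χ with
  | falsum => exact .const False
  | modEq s s' =>
    -- Equality in the module sort becomes `v(s - s') = ∞`, so value conditions alone suffice.
    refine (IsDefinable.eq (.val ((IsModTerm.realize s).sub (.realize s'))) .top).congr fun H x y => ?_
    rw [H.henselian.eq_top_iff, sub_eq_zero]
    rfl
  | valEq s s' => exact .eq ⟨s, fun _ _ _ => rfl⟩ ⟨s', fun _ _ _ => rfl⟩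
  | valRel ρ s => exact ⟨Relations.formula ρ s, fun H x y => Formula.realize_rel.symm⟩
  | imp χ χ' h h' => exact h.imp h'
  | allM χ h =>
    refine h.not.exists_mod.not.congr fun H x y => ?_
    rw [not_exists_not]
    rfl
  | @allV m n χ h =>
    let e : Fin (n + 1) → Fin n ⊕ Unit := Fin.snoc (α := fun _ => Fin n ⊕ Unit) Sum.inl (Sum.inr ())
    have h1 := (h.not.comp (α := Fin m) (β := Fin n ⊕ Unit) (fun i => .var i)
      (fun i => .var (e i))).exists_val.not
    refine h1.congr fun H x y => ?_
    rw [not_exists_not]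
    have h2 : ∀ z : Unit → H.V, (fun i => Sum.elim y z (e i)) =
        Fin.snoc (α := fun _ => H.V) y (z ()) := by
      intro z
      funext i
      refine Fin.lastCases ?_ (fun i => ?_) i <;> simp [e]
    simp only [h2]
    exact ⟨fun h z => h (z ()), fun h b => h fun _ => b⟩

end

/-! ## Semantics of `L`-formulas -/

namespace LFormula

variable {R : Type u} (S : LStr R) {m n : ℕ} {x : Fin m → S.M} {y : Fin n → S.V}

@[simp] theorem realize_falsum : (falsum : LFormula R m n).Realize S x y ↔ False := Iff.rfl

@[simp] theorem realize_modEq {s s' : (modLang R).Term (Fin m)} :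
    (modEq s s' : LFormula R m n).Realize S x y ↔ s.realize x = s'.realize x := Iff.rfl

@[simp] theorem realize_valEq {s s' : ValTerm R m n} :
    (valEq s s').Realize S x y ↔ S.evalV x y s = S.evalV x y s' := Iff.rfl

@[simp] theorem realize_imp {χ χ' : LFormula R m n} :
    (χ.imp χ').Realize S x y ↔ (χ.Realize S x y → χ'.Realize S x y) := Iff.rfl

@[simp] theorem realize_allM {χ : LFormula R (m + 1) n} :
    χ.allM.Realize S x y ↔ ∀ a : S.M, χ.Realize S (Fin.snoc x a) y := Iff.rfl

@[simp] theorem realize_allV {χ : LFormula R m (n + 1)} :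
    χ.allV.Realize S x y ↔ ∀ b : S.V, χ.Realize S x (Fin.snoc y b) := Iff.rfl

@[simp] theorem realize_neg {χ : LFormula R m n} : χ.neg.Realize S x y ↔ ¬ χ.Realize S x y :=
  Iff.rfl

@[simp] theorem realize_conj {χ χ' : LFormula R m n} :
    (χ.conj χ').Realize S x y ↔ χ.Realize S x y ∧ χ'.Realize S x y := by
  simp [conj]

@[simp] theorem realize_disj {χ χ' : LFormula R m n} :
    (χ.disj χ').Realize S x y ↔ χ.Realize S x y ∨ χ'.Realize S x y := by
  simp only [disj, realize_imp, realize_neg]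
  tauto

@[simp] theorem realize_equiv {χ χ' : LFormula R m n} :
    (χ.equiv χ').Realize S x y ↔ (χ.Realize S x y ↔ χ'.Realize S x y) := by
  simp only [equiv, realize_conj, realize_imp]
  tauto

@[simp] theorem realize_exM {χ : LFormula R (m + 1) n} :
    χ.exM.Realize S x y ↔ ∃ a : S.M, χ.Realize S (Fin.snoc x a) y := by
  simp [exM]

theorem realize_exsM {χ : LFormula R m n} {x₀ : Fin 0 → S.M} :
    χ.exsM.Realize S x₀ y ↔ ∃ x : Fin m → S.M, χ.Realize S x y := by
  induction m with
  | zero => exact ⟨fun h => ⟨x₀, h⟩, fun ⟨x, h⟩ => by rwa [Subsingleton.elim x x₀] at h⟩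
  | succ m ih =>
    rw [exsM, ih]
    simp only [realize_exM]
    exact ⟨fun ⟨x, a, h⟩ => ⟨_, h⟩, fun ⟨x, h⟩ => ⟨Fin.init x, x (Fin.last m), by
      rwa [Fin.snoc_init_self]⟩⟩

@[simp] theorem realize_conjs {l : List (LFormula R m n)} :
    (conjs l).Realize S x y ↔ ∀ χ ∈ l, χ.Realize S x y := by
  induction l with
  | nil => simp [conjs]
  | cons χ l ih => simp [conjs, ih]

theorem realize_ofMod {γ : Type} (e : γ → Fin m) {l : ℕ} (χ : (modLang R).BoundedFormula γ l)
    (x : Fin (m + l) → S.M) :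
    (ofMod e χ : LFormula R (m + l) n).Realize S x y ↔
      χ.Realize (fun a => x (Fin.castAdd l (e a))) (fun i => x (Fin.natAdd m i)) := by
  have hterm : ∀ {l : ℕ} (x : Fin (m + l) → S.M) (s : (modLang R).Term (γ ⊕ Fin l)),
      (s.relabel (Sum.elim (Fin.castAdd l ∘ e) (Fin.natAdd m))).realize x =
        s.realize (Sum.elim (fun a => x (Fin.castAdd l (e a))) fun i => x (Fin.natAdd m i)) := by
    intro l x s
    rw [Term.realize_relabel]
    exact congrArg (fun z => s.realize z) (funext fun o => by rcases o with a | i <;> rfl)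
  induction χ with
  | falsum => rfl
  | equal s s' =>
    rw [ofMod, realize_modEq, hterm, hterm]
    rfl
  | rel ρ _ => exact ρ.elim
  | imp χ χ' h h' => exact imp_congr (h x) (h' x)
  | @all l χ h =>
    refine forall_congr' fun a => (h (Fin.snoc (α := fun _ => S.M) x a)).trans ?_
    refine iff_of_eq (congrArg₂ χ.Realize (funext fun i => ?_) (funext fun i => ?_))
    · exact Fin.snoc_castSucc (α := fun _ => S.M) a x (Fin.castAdd l (e i))
    · refine Fin.lastCases ?_ (fun i => ?_) i
      · rw [Fin.snoc_last]
        exact Fin.snoc_last (α := fun _ => S.M) a x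
      · rw [Fin.snoc_castSucc]
        exact Fin.snoc_castSucc (α := fun _ => S.M) a x (Fin.natAdd m i)

theorem realize_ofVal {γ : Type} (e : γ → ValTerm R m n) {l : ℕ}
    (χ : valLang.BoundedFormula γ l) (y : Fin (n + l) → S.V) :
    (ofVal e χ).Realize S x y ↔
      χ.Realize (fun a => S.evalV x (fun i => y (Fin.castAdd l i)) (e a))
        (fun i => y (Fin.natAdd n i)) := by
  have hterm : ∀ {l : ℕ} (y : Fin (n + l) → S.V) (s : valLang.Term (γ ⊕ Fin l)),
      S.evalV x y (s.subst (valSubst e l)) = s.realize (Sum.elim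
        (fun a => S.evalV x (fun i => y (Fin.castAdd l i)) (e a)) fun i => y (Fin.natAdd n i)) := by
    intro l y s
    rw [LStr.evalV, Term.realize_subst]
    refine congrArg (fun z => s.realize z) (funext fun o => ?_)
    rcases o with a | i
    · simp only [valSubst, Sum.elim_inl, Term.realize_relabel, LStr.evalV]
      exact congrArg (fun z => (e a).realize z) (funext fun o => by rcases o with b | j <;> rfl)
    · rfl
  induction χ with
  | falsum => rfl
  | equal s s' =>
    rw [ofVal, realize_valEq, hterm, hterm]
    rfl
  | rel ρ s =>
    refine iff_of_eq (congrArg (Structure.RelMap ρ) (funext fun i => hterm y (s i)))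
  | imp χ χ' h h' => exact imp_congr (h y) (h' y)
  | @all l χ h =>
    refine forall_congr' fun a => (h (Fin.snoc (α := fun _ => S.V) y a)).trans ?_
    refine iff_of_eq (congrArg₂ χ.Realize (funext fun i => ?_) (funext fun i => ?_))
    · refine congrArg (fun z => S.evalV x z (e i)) (funext fun j => ?_)
      exact Fin.snoc_castSucc (α := fun _ => S.V) a y (Fin.castAdd l j)
    · refine Fin.lastCases ?_ (fun i => ?_) i
      · rw [Fin.snoc_last]
        exact Fin.snoc_last (α := fun _ => S.V) a y
      · rw [Fin.snoc_castSucc]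
        exact Fin.snoc_castSucc (α := fun _ => S.V) a y (Fin.natAdd n i)

end LFormula

section

variable {R : Type u} (S : LStr R)

theorem realize_modSentence (σ : (modLang R).Sentence) :
    (modSentence σ).Realize S Fin.elim0 Fin.elim0 ↔ S.M ⊨ σ := by
  refine (LFormula.realize_ofMod S (n := 0) (y := Fin.elim0) (Empty.elim : Empty → Fin 0) σ
    Fin.elim0).trans ?_
  exact iff_of_eq (congrArg₂ (BoundedFormula.Realize σ) (Subsingleton.elim _ _)
    (Subsingleton.elim _ _))

theorem realize_valSentence (σ : valLang.Sentence) :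
    (valSentence (R := R) σ).Realize S Fin.elim0 Fin.elim0 ↔ S.V ⊨ σ := by
  refine (LFormula.realize_ofVal S (m := 0) (n := 0) (x := Fin.elim0)
    (Empty.elim : Empty → ValTerm R 0 0) σ Fin.elim0).trans ?_
  exact iff_of_eq (congrArg₂ (BoundedFormula.Realize σ) (Subsingleton.elim _ _)
    (Subsingleton.elim _ _))

end

section

variable {K : Type u} [Field K] {φ : K →+* K} (c : TwistedPoly φ → ℕ∞) {m n : ℕ}

/-- Every formula is equivalent to one in `Θ_v`. -/
theorem exists_thetaV (χ : LFormula (TwistedPoly φ) m n) :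
    ∃ θ ∈ ThetaV (TwistedPoly φ) m n, ∀ (H : HenselianModel φ c) (x : Fin m → H.M)
      (y : Fin n → H.V), χ.Realize H.toLStr x y ↔ θ.Realize H.toLStr x y := by
  classical
  obtain ⟨ψ, hψ⟩ := isDefinable_realize (c := c) χ
  let S : Finset ((modLang (TwistedPoly φ)).Term (Fin m)) :=
    ψ.freeVarFinset.preimage Sum.inl Sum.inl_injective.injOn
  let e : S ≃ Fin S.card := S.equivFin
  let f : ψ.freeVarFinset → Fin n ⊕ Fin S.card := fun o => match o with
    | ⟨Sum.inl s, h⟩ => Sum.inr (e ⟨s, Finset.mem_preimage.2 h⟩)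
    | ⟨Sum.inr b, _⟩ => Sum.inl b
  let ψ' : valLang.Formula (Fin n ⊕ Fin S.card) := BoundedFormula.restrictFreeVar ψ f
  -- The module part `ξ` can be trivial, since equations between terms are already encoded by the
  -- value `∞`.
  refine ⟨_, ⟨⊤, S.card, fun i => (e.symm i).1, ψ'.toPrenex, .imp .falsum .falsum,
    BoundedFormula.toPrenex_isPrenex _, rfl⟩, fun H x y => ?_⟩
  have h1 : (LFormula.ofMod (n := n) (l := 0) id (⊤ : (modLang (TwistedPoly φ)).Formula (Fin m))
      ).Realize H.toLStr x y := id
  refine (hψ H x y).trans ?_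
  rw [LFormula.realize_conj]
  refine Iff.trans ?_ (and_iff_right h1).symm
  refine Iff.trans ?_ (LFormula.realize_ofVal H.toLStr (l := 0) _ _ y).symm
  rw [BoundedFormula.realize_toPrenex]
  refine Iff.trans ?_ (BoundedFormula.realize_restrictFreeVar (H.assign x y) ?_).symm
  · exact iff_of_eq (congrArg (BoundedFormula.Realize ψ (H.assign x y)) (Subsingleton.elim _ _))
  · rintro ⟨t | b, h⟩
    · simp only [f, Sum.elim_inr, Equiv.symm_apply_apply]
      rfl
    · rfl

end

end ValMod

end

noncomputable section

open scoped RightActions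

namespace ValMod

open FirstOrder FirstOrder.Language

/-! ## Interpretations of the symbols -/

section Operations

variable {R : Type u} {M V : Type u} [(modLang R).Structure M] [valLang.Structure V]

/-- The interpretation of `0`. -/
def zeroOp (R M : Type u) [(modLang R).Structure M] : M :=
  Structure.funMap (L := modLang R) ModFunc.zero default

/-- The interpretation of `+`. -/
def addOp (R : Type u) {M : Type u} [(modLang R).Structure M] (a b : M) : M :=
  Structure.funMap (L := modLang R) ModFunc.add ![a, b]

/-- The interpretation of `-`. -/
def negOp (R : Type u) {M : Type u} [(modLang R).Structure M] (a : M) : M :=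
  Structure.funMap (L := modLang R) ModFunc.neg ![a]

/-- The interpretation of `.r`. -/
def actOp (r : R) (a : M) : M := Structure.funMap (L := modLang R) (ModFunc.act r) ![a]

/-- The interpretation of `∞`. -/
def inftyOp (V : Type u) [valLang.Structure V] : V :=
  Structure.funMap (L := valLang) ValFunc.infty default

/-- The interpretation of `τ`. -/
def tauOp (a : V) : V := Structure.funMap (L := valLang) ValFunc.tau ![a]

/-- The interpretation of `≤`. -/
def leRel (a b : V) : Prop := Structure.RelMap (L := valLang) ValRel.le ![a, b]

/-- The interpretation of `R_n`. -/
def resRel (n : ℕ) (a : V) : Prop := Structure.RelMap (L := valLang) (ValRel.res n) ![a]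

variable {α : Type} {γ : Type*} (x : α → M) (y : γ → V)

@[simp] theorem realize_mvar {m : ℕ} (i : Fin m) (x : Fin m → M) :
    (mvar i : (modLang R).Term (Fin m)).realize x = x i := rfl

@[simp] theorem realize_zeroT : (zeroT : (modLang R).Term α).realize x = zeroOp R M :=
  congrArg (Structure.funMap (L := modLang R) ModFunc.zero) (Subsingleton.elim _ _)

@[simp] theorem realize_addT (s s' : (modLang R).Term α) :
    (addT s s').realize x = addOp R (s.realize x) (s'.realize x) := Term.realize_functions_apply₂

@[simp] theorem realize_negT (s : (modLang R).Term α) :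
    (negT s).realize x = negOp R (s.realize x) := Term.realize_functions_apply₁

@[simp] theorem realize_actT (s : (modLang R).Term α) (r : R) :
    (actT s r).realize x = actOp r (s.realize x) := Term.realize_functions_apply₁

@[simp] theorem realize_inftyT : (inftyT : valLang.Term γ).realize y = inftyOp V :=
  congrArg (Structure.funMap (L := valLang) ValFunc.infty) (Subsingleton.elim _ _)

@[simp] theorem realize_tauT (s : valLang.Term γ) :
    (tauT s).realize y = tauOp (s.realize y) := Term.realize_functions_apply₁

end Operations

section

variable {R : Type u} (S : LStr R) {m n : ℕ} {x : Fin m → S.M} {y : Fin n → S.V}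

@[simp] theorem evalV_vT (s : (modLang R).Term (Fin m)) :
    S.evalV x y (vT s) = S.v (s.realize x) := rfl

@[simp] theorem evalV_vvar (i : Fin n) : S.evalV x y (vvar i) = y i := rfl

@[simp] theorem evalV_inftyT : S.evalV x y inftyT = inftyOp S.V := realize_inftyT _

@[simp] theorem evalV_tauT (s : ValTerm R m n) :
    S.evalV x y (tauT s) = tauOp (S.evalV x y s) := realize_tauT _ _

@[simp] theorem realize_leF (s s' : ValTerm R m n) :
    (leF s s').Realize S x y ↔ leRel (S.evalV x y s) (S.evalV x y s') := by
  refine iff_of_eq (congrArg (Structure.RelMap (L := valLang) ValRel.le) (funext fun i => ?_))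
  refine Fin.cases rfl (fun i => ?_) i
  rw [Subsingleton.elim i 0]
  rfl

@[simp] theorem realize_resF (k : ℕ) (s : ValTerm R m n) :
    (resF k s).Realize S x y ↔ resRel k (S.evalV x y s) := by
  refine iff_of_eq (congrArg (Structure.RelMap (L := valLang) (ValRel.res k)) (funext fun i => ?_))
  rw [Subsingleton.elim i 0]
  rfl

@[simp] theorem realize_ltF (s s' : ValTerm R m n) : (ltF s s').Realize S x y ↔
    leRel (S.evalV x y s) (S.evalV x y s') ∧ ¬ leRel (S.evalV x y s') (S.evalV x y s) := by
  simp [ltF]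

@[simp] theorem realize_aboveThetaF (s : ValTerm R m n) : (aboveThetaF s).Realize S x y ↔
    (leRel (S.evalV x y s) (tauOp (S.evalV x y s)) ∧
      ¬ leRel (tauOp (S.evalV x y s)) (S.evalV x y s)) ∨ S.evalV x y s = inftyOp S.V := by
  simp [aboveThetaF]

end

/-! ## Models of the theories of modules and of `τ`-chains -/

theorem le_encard_iff {M : Type u} {s : Set M} {n : ℕ} : (n : ℕ∞) ≤ s.encard ↔
    ∃ x : Fin n → M, (∀ i, x i ∈ s) ∧ ∀ i j, i ≠ j → x i ≠ x j := by
  constructor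
  · intro h
    obtain ⟨t, hts, ht⟩ := Set.exists_subset_encard_eq h
    have hfin : t.Finite := Set.finite_of_encard_eq_coe ht
    have := hfin.fintype
    have hcard : Fintype.card t = n := by
      rw [← Set.toFinset_card, ← Nat.cast_inj (R := ℕ∞), ← Set.encard_coe_eq_coe_finsetCard,
        Set.coe_toFinset, ht]
    let e := (Fintype.equivFinOfCardEq hcard).symm
    exact ⟨fun i => (e i).1, fun i => hts (e i).2,
      fun i j hij h => hij (e.injective (Subtype.ext h))⟩
  · rintro ⟨x, hx, hinj⟩
    have h : Function.Injective x := fun i j hij => by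
      by_contra hne
      exact hinj i j hne hij
    calc (n : ℕ∞) = (Set.range x).encard := by
          rw [← Set.image_univ, h.encard_image, Set.encard_univ]
          simp
      _ ≤ s.encard := Set.encard_le_encard (Set.range_subset_iff.2 hx)

section

theorem realize_annGe {R M : Type u} [(modLang R).Structure M] (r : R) (n : ℕ) :
    M ⊨ annGe r n ↔ (n : ℕ∞) ≤ {x : M | actOp r x = zeroOp R M}.encard := by
  rw [le_encard_iff]
  unfold annGe Sentence.Realize
  rw [BoundedFormula.realize_exs]
  refine exists_congr fun x => ?_
  rw [BoundedFormula.realize_inf, BoundedFormula.realize_iInf, BoundedFormula.realize_iInf]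
  refine and_congr (forall_congr' fun i => ?_) ?_
  · rw [BoundedFormula.realize_bdEqual, realize_actT, realize_zeroT]
    rfl
  · refine ⟨fun h i j hij => h ⟨(i, j), hij⟩, fun h p => h p.1.1 p.1.2 p.2⟩

variable {R : Type u} [Ring R] {M : Type u} [inst : (modLang R).Structure M]

/-- A model of the axioms of modules is a module. -/
theorem exists_module (h : ∀ σ ∈ moduleTheory R, M ⊨ σ) :
    ∃ (_ : AddCommGroup M) (_ : Module Rᵐᵒᵖ M), modStructure R M = inst := by
  have hassoc := h (∀' ∀' ∀' (addT (addT &0 &1) &2 =' addT &0 (addT &1 &2)))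
    (by simp [moduleTheory])
  have hcomm := h (∀' ∀' (addT &0 &1 =' addT &1 &0)) (by simp [moduleTheory])
  have hzero := h (∀' (addT &0 zeroT =' &0)) (by simp [moduleTheory])
  have hneg := h (∀' (addT &0 (negT &0) =' zeroT)) (by simp [moduleTheory])
  have hone := h (∀' (actT &0 1 =' &0)) (by simp [moduleTheory])
  have hadd := fun r : R => h (∀' ∀' (actT (addT &0 &1) r =' addT (actT &0 r) (actT &1 r)))
    (Or.inl (Or.inl (Or.inr ⟨r, rfl⟩)))
  have hadd' := fun r s : R => h (∀' (actT &0 (r + s) =' addT (actT &0 r) (actT &0 s)))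
    (Or.inl (Or.inr ⟨r, s, rfl⟩))
  have hmul := fun r s : R => h (∀' (actT &0 (r * s) =' actT (actT &0 r) s)) (Or.inr ⟨r, s, rfl⟩)
  simp [Sentence.Realize, Formula.Realize, Fin.snoc] at hassoc hcomm hzero hneg hone hadd hadd' hmul
  let _ : Zero M := ⟨zeroOp R M⟩
  let _ : Add M := ⟨addOp R⟩
  let _ : Neg M := ⟨negOp R⟩
  let i : AddCommGroup M :=
    { add := addOp R
      zero := zeroOp R M
      neg := negOp R
      add_assoc := hassoc
      add_comm := hcomm
      zero_add := fun a => (hcomm _ _).trans (hzero a)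
      add_zero := hzero
      neg_add_cancel := fun a => (hcomm _ _).trans (hneg a)
      nsmul := nsmulRec
      zsmul := zsmulRec }
  have hact0 : ∀ r : R, actOp r (0 : M) = 0 := fun r => by
    have h1 : actOp r (0 + 0 : M) = actOp r 0 + actOp r 0 := hadd r 0 0
    rwa [add_zero, left_eq_add] at h1
  have hact0' : ∀ a : M, actOp (0 : R) a = 0 := fun a => by
    have h1 : actOp (0 + 0 : R) a = actOp (0 : R) a + actOp (0 : R) a := hadd' 0 0 a
    rwa [add_zero, left_eq_add] at h1
  let j : Module Rᵐᵒᵖ M :=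
    { smul := fun r a => actOp r.unop a
      one_smul := hone
      -- Multiplication in the opposite ring reverses the factors.
      mul_smul := fun r s a => hmul s.unop r.unop a
      smul_zero := fun r => hact0 r.unop
      smul_add := fun r a b => hadd r.unop a b
      add_smul := fun r s a => hadd' r.unop s.unop a
      zero_smul := hact0' }
  refine ⟨i, j, ?_⟩
  ext n f x
  · have h1 : ∀ x : Fin 1 → M, ![x 0] = x := fun x => funext fun i => by
      rw [Subsingleton.elim i 0]; rfl
    have h2 : ∀ x : Fin 2 → M, ![x 0, x 1] = x := fun x => by
      ext i
      fin_cases i <;> rfl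
    cases f with
    | zero =>
      exact congrArg (@Structure.funMap (modLang R) M inst 0 ModFunc.zero) (Subsingleton.elim _ _)
    | add => exact congrArg (@Structure.funMap (modLang R) M inst 2 ModFunc.add) (h2 x)
    | neg => exact congrArg (@Structure.funMap (modLang R) M inst 1 ModFunc.neg) (h1 x)
    | act r => exact congrArg (@Structure.funMap (modLang R) M inst 1 (ModFunc.act r)) (h1 x)
  · exact f.elim

end

theorem exists_tauChain {V : Type u} [valLang.Structure V] (h : ∀ σ ∈ tauChainTheory, V ⊨ σ) :
    ∃ (_ : LinearOrder V) (_ : OrderTop V), (∀ a b : V, leRel a b ↔ a ≤ b) ∧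
      inftyOp V = ⊤ ∧ IsTauChain (tauOp : V → V) := by
  classical
  have h0 : V ⊨ valLang.linearOrderTheory := ⟨fun σ h1 => h σ (Or.inl h1)⟩
  let i : LinearOrder V := valLang.linearOrderOfModels V
  have htop := h (∀' (&0).le inftyT) (by simp [tauChainTheory])
  have hmono := h (∀' ∀' ((&0).lt &1 ⟹ (tauT &0).lt (tauT &1))) (by simp [tauChainTheory])
  have hmap := h (tauT inftyT =' inftyT) (by simp [tauChainTheory])
  have hlt := h (∀' ∀' (∼(&0 =' inftyT) ⟹ (tauT &0).le &0 ⟹ (&1).lt &0 ⟹ (tauT &1).lt &1))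
    (by simp [tauChainTheory])
  simp [Sentence.Realize, Formula.Realize, Fin.snoc] at htop hmono hmap hlt
  let j : OrderTop V := { top := inftyOp V, le_top := htop }
  exact ⟨i, j, fun _ _ => Iff.rfl, rfl, fun a b hab => hmono a b hab, hmap,
    fun a b ha hab hb => hlt a b ha hab hb⟩

end ValMod

end

/-! ### From models of the theory to divisible henselian modules. -/

noncomputable section

open scoped RightActions

namespace ValMod

open FirstOrder FirstOrder.Language

section

variable {R : Type u} [Ring R] {M : Type u} [AddCommGroup M] [Module Rᵐᵒᵖ M]

theorem zeroOp_modStructure : @zeroOp R M (modStructure R M) = 0 := rfl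

theorem addOp_modStructure (a b : M) : @addOp R M (modStructure R M) a b = a + b := rfl

theorem negOp_modStructure (a : M) : @negOp R M (modStructure R M) a = -a := rfl

theorem actOp_modStructure (r : R) (a : M) : @actOp R M (modStructure R M) r a = a <• r := rfl

end

variable {K : Type u} [Field K] {φ : K →+* K}

theorem realize_resAxiom {R : Type u} (S : LStr R) (n : ℕ) :
    (resAxiom R n).Realize S Fin.elim0 Fin.elim0 ↔ ∀ γ : S.V, γ ≠ inftyOp S.V →
      (resRel n γ ↔ ∃ x : Fin n → S.M, (∀ i, leRel γ (S.v (x i))) ∧ ∀ i j, i ≠ j →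
        ¬ (leRel γ (S.v (addOp R (x i) (negOp R (x j)))) ∧
          ¬ leRel (S.v (addOp R (x i) (negOp R (x j)))) γ)) := by
  unfold resAxiom
  simp only [LFormula.realize_allV, LFormula.realize_imp, LFormula.realize_neg,
    LFormula.realize_valEq, evalV_vvar, evalV_inftyT, LFormula.realize_equiv, realize_resF,
    LFormula.realize_exsM, LFormula.realize_conj, LFormula.realize_conjs, List.forall_mem_map]
  refine forall_congr' fun γ => imp_congr Iff.rfl (iff_congr Iff.rfl (exists_congr fun x =>
    and_congr (by simp [Fin.snoc]) ?_))
  simp [Fin.snoc]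

/-- Every model of `T_h ∪ Tor_F` arises from a divisible henselian valued module. -/
theorem exists_henselianModel {F : Type u} [AddCommGroup F] [Module (TwistedPoly φ)ᵐᵒᵖ F]
    (S : LStr (TwistedPoly φ)) (hT : S.Models (henselTheory φ))
    (hTor : S.Models (modSentence '' torTheory (R := TwistedPoly φ) F)) :
    ∃ H : HenselianModel φ fun r => (ann F r).encard, H.toLStr = S := by
  obtain @⟨M, V, iM, iV, v⟩ := S
  let S : LStr (TwistedPoly φ) := ⟨M, V, v⟩
  have htor : ∀ σ ∈ torTheory (R := TwistedPoly φ) F, M ⊨ σ := fun σ hσ =>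
    (realize_modSentence S σ).1 (hTor _ ⟨σ, hσ, rfl⟩)
  obtain ⟨i, j, rfl⟩ := exists_module fun σ hσ => htor σ (Or.inl (Or.inl (Or.inl (Or.inl hσ))))
  let _ := modStructure (TwistedPoly φ) M
  obtain ⟨iord, itop, hle, hinf, hτ⟩ := exists_tauChain (V := V) fun σ hσ =>
    (realize_valSentence S σ).1 (hT _ (Or.inl (Or.inl (Or.inl (Or.inl (Or.inr ⟨σ, hσ, rfl⟩))))))
  have hax := fun σ hσ => hT σ (Or.inl (Or.inl (Or.inl (Or.inr hσ))))
  simp [Fin.snoc, hle, hinf, zeroOp_modStructure, addOp_modStructure, negOp_modStructure,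
    actOp_modStructure] at hax
  have hconst := fun (a : K) (ha : a ≠ 0) => hT _ (Or.inl (Or.inl (Or.inr ⟨a, ha, rfl⟩)))
  have hres := fun n => (realize_resAxiom S n).1 (hT _ (Or.inl (Or.inr ⟨n, rfl⟩)))
  have hhens := fun (r : TwistedPoly φ) (hr : r.IsSeparable) => hT _ (Or.inr ⟨r, hr, rfl⟩)
  have hdiv := fun (r : TwistedPoly φ) (hr : r ≠ 0) =>
    htor _ (Or.inl (Or.inl (Or.inr ⟨r, hr, rfl⟩)))
  have hfin := fun (r : TwistedPoly φ) (hr : (ann F r).Finite) =>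
    htor _ (Or.inl (Or.inr ⟨r, hr, rfl⟩))
  have hinfin := fun (r : TwistedPoly φ) (n : ℕ) (hr : (ann F r).Infinite) =>
    htor _ (Or.inr ⟨r, n, hr, rfl⟩)
  simp [Fin.snoc, hle, hinf, actOp_modStructure, Sentence.Realize, Formula.Realize] at hconst hhens hdiv
  obtain ⟨hsurj, htop, hadd, hsub, hinj, ht⟩ := hax
  have hvg : IsValuedGroup v :=
    { surjective := hsurj
      eq_top_iff := htop
      min_le_add := fun x y => min_le_iff.2 (hadd x y)
      min_le_sub := fun x y => by rw [sub_eq_add_neg]; exact min_le_iff.2 (hsub x y) }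
  have habove : ∀ γ : V, AboveTheta tauOp γ ↔ (γ ≤ tauOp γ ∧ γ < tauOp γ ∨ γ = ⊤) := fun γ =>
    or_congr ⟨fun h => ⟨h.le, h⟩, fun h => h.2⟩ Iff.rfl
  let H : HenselianModel φ fun r => (ann F r).encard :=
    { M := M
      V := V
      τ := tauOp
      v := v
      henselian :=
        { toIsValuedGroup := hvg
          t_injective := fun x y => hinj x y
          tauChain := hτ
          map_const := hconst
          map_t := ht
          henselian := fun r hr x hx => by
            obtain ⟨y, h1, h2⟩ := hhens r hr x ((habove _).1 hx)
            exact ⟨y, h1, (habove _).2 h2⟩ }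
      divisible := hdiv
      -- In the finite case the axioms bound the number of zeros from both sides; in the infinite
      -- case they exceed every natural number.
      encard_ann := fun r => by
        have h1 : ∀ n : ℕ, M ⊨ annGe r n ↔ (n : ℕ∞) ≤ (ann M r).encard := fun n =>
          realize_annGe r n
        by_cases hr : (ann F r).Finite
        · have h2 := hfin r hr
          rw [Sentence.Realize, Formula.realize_inf, Formula.realize_not] at h2
          have h3 := (h1 _).1 h2.1
          have h4 := fun h => h2.2 ((h1 _).2 h)
          rw [hr.cast_ncard_eq] at h3
          refine le_antisymm (not_lt.1 fun h5 => h4 ?_) h3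
          rw [Nat.cast_add, hr.cast_ncard_eq]
          exact Order.add_one_le_of_lt h5
        · rw [Set.Infinite.encard_eq hr, ENat.eq_top_iff_forall_ge]
          exact fun n => (h1 n).1 (hinfin r n hr)
      -- The predicates are taken over from the given structure, including their unspecified values
      -- at `∞`. This makes `H.toLStr` equal to `S`, not just isomorphic to it.
      res := resRel
      res_iff := fun n γ hγ => by
        rw [hres n γ (by rw [hinf]; exact hγ)]
        simp only [hle, addOp_modStructure, negOp_modStructure, ← sub_eq_add_neg,
          ← lt_iff_le_not_ge]
        rfl }
  refine ⟨H, ?_⟩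
  have hV : H.instValStructure = iV := by
    have h1 : ∀ x : Fin 1 → V, ![x 0] = x := fun x => funext fun i => by
      rw [Subsingleton.elim i 0]; rfl
    have h2 : ∀ x : Fin 2 → V, ![x 0, x 1] = x := fun x => by
      ext i
      fin_cases i <;> rfl
    ext n f x
    · cases f with
      | infty =>
        exact hinf.symm.trans
          (congrArg (@Structure.funMap valLang V iV 0 ValFunc.infty) (Subsingleton.elim _ _))
      | tau => exact congrArg (@Structure.funMap valLang V iV 1 ValFunc.tau) (h1 x)
    · cases f with
      | le =>
        exact (hle (x 0) (x 1)).symm.trans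
          (iff_of_eq (congrArg (@Structure.RelMap valLang V iV 2 ValRel.le) (h2 x)))
      | res k => exact iff_of_eq (congrArg (@Structure.RelMap valLang V iV 1 (ValRel.res k)) (h1 x))
  change LStr.mk (modStr := modStructure (TwistedPoly φ) M) (valStr := H.instValStructure) M V v = _
  rw [hV]

end ValMod

end

/-! ### From divisible henselian modules to models, and reduction of sentences to the value sort. -/

noncomputable section

open scoped RightActions

namespace ValMod

open FirstOrder FirstOrder.Language

variable {K : Type u} [Field K] {φ : K →+* K}

namespace HenselianModel

variable {c : TwistedPoly φ → ℕ∞} (H : HenselianModel φ c)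

theorem zeroOp_eq : zeroOp (TwistedPoly φ) H.M = 0 := rfl

theorem addOp_eq (a b : H.M) : addOp (TwistedPoly φ) a b = a + b := rfl

theorem negOp_eq (a : H.M) : negOp (TwistedPoly φ) a = -a := rfl

theorem actOp_eq (r : TwistedPoly φ) (a : H.M) : actOp r a = a <• r := rfl

theorem inftyOp_eq : inftyOp H.V = ⊤ := rfl

theorem tauOp_eq (a : H.V) : tauOp a = H.τ a := rfl

theorem leRel_iff (a b : H.V) : leRel a b ↔ a ≤ b := Iff.rfl

instance : valLang.OrderedStructure H.V := ⟨fun _ => Iff.rfl⟩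

theorem models_moduleTheory : ∀ σ ∈ moduleTheory (TwistedPoly φ), H.M ⊨ σ := by
  rintro σ (((hσ | ⟨r, rfl⟩) | ⟨r, s, rfl⟩) | ⟨r, s, rfl⟩)
  · rcases hσ with rfl | rfl | rfl | rfl | rfl
    · simp [Sentence.Realize, Formula.Realize, Fin.snoc, addOp_eq, add_assoc]
    · simp [Sentence.Realize, Formula.Realize, Fin.snoc, addOp_eq, add_comm]
    · simp [Sentence.Realize, Formula.Realize, Fin.snoc, addOp_eq, zeroOp_eq]
    · simp [Sentence.Realize, Formula.Realize, Fin.snoc, addOp_eq, zeroOp_eq, negOp_eq]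
    · simp [Sentence.Realize, Formula.Realize, Fin.snoc, actOp_eq]
  · simp [Sentence.Realize, Formula.Realize, Fin.snoc, addOp_eq, actOp_eq]
  · simp [Sentence.Realize, Formula.Realize, Fin.snoc, addOp_eq, actOp_eq, add_smul]
  · simp [Sentence.Realize, Formula.Realize, Fin.snoc, actOp_eq, mul_smul]

theorem models_tauChainTheory : ∀ σ ∈ tauChainTheory, H.V ⊨ σ := by
  have hτ := H.henselian.tauChain
  rintro σ (hσ | rfl | rfl | rfl | rfl)
  · exact (inferInstance : H.V ⊨ valLang.linearOrderTheory).realize_of_mem σ hσ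
  · simp [Sentence.Realize, Formula.Realize, inftyOp_eq]
  · simpa [Sentence.Realize, Formula.Realize, tauOp_eq, Fin.snoc] using
      fun a b h => hτ.strictMono h
  · simp [Sentence.Realize, Formula.Realize, inftyOp_eq, tauOp_eq, hτ.map_top]
  · simpa [Sentence.Realize, Formula.Realize, tauOp_eq, inftyOp_eq, Fin.snoc] using hτ.map_lt

theorem models_valuedModuleTheory : H.toLStr.Models (valuedModuleTheory φ) := by
  have hv := H.henselian
  rintro σ ((((⟨σ, hσ, rfl⟩ | ⟨σ, hσ, rfl⟩) | hσ) | ⟨a, ha, rfl⟩) | ⟨n, rfl⟩)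
  · exact (realize_modSentence H.toLStr σ).2 (H.models_moduleTheory σ hσ)
  · exact (realize_valSentence H.toLStr σ).2 (H.models_tauChainTheory σ hσ)
  · rcases hσ with rfl | rfl | rfl | rfl | rfl | rfl
    · simpa [Fin.snoc] using fun b => hv.surjective b
    · simpa [Fin.snoc, inftyOp_eq, zeroOp_eq] using hv.eq_top_iff
    · simpa [Fin.snoc, addOp_eq, leRel_iff] using hv.min_le_add
    · simpa [Fin.snoc, addOp_eq, negOp_eq, leRel_iff, sub_eq_add_neg] using hv.min_le_sub
    · simpa [Fin.snoc, actOp_eq] using fun a b h => hv.t_injective h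
    · simpa [Fin.snoc, actOp_eq, tauOp_eq] using hv.map_t
  · simpa [Fin.snoc, actOp_eq] using hv.map_const a ha
  · refine (realize_resAxiom H.toLStr n).2 fun γ hγ => ?_
    refine (H.res_iff n γ hγ).trans ?_
    simp only [leRel_iff, addOp_eq, negOp_eq, ← sub_eq_add_neg, ← lt_iff_le_not_ge]
    rfl

theorem models_henselTheory : H.toLStr.Models (henselTheory φ) := by
  rintro σ (hσ | ⟨r, hr, rfl⟩)
  · exact H.models_valuedModuleTheory σ hσ
  · have h := H.henselian.henselian r hr
    simp only [AboveTheta, lt_iff_le_not_ge] at h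
    simpa [Fin.snoc, leRel_iff, tauOp_eq, inftyOp_eq, actOp_eq] using h

theorem realize_annGe_iff (r : TwistedPoly φ) (n : ℕ) :
    H.M ⊨ annGe r n ↔ (n : ℕ∞) ≤ (ann H.M r).encard := realize_annGe r n

theorem models_torTheory [Nontrivial H.M] {F : Type u} [AddCommGroup F]
    [Module (TwistedPoly φ)ᵐᵒᵖ F] (hc : ∀ r, c r = (ann F r).encard) :
    ∀ σ ∈ torTheory (R := TwistedPoly φ) F, H.M ⊨ σ := by
  rintro σ ((((hσ | rfl) | ⟨r, hr, rfl⟩) | ⟨r, hr, rfl⟩) | ⟨r, n, hr, rfl⟩)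
  · exact H.models_moduleTheory σ hσ
  · simpa [Sentence.Realize, Formula.Realize, Fin.snoc, zeroOp_eq] using exists_ne (0 : H.M)
  · simpa [Sentence.Realize, Formula.Realize, Fin.snoc, actOp_eq] using H.divisible r hr
  · rw [Sentence.Realize, Formula.realize_inf, Formula.realize_not]
    refine ⟨(H.realize_annGe_iff r _).2 ?_, fun h => ?_⟩
    · rw [H.encard_ann, hc, hr.cast_ncard_eq]
    · have h1 := (H.realize_annGe_iff r _).1 h
      rw [H.encard_ann, hc, ← hr.cast_ncard_eq] at h1
      exact absurd (Nat.cast_le.1 h1) (by omega)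
  · refine (H.realize_annGe_iff r n).2 ?_
    rw [H.encard_ann, hc, Set.Infinite.encard_eq hr]
    exact le_top

/-- A sentence is equivalent to an `L_V`-sentence. -/
theorem exists_valSentence (c : TwistedPoly φ → ℕ∞) (σ : LSentence (TwistedPoly φ)) :
    ∃ σ' : valLang.Sentence, ∀ (H : HenselianModel φ c),
      σ.Realize H.toLStr Fin.elim0 Fin.elim0 ↔ H.V ⊨ σ' := by
  obtain ⟨ψ, hψ⟩ := isDefinable_realize (c := c) σ
  -- Without free variables every module term is closed, hence equal to `0`, and its value can be
  -- replaced by `∞`.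
  refine ⟨BoundedFormula.subst ψ fun _ => inftyT, fun H => (hψ H Fin.elim0 Fin.elim0).trans ?_⟩
  have hzero : ∀ s : (modLang (TwistedPoly φ)).Term (Fin 0),
      s.realize (Fin.elim0 : Fin 0 → H.M) = 0 := by
    intro s
    induction s with
    | var i => exact i.elim0
    | func f ts ih =>
      have h : ∀ i, (ts i).realize (Fin.elim0 : Fin 0 → H.M) = 0 := ih
      cases f with
      | zero => rfl
      | add =>
        change (ts 0).realize (Fin.elim0 : Fin 0 → H.M) + (ts 1).realize Fin.elim0 = 0
        rw [h, h, add_zero]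
      | neg =>
        change -(ts 0).realize (Fin.elim0 : Fin 0 → H.M) = 0
        rw [h, neg_zero]
      | act r =>
        change (ts 0).realize (Fin.elim0 : Fin 0 → H.M) <• r = 0
        rw [h, smul_zero]
  rw [Sentence.Realize, Formula.Realize, Formula.Realize, BoundedFormula.realize_subst]
  refine iff_of_eq (congrArg (fun z => BoundedFormula.Realize ψ z default) (funext fun o => ?_))
  rw [realize_inftyT]
  rcases o with s | i
  · rw [HenselianModel.assign, Sum.elim_inl, hzero, H.henselian.map_zero]
  · exact i.elim0

end HenselianModel

/-! ## The standard model -/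

/-- Distinct cosets correspond to incongruent representatives. This connects the quotient in the
interpretation of `R_n` with the first-order form used in the axioms. -/
theorem hasResidues_iff {M Δ : Type u} [AddCommGroup M] [LinearOrder Δ] [OrderTop Δ] {v : M → Δ}
    (hv : IsValuedGroup v) (n : ℕ) {γ : Δ} (hγ : γ ≠ ⊤) :
    (n : ℕ∞) ≤ ENat.card (hv.geBall γ ⧸ (hv.gtBall γ hγ).addSubgroupOf (hv.geBall γ)) ↔
      IsValuedGroup.HasResidues v n γ := by
  have hmk : ∀ a b : hv.geBall γ,
      (QuotientAddGroup.mk a : hv.geBall γ ⧸ (hv.gtBall γ hγ).addSubgroupOf (hv.geBall γ)) =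
        QuotientAddGroup.mk b ↔ γ < v (a.1 - b.1) := by
    intro a b
    rw [QuotientAddGroup.eq, AddSubgroup.mem_addSubgroupOf, hv.map_sub_comm]
    change γ < v (-a.1 + b.1) ↔ _
    rw [neg_add_eq_sub]
  rw [← Set.encard_univ, le_encard_iff]
  constructor
  · rintro ⟨x, -, hx⟩
    refine ⟨fun i => (x i).out.1, fun i => (x i).out.2, fun i j hij => ?_⟩
    rw [← hmk, QuotientAddGroup.out_eq', QuotientAddGroup.out_eq']
    exact hx i j hij
  · rintro ⟨a, ha, ha'⟩
    refine ⟨fun i => QuotientAddGroup.mk ⟨a i, ha i⟩, fun _ => Set.mem_univ _, fun i j hij => ?_⟩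
    rw [Ne, hmk]
    exact ha' i j hij

/-- A divisible henselian valued module, with given truth values of `R_n(∞)`. -/
@[reducible]
def standardModel {F Δ : Type u} [AddCommGroup F] [Module (TwistedPoly φ)ᵐᵒᵖ F] [LinearOrder Δ]
    [OrderTop Δ] {τ : Δ → Δ} {v : F → Δ} (hF : IsHenselianValuedModule φ τ v)
    (hdiv : IsDivisibleModule (TwistedPoly φ) F) (ρ : ℕ → Prop) :
    HenselianModel φ fun r => (ann F r).encard where
  M := F
  V := Δ
  τ := τ
  v := v
  henselian := hF
  divisible := hdiv
  encard_ann _ := rfl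
  res n γ := (γ = ⊤ ∧ ρ n) ∨ ∃ h : γ ≠ ⊤, (n : ℕ∞) ≤
    ENat.card (hF.geBall γ ⧸ (hF.gtBall γ h).addSubgroupOf (hF.geBall γ))
  res_iff n γ hγ := by
    rw [← hasResidues_iff hF.toIsValuedGroup n hγ]
    simp [hγ]

/-- `T_v` is defined through `valStructure`, so this identification is what makes the standard model
satisfy it. -/
theorem standardModel_instValStructure {F Δ : Type u} [AddCommGroup F] [Module (TwistedPoly φ)ᵐᵒᵖ F]
    [LinearOrder Δ] [OrderTop Δ] {τ : Δ → Δ} {v : F → Δ} (hF : IsHenselianValuedModule φ τ v)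
    (hdiv : IsDivisibleModule (TwistedPoly φ) F) (ρ : ℕ → Prop) :
    (standardModel hF hdiv ρ).instValStructure = valStructure τ hF.toIsValuedGroup ρ := by
  ext n f x
  · cases f <;> rfl
  · cases f <;> rfl

end ValMod

end

/-! ### Completeness and elimination of module quantifiers. -/

theorem mainTheorem2 {K : Type u} [Field K] (φ : K →+* K)
    {F Δ : Type u} [AddCommGroup F] [Module (TwistedPoly φ)ᵐᵒᵖ F] [Nontrivial F]
    [LinearOrder Δ] [OrderTop Δ] (τ : Δ → Δ) (v : F → Δ)
    (hF : IsHenselianValuedModule φ τ v) (hdiv : IsDivisibleModule (TwistedPoly φ) F)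
    (ρ : ℕ → Prop) :
    ValMod.IsCompleteTheory (ValMod.fullTheory φ τ hF.toIsValuedGroup ρ) ∧
    ∀ (m n : ℕ) (χ : ValMod.LFormula (TwistedPoly φ) m n),
      ∃ θ ∈ ValMod.ThetaV (TwistedPoly φ) m n,
        ValMod.EquivMod (ValMod.fullTheory φ τ hF.toIsValuedGroup ρ) χ θ := by
  have hT : ∀ S : ValMod.LStr (TwistedPoly φ),
      S.Models (ValMod.fullTheory φ τ hF.toIsValuedGroup ρ) →
      ∃ H : ValMod.HenselianModel φ fun r => (ValMod.ann F r).encard, H.toLStr = S :=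
    fun S hS => ValMod.exists_henselianModel S (fun σ hσ => hS σ (Or.inl (Or.inl hσ)))
      (fun σ hσ => hS σ (Or.inr hσ))
  let H₀ := ValMod.standardModel hF hdiv ρ
  refine ⟨⟨⟨H₀.toLStr, ?_⟩, fun σ => ?_⟩, fun m n χ => ?_⟩
  · rintro σ ((hσ | ⟨σ, hσ, rfl⟩) | ⟨σ, hσ, rfl⟩)
    · exact H₀.models_henselTheory σ hσ
    · refine (ValMod.realize_valSentence H₀.toLStr σ).2 ?_
      exact Eq.subst (motive := fun s => @FirstOrder.Language.Sentence.Realize ValMod.valLang Δ s σ)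
        (ValMod.standardModel_instValStructure hF hdiv ρ).symm hσ
    · have : Nontrivial H₀.M := (inferInstance : Nontrivial F)
      exact (ValMod.realize_modSentence H₀.toLStr σ).2
        (H₀.models_torTheory (fun _ => rfl) σ hσ)
  · obtain ⟨σ', hσ'⟩ := ValMod.HenselianModel.exists_valSentence
      (fun r => (ValMod.ann F r).encard) σ
    let _ := ValMod.valStructure τ hF.toIsValuedGroup ρ
    have hval : ∀ ξ : ValMod.valLang.Sentence, ξ.Realize Δ →
        ∀ H : ValMod.HenselianModel φ fun r => (ValMod.ann F r).encard,
        H.toLStr.Models (ValMod.fullTheory φ τ hF.toIsValuedGroup ρ) → ξ.Realize H.V :=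
      fun ξ hξ H hH => (ValMod.realize_valSentence H.toLStr ξ).1
        (hH _ (Or.inl (Or.inr ⟨ξ, hξ, rfl⟩)))
    -- The value set of `F` decides the reduced sentence. Since `T_v` is its complete theory, every
    -- model of the full theory agrees.
    by_cases h : σ'.Realize Δ
    · refine Or.inl fun S hS => ?_
      obtain ⟨H, rfl⟩ := hT S hS
      rintro _ rfl
      exact (hσ' H).2 (hval σ' h H hS)
    · refine Or.inr fun S hS => ?_
      obtain ⟨H, rfl⟩ := hT S hS
      rintro _ rfl
      exact fun h1 => hval σ'.not h H hS ((hσ' H).1 h1)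
  · obtain ⟨θ, hθ, h⟩ := ValMod.exists_thetaV (fun r => (ValMod.ann F r).encard) χ
    refine ⟨θ, hθ, fun S hS x y => ?_⟩
    obtain ⟨H, rfl⟩ := hT S hS
    exact h H x y
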